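/- Let $E$ be a Grothendieck topos, $A$ a sheaf of commutative rings on $E$, $B$ a sheaf of commutative $A$-algebras, and $J$ a sheaf of $B$-modules. Let $A\text{-}\mathrm{Alg}/B$ be the following site. Its objects are pairs $(U,C)$ with $U\in E$ and $C$ a sheaf of commutative $A_U$-algebras on $E/U$ equipped with an $A_U$-algebra map to $B_U$. A morphism $(U_1,C_1)\to(U_2,C_2)$ is a map $f:U_1\to U_2$ together with a map $C_1\to f^*C_2$ of $A_{U_1}$-algebras over $B_{U_1}$. A family $(U_i,C_i)\to(U,C)$ is covering if for every $V\to U$ and every finite set $\Lambda\subset\Gamma(V,C)$ there exist, locally in $V$, an index $i$, a map $V\to U_i$ over $U$ and a lift of $\Lambda$ to $\Gamma(V,C_i)$. Let $\underline{\mathrm{Der}}_A(B,J)$ be the presheaf of abelian groups $(U,C)\mapsto \mathrm{Der}_{A_U}(C,J_U)$ on this site. Let $\underline{\mathrm{Exal}}_A(B,J)$ be the category over $A\text{-}\mathrm{Alg}/B$ whose fibre over $(U,C)$ is the category of square-zero extensions of the $A_U$-algebra $C$ by the $C$-module $J_U$; a morphism over $(f,g):(U_1,C_1)\to(U_2,C_2)$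 from $C_1'$ to $C_2'$ is a map of $A_{U_1}$-algebras $C_1'\to f^*C_2'$ that is compatible with $g:C_1\to f^*C_2$ and the identity on $J_{U_1}$. Let $\mathrm{Exal}_A(B,J)$ be the category of square-zero extensions of the $A$-algebra $B$ by $J$ on $E$. Let $B\,\underline{\mathrm{Der}}_A(B,J)$ be the category over $A\text{-}\mathrm{Alg}/B$ whose fibre over $X$ is the category of torsors under the restriction of $\underline{\mathrm{Der}}_A(B,J)$ to the slice site over $X$ (the classifying stack). Then: 1. $\underline{\mathrm{Der}}_A(B,J)$ is a sheaf, and $\underline{\mathrm{Exal}}_A(B,J)$ and $B\,\underline{\mathrm{Der}}_A(B,J)$ are fibered categories over $A\text{-}\mathrm{Alg}/B$. 2. For an extension $C'$ of $C$ over $(U,C)$, the presheaf represented by $(U,C')\to(U,C)$ on the slice over $(U,C)$, on which derivations $\delta$ act by $s\mapsto s+\delta$, is a torsor under $\underline{\mathrm{Der}}_A(B,J)$, and the resulting functor $$\underline{\mathrm{Exal}}_A(B,J)\longrightarrow B\,\underline{\mathrm{Der}}_A(B,J)$$ is an equivalence of categories over $A\text{-}\mathrm{Alg}/B$. 3. For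 every $B'\in\mathrm{Exal}_A(B,J)$ the presheaf $(U,C)\mapsto\{A_U\text{-algebra maps } C\to B'_U \text{ over } B_U\}$ is a $\underline{\mathrm{Der}}_A(B,J)$-torsor on $A\text{-}\mathrm{Alg}/B$, and there is a bijection from the set of isomorphism classes of $\mathrm{Exal}_A(B,J)$ to $$H^1\bigl(A\text{-}\mathrm{Alg}/B,\ \underline{\mathrm{Der}}_A(B,J)\bigr)$$ that sends the class of $B'$ to the cohomology class of this torsor. -/

import Mathlib

open CategoryTheory Opposite Limits

universe u

namespace SqZero

section PshOver

universe v₁ u₁ v₂ u₂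

/-- A pair of an object `base` of `C` and a `D`-valued presheaf on the slice over `base`. -/
structure PshOver (C : Type u₁) [Category.{v₁} C] (D : Type u₂) [Category.{v₂} D] where
  base : C
  psh : (Over base)ᵒᵖ ⥤ D

namespace PshOver
variable {C : Type u₁} [Category.{v₁} C] {D : Type u₂} [Category.{v₂} D]

/-- A morphism of `C` between the bases, with a map from `X.psh` to the restriction of `Y.psh`. -/
structure Hom (X Y : PshOver C D) where
  base : X.base ⟶ Y.base
  app : X.psh ⟶ (Over.map base).op ⋙ Y.psh

/-- Restriction along a morphism `k : S ⟶ T` of objects over `X.base`. -/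
abbrev res (X : PshOver C D) {S T : C} (k : S ⟶ T) (t : T ⟶ X.base) (s : S ⟶ X.base)
    (h : k ≫ t = s) : X.psh.obj (op (Over.mk t)) ⟶ X.psh.obj (op (Over.mk s)) :=
  X.psh.map (Over.homMk k h : Over.mk s ⟶ Over.mk t).op

/-- The map which `f` induces from the sections of `X` over `t` to the sections of `Y` over
`s = t ≫ f.base`. -/
def Hom.at {X Y : PshOver C D} (f : Hom X Y) {T : C} (t : T ⟶ X.base) (s : T ⟶ Y.base)
    (h : t ≫ f.base = s) : X.psh.obj (op (Over.mk t)) ⟶ Y.psh.obj (op (Over.mk s)) :=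
  f.app.app (op (Over.mk t)) ≫
    Y.psh.map (Over.homMk (𝟙 T) (by simp [h]) :
      Over.mk s ⟶ (Over.map f.base).obj (Over.mk t)).op

lemma res_id (X : PshOver C D) {T : C} (t : T ⟶ X.base) (h : 𝟙 T ≫ t = t) :
    X.res (𝟙 T) t t h = 𝟙 _ :=
  X.psh.map_id _

lemma res_res (X : PshOver C D) {R S T : C} (j : R ⟶ S) (k : S ⟶ T) (t : T ⟶ X.base)
    (s : S ⟶ X.base) (r : R ⟶ X.base) (h : k ≫ t = s) (h' : j ≫ s = r) :
    X.res k t s h ≫ X.res j s r h' = X.res (j ≫ k) t r (by simp [h, h']) :=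
  (X.psh.map_comp _ _).symm

lemma Hom.ext {X Y : PshOver C D} {f g : Hom X Y} (hb : f.base = g.base)
    (h : ∀ ⦃T : C⦄ (t : T ⟶ X.base) (s : T ⟶ Y.base) (h : t ≫ f.base = s)
      (h' : t ≫ g.base = s), f.at t s h = g.at t s h') : f = g := by
  obtain ⟨f, φ⟩ := f
  obtain ⟨g, γ⟩ := g
  obtain rfl : f = g := hb
  congr 1
  ext T
  have e := h T.unop.hom _ rfl rfl
  have e' : ∀ (φ : X.psh ⟶ (Over.map f).op ⋙ Y.psh),
      Hom.at ⟨f, φ⟩ T.unop.hom (T.unop.hom ≫ f) rfl = φ.app T := fun φ =>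
    (congrArg (_ ≫ ·) (Y.psh.map_id _)).trans (Category.comp_id _)
  rwa [e', e'] at e

lemma Hom.at_eq {X Y : PshOver C D} (f : Hom X Y) {T : C} (t : T ⟶ X.base) :
    f.at t (t ≫ f.base) rfl = f.app.app (op (Over.mk t)) :=
  (congrArg (_ ≫ ·) (Y.psh.map_id _)).trans (Category.comp_id _)

lemma Hom.res_at {X Y : PshOver C D} (f : Hom X Y) {S T : C} (k : S ⟶ T) (t : T ⟶ X.base)
    (s : S ⟶ X.base) (t' : T ⟶ Y.base) (s' : S ⟶ Y.base) (h : k ≫ t = s)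
    (ht : t ≫ f.base = t') (hs : s ≫ f.base = s') :
    X.res k t s h ≫ f.at s s' hs =
      f.at t t' ht ≫ Y.res k t' s' (by rw [← hs, ← ht, ← h, Category.assoc]) := by
  subst h ht hs
  rw [at_eq, at_eq]
  exact f.app.naturality (Over.homMk k rfl : Over.mk (k ≫ t) ⟶ Over.mk t).op

def Hom.id (X : PshOver C D) : Hom X X where
  base := 𝟙 _
  app := Functor.whiskerRight (NatTrans.op (Over.mapId X.base).hom) X.psh

def Hom.comp {X Y Z : PshOver C D} (f : Hom X Y) (g : Hom Y Z) : Hom X Z where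
  base := f.base ≫ g.base
  app := f.app ≫ Functor.whiskerLeft (Over.map f.base).op g.app ≫
    Functor.whiskerRight (NatTrans.op (Over.mapComp f.base g.base).hom) Z.psh

lemma Hom.id_at (X : PshOver C D) {T : C} (t s : T ⟶ X.base) (h : t ≫ 𝟙 _ = s) :
    (Hom.id X).at t s h = X.res (𝟙 T) t s (by simpa using h) := by
  refine (X.psh.map_comp _ _).symm.trans (congrArg X.psh.map (Quiver.Hom.unop_inj ?_))
  ext
  exact Category.id_comp (𝟙 T)

lemma Hom.id_at_self (X : PshOver C D) {T : C} (t : T ⟶ X.base) (h : t ≫ 𝟙 _ = t) :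
    (Hom.id X).at t t h = 𝟙 _ :=
  (Hom.id_at X t t h).trans (res_id X t _)

lemma Hom.comp_at {X Y Z : PshOver C D} (f : Hom X Y) (g : Hom Y Z) {T : C} (t : T ⟶ X.base)
    (r : T ⟶ Y.base) (s : T ⟶ Z.base) (h : t ≫ f.base ≫ g.base = s) (hf : t ≫ f.base = r)
    (hg : r ≫ g.base = s) :
    (f.comp g).at t s h = f.at t r hf ≫ g.at r s hg := by
  subst hf hg
  rw [at_eq, at_eq]
  refine (Category.assoc _ _ _).trans (congrArg (_ ≫ ·) ((Category.assoc _ _ _).trans ?_))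
  refine (congrArg (_ ≫ ·) ?_).trans (Category.comp_id _)
  refine (Z.psh.map_comp _ _).symm.trans (Eq.trans ?_ (Z.psh.map_id _))
  refine (congrArg Z.psh.map (Quiver.Hom.unop_inj ?_))
  ext
  exact Category.id_comp (𝟙 T)

instance : Category (PshOver C D) where
  Hom := Hom
  id := Hom.id
  comp := Hom.comp
  id_comp {X Y} f := Hom.ext (Category.id_comp _) fun T t s h h' => by
    rw [Hom.comp_at _ _ t t s h (Category.comp_id t) h', Hom.id_at, res_id, Category.id_comp]
  comp_id {X Y} f := Hom.ext (Category.comp_id _) fun T t s h h' => by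
    rw [Hom.comp_at _ _ t s s h h' (Category.comp_id s), Hom.id_at, res_id, Category.comp_id]
  assoc {X Y Z W} f g h := Hom.ext (Category.assoc _ _ _) fun T t s e e' => by
    have e₂ : (t ≫ f.base ≫ g.base) ≫ h.base = s := e ▸ Category.assoc _ _ _
    have e₁ : (t ≫ f.base) ≫ g.base ≫ h.base = s := e' ▸ Category.assoc _ _ _
    rw [Hom.comp_at _ _ t (t ≫ f.base ≫ g.base) s e rfl e₂,
      Hom.comp_at f g t (t ≫ f.base) _ rfl rfl (Category.assoc _ _ _),
      Hom.comp_at _ _ t (t ≫ f.base) s e' rfl e₁,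
      Hom.comp_at g h (t ≫ f.base) (t ≫ f.base ≫ g.base) s e₁ (Category.assoc _ _ _) e₂,
      Category.assoc]

end PshOver

end PshOver


section Site

variable {E : Type (u + 1)} [Category.{u} E] {K : GrothendieckTopology E}

variable {A B : Sheaf K CommRingCat.{u}}

/-- The category `A-Alg/B` for a sheaf of `A`-algebras `φ : A ⟶ B`: pairs `(U, C)` of an object `U`
and a sheaf `C` of commutative `A_U`-algebras on the slice over `U` with a map to `B_U`. -/
structure AlgOver (φ : A ⟶ B) where
  base : E
  ring : Sheaf (K.over base) CommRingCat.{u}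
  str : A.over base ⟶ ring
  toB : ring ⟶ B.over base
  str_toB : str ≫ toB = (K.overPullback CommRingCat.{u} base).map φ

namespace AlgOver

variable {φ : A ⟶ B}

abbrev toPsh (X : AlgOver φ) : PshOver E CommRingCat.{u} where
  base := X.base
  psh := X.ring.obj

/-- The sections `Γ(T, C)` of `X = (U, C)` over `t : T ⟶ U`. -/
abbrev sec (X : AlgOver φ) {T : E} (t : T ⟶ X.base) : CommRingCat.{u} :=
  X.ring.obj.obj (op (Over.mk t))

def strAt (X : AlgOver φ) {T : E} (t : T ⟶ X.base) : A.obj.obj (op T) ⟶ X.sec t :=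
  X.str.hom.app (op (Over.mk t))

def toBAt (X : AlgOver φ) {T : E} (t : T ⟶ X.base) : X.sec t ⟶ B.obj.obj (op T) :=
  X.toB.hom.app (op (Over.mk t))

/-- A morphism `(U₁, C₁) ⟶ (U₂, C₂)`: a map `f : U₁ ⟶ U₂` and a map `C₁ ⟶ f^* C₂` of `A`-algebras
over `B`. -/
@[ext]
structure Hom (X Y : AlgOver φ) where
  hom : PshOver.Hom X.toPsh Y.toPsh
  strAt_at : ∀ ⦃T : E⦄ (t : T ⟶ X.base) (s : T ⟶ Y.base) (h : t ≫ hom.base = s),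
    X.strAt t ≫ hom.at t s h = Y.strAt s
  at_toBAt : ∀ ⦃T : E⦄ (t : T ⟶ X.base) (s : T ⟶ Y.base) (h : t ≫ hom.base = s),
    hom.at t s h ≫ Y.toBAt s = X.toBAt t

lemma strAt_res (X : AlgOver φ) {S T : E} (k : S ⟶ T) (t : T ⟶ X.base) (s : S ⟶ X.base)
    (h : k ≫ t = s) : X.strAt t ≫ X.toPsh.res k t s h = A.obj.map k.op ≫ X.strAt s :=
  (X.str.hom.naturality (Over.homMk k h : Over.mk s ⟶ Over.mk t).op).symm

lemma res_toBAt (X : AlgOver φ) {S T : E} (k : S ⟶ T) (t : T ⟶ X.base) (s : S ⟶ X.base)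
    (h : k ≫ t = s) : X.toPsh.res k t s h ≫ X.toBAt s = X.toBAt t ≫ B.obj.map k.op :=
  X.toB.hom.naturality (Over.homMk k h : Over.mk s ⟶ Over.mk t).op

def Hom.id (X : AlgOver φ) : Hom X X where
  hom := PshOver.Hom.id X.toPsh
  strAt_at T t s h := by
    have : t = s := (Category.comp_id t).symm.trans h
    subst this
    exact (congrArg (_ ≫ ·) (PshOver.Hom.id_at_self X.toPsh t h)).trans (Category.comp_id _)
  at_toBAt T t s h := by
    have : t = s := (Category.comp_id t).symm.trans h
    subst this
    exact (congrArg (· ≫ _) (PshOver.Hom.id_at_self X.toPsh t h)).trans (Category.id_comp _)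

def Hom.comp {X Y Z : AlgOver φ} (f : Hom X Y) (g : Hom Y Z) : Hom X Z where
  hom := f.hom.comp g.hom
  strAt_at T t s h := by
    have h' : (t ≫ f.hom.base) ≫ g.hom.base = s := (Category.assoc _ _ _).trans h
    rw [PshOver.Hom.comp_at f.hom g.hom t _ s h rfl h', ← Category.assoc, f.strAt_at, g.strAt_at]
  at_toBAt T t s h := by
    have h' : (t ≫ f.hom.base) ≫ g.hom.base = s := (Category.assoc _ _ _).trans h
    rw [PshOver.Hom.comp_at f.hom g.hom t _ s h rfl h', Category.assoc, g.at_toBAt, f.at_toBAt]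

instance : Category.{u + 1} (AlgOver φ) where
  Hom := Hom
  id := Hom.id
  comp := Hom.comp
  id_comp f := Hom.ext (Category.id_comp (obj := PshOver E CommRingCat.{u}) f.hom)
  comp_id f := Hom.ext (Category.comp_id (obj := PshOver E CommRingCat.{u}) f.hom)
  assoc f g h := Hom.ext (Category.assoc (obj := PshOver E CommRingCat.{u}) (Hom.hom f) (Hom.hom g) (Hom.hom h))

def Hom.bs {X Y : AlgOver φ} (f : X ⟶ Y) : X.base ⟶ Y.base :=
  (Hom.hom f).base

def Hom.at {X Y : AlgOver φ} (f : X ⟶ Y) {T : E} (t : T ⟶ X.base) (s : T ⟶ Y.base)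
    (h : t ≫ Hom.bs f = s) : X.sec t ⟶ Y.sec s :=
  (Hom.hom f).at t s h

/-- For a sieve `S` on `X = (U, C)`, a map `f : V ⟶ U` and a set `Λ` of sections of `C` over `V`, the
sieve of all `k : W ⟶ V` for which there are a member `(U', C') ⟶ (U, C)` of `S` and a map `W ⟶ U'`
over `U` such that the restrictions to `W` of the sections in `Λ` lift to `C'`. -/
def liftSieve {X : AlgOver φ} (S : Sieve X) {V : E} (f : V ⟶ X.base) (Λ : Set (X.sec f)) :
    Sieve V where
  arrows W k := ∃ (Y : AlgOver φ) (g : Y ⟶ X) (_ : S g) (m : W ⟶ Y.base)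
    (w : m ≫ Hom.bs g = k ≫ f), ∀ x ∈ Λ, ∃ y : Y.sec m,
      Hom.at g m (k ≫ f) w y = X.toPsh.res k f (k ≫ f) rfl x
  downward_closed := by
    rintro W W' k ⟨Y, g, hg, m, w, H⟩ j
    refine ⟨Y, g, hg, j ≫ m, by rw [Category.assoc, w, Category.assoc], fun x hx => ?_⟩
    obtain ⟨y, hy⟩ := H x hx
    refine ⟨Y.toPsh.res j m (j ≫ m) rfl y, ?_⟩
    have e₁ := congr($(PshOver.Hom.res_at (Hom.hom g) j m (j ≫ m) (k ≫ f) ((j ≫ k) ≫ f) rfl w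
      (by rw [Category.assoc, Category.assoc]; exact congrArg (j ≫ ·) w)) y)
    have e₂ := congr($(PshOver.res_res X.toPsh j k f (k ≫ f) ((j ≫ k) ≫ f) rfl (by simp)) x)
    refine e₁.trans (Eq.trans ?_ e₂)
    exact congrArg (X.toPsh.res j (k ≫ f) ((j ≫ k) ≫ f) (by simp)) hy


lemma Hom.res_at {X Y : AlgOver φ} (f : X ⟶ Y) {S T : E} (k : S ⟶ T) (t : T ⟶ X.base)
    (s : S ⟶ X.base) (t' : T ⟶ Y.base) (s' : S ⟶ Y.base) (h : k ≫ t = s)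
    (ht : t ≫ Hom.bs f = t') (hs : s ≫ Hom.bs f = s') (h' : k ≫ t' = s') :
    X.toPsh.res k t s h ≫ Hom.at f s s' hs = Hom.at f t t' ht ≫ Y.toPsh.res k t' s' h' :=
  PshOver.Hom.res_at (Hom.hom f) k t s t' s' h ht hs

lemma Hom.at_comp {X Y Z : AlgOver φ} (f : X ⟶ Y) (g : Y ⟶ Z) {T : E} (t : T ⟶ X.base)
    (r : T ⟶ Y.base) (s : T ⟶ Z.base) (h : t ≫ Hom.bs (f ≫ g) = s) (hf : t ≫ Hom.bs f = r)
    (hg : r ≫ Hom.bs g = s) :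
    Hom.at (f ≫ g) t s h = Hom.at f t r hf ≫ Hom.at g r s hg :=
  PshOver.Hom.comp_at (Hom.hom f) (Hom.hom g) t r s h hf hg

lemma Hom.hext {X Y : AlgOver φ} {f g : X ⟶ Y} (hb : Hom.bs f = Hom.bs g)
    (h : ∀ ⦃T : E⦄ (t : T ⟶ X.base) (s : T ⟶ Y.base) (h : t ≫ Hom.bs f = s)
      (h' : t ≫ Hom.bs g = s), Hom.at f t s h = Hom.at g t s h') : f = g :=
  Hom.ext (PshOver.Hom.ext hb h)

/-- The restriction of `X.ring` along `m`. -/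
abbrev pullRing (X : AlgOver φ) {W : E} (m : W ⟶ X.base) : Sheaf (K.over W) CommRingCat.{u} :=
  (K.overMapPullback CommRingCat.{u} m).obj X.ring

def pullStr (X : AlgOver φ) {W : E} (m : W ⟶ X.base) : A.over W ⟶ X.pullRing m where
  hom :=
    { app := fun T => X.strAt (T.unop.hom ≫ m)
      naturality := fun S T k => (X.strAt_res k.unop.left (S.unop.hom ≫ m) (T.unop.hom ≫ m)
        (by rw [← Category.assoc, Over.w])).symm }

def pullToB (X : AlgOver φ) {W : E} (m : W ⟶ X.base) : X.pullRing m ⟶ B.over W where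
  hom :=
    { app := fun T => X.toBAt (T.unop.hom ≫ m)
      naturality := fun S T k => X.res_toBAt k.unop.left (S.unop.hom ≫ m) (T.unop.hom ≫ m)
        (by rw [← Category.assoc, Over.w]) }

def pullMap {X Y : AlgOver φ} (f : X ⟶ Y) {W : E} (m : W ⟶ X.base) (n : W ⟶ Y.base)
    (h : m ≫ Hom.bs f = n) : X.pullRing m ⟶ Y.pullRing n where
  hom :=
    { app := fun T => Hom.at f (T.unop.hom ≫ m) (T.unop.hom ≫ n) (by rw [Category.assoc, h])
      naturality := fun S T k => Hom.res_at f k.unop.left (S.unop.hom ≫ m) (T.unop.hom ≫ m)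
        (S.unop.hom ≫ n) (T.unop.hom ≫ n) (by rw [← Category.assoc, Over.w]) _ _
        (by rw [← Category.assoc, Over.w]) }

lemma pullStr_pullMap {X Y : AlgOver φ} (f : X ⟶ Y) {W : E} (m : W ⟶ X.base) (n : W ⟶ Y.base)
    (h : m ≫ Hom.bs f = n) : X.pullStr m ≫ pullMap f m n h = Y.pullStr n := by
  ext T : 3
  exact Hom.strAt_at f (T.unop.hom ≫ m) (T.unop.hom ≫ n) (by rw [Category.assoc]; exact congrArg _ h)

lemma pullMap_pullToB {X Y : AlgOver φ} (f : X ⟶ Y) {W : E} (m : W ⟶ X.base) (n : W ⟶ Y.base)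
    (h : m ≫ Hom.bs f = n) : pullMap f m n h ≫ Y.pullToB n = X.pullToB m := by
  ext T : 3
  exact Hom.at_toBAt f (T.unop.hom ≫ m) (T.unop.hom ≫ n) (by rw [Category.assoc]; exact congrArg _ h)

lemma pullStr_pullToB (X : AlgOver φ) {W : E} (m : W ⟶ X.base) :
    X.pullStr m ≫ X.pullToB m = (K.overPullback CommRingCat.{u} W).map φ := by
  ext T : 3
  exact congr(($(X.str_toB)).hom.app (op (Over.mk (T.unop.hom ≫ m))))

/-- An algebra over `W` with a map to the restriction of `X.ring`, as an object over `X`. -/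
def ofMap (X : AlgOver φ) {W : E} (m : W ⟶ X.base) (R : Sheaf (K.over W) CommRingCat.{u})
    (a : A.over W ⟶ R) (b : R ⟶ X.pullRing m) (w : a ≫ b = X.pullStr m) : AlgOver φ where
  base := W
  ring := R
  str := a
  toB := b ≫ X.pullToB m
  str_toB := by rw [← Category.assoc, w, pullStr_pullToB]

/-- A morphism of `AlgOver φ` from a map of algebras over `X.base`. -/
def homMk {X Y : AlgOver φ} (b : X.base ⟶ Y.base) (c : X.ring ⟶ Y.pullRing b)
    (h₁ : X.str ≫ c = Y.pullStr b) (h₂ : c ≫ Y.pullToB b = X.toB) : X ⟶ Y where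
  hom := ⟨b, c.hom⟩
  strAt_at T t s h := by
    subst h
    exact (congrArg (_ ≫ ·) (PshOver.Hom.at_eq (X := X.toPsh) (Y := Y.toPsh) ⟨b, c.hom⟩ t)).trans
      congr(($h₁).hom.app (op (Over.mk t)))
  at_toBAt T t s h := by
    subst h
    exact (congrArg (· ≫ _) (PshOver.Hom.at_eq (X := X.toPsh) (Y := Y.toPsh) ⟨b, c.hom⟩ t)).trans
      congr(($h₂).hom.app (op (Over.mk t)))

lemma homMk_at {X Y : AlgOver φ} (b : X.base ⟶ Y.base) (c : X.ring ⟶ Y.pullRing b)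
    (h₁ : X.str ≫ c = Y.pullStr b) (h₂ : c ≫ Y.pullToB b = X.toB) {T : E} (t : T ⟶ X.base) :
    Hom.at (homMk b c h₁ h₂) t (t ≫ b) rfl = c.hom.app (op (Over.mk t)) :=
  PshOver.Hom.at_eq (X := X.toPsh) (Y := Y.toPsh) ⟨b, c.hom⟩ t

lemma exists_isPullback {D : Type (u + 1)} [Category.{u} D] {L : GrothendieckTopology D}
    {F G H : Sheaf L CommRingCat.{u}} (f : F ⟶ H) (g : G ⟶ H) :
    ∃ (R : Sheaf L CommRingCat.{u}) (c : R ⟶ F) (d : R ⟶ G), IsPullback c d f g :=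
  ⟨_, _, _, IsPullback.of_hasPullback f g⟩

lemma exists_section {D : Type (u + 1)} [Category.{u} D] {L : GrothendieckTopology D}
    {R F G H : Sheaf L CommRingCat.{u}} {c : R ⟶ F} {d : R ⟶ G} {f : F ⟶ H} {g : G ⟶ H}
    (P : IsPullback c d f g) (T : Dᵒᵖ) (x : F.obj.obj T) (y : G.obj.obj T)
    (h : f.hom.app T x = g.hom.app T y) :
    ∃ z : R.obj.obj T, c.hom.app T z = x ∧ d.hom.app T z = y :=
  Types.exists_of_isPullback (P.map
    (sheafToPresheaf L CommRingCat.{u} ⋙ (evaluation _ _).obj T ⋙ forget CommRingCat.{u})) x y h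

lemma exists_fibre_product {X Y Z : AlgOver φ} (f : X ⟶ Z) (g : Y ⟶ Z) {W : E}
    (m : W ⟶ X.base) (n : W ⟶ Y.base) (r : W ⟶ Z.base) (hm : m ≫ Hom.bs f = r)
    (hn : n ≫ Hom.bs g = r) :
    ∃ (P : AlgOver φ) (p : P ⟶ X) (q : P ⟶ Y) (j : W ⟶ P.base) (hp : j ≫ Hom.bs p = m)
      (hq : j ≫ Hom.bs q = n), p ≫ f = q ≫ g ∧
      ∀ (x : X.sec m) (y : Y.sec n), Hom.at f m r hm x = Hom.at g n r hn y →
        ∃ z : P.sec j, Hom.at p j m hp z = x ∧ Hom.at q j n hq z = y := by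
  have hst : X.pullStr m ≫ pullMap f m r hm = Y.pullStr n ≫ pullMap g n r hn := by
    rw [pullStr_pullMap, pullStr_pullMap]
  obtain ⟨R, c, d, H⟩ := exists_isPullback (pullMap f m r hm) (pullMap g n r hn)
  let P : AlgOver φ := X.ofMap m _ (H.lift _ _ hst) c (H.lift_fst _ _ _)
  have hd : d ≫ Y.pullToB n = P.toB := by
    change _ = c ≫ X.pullToB m
    rw [← pullMap_pullToB f m r hm, ← Category.assoc, H.w, Category.assoc, pullMap_pullToB]
  let p : P ⟶ X := homMk (X := P) m c (H.lift_fst _ _ _) rfl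
  let q : P ⟶ Y := homMk (X := P) n d (H.lift_snd _ _ _) hd
  have hp {T : E} (t : T ⟶ W) : Hom.at p t (t ≫ m) rfl = c.hom.app (op (Over.mk t)) :=
    homMk_at (X := P) m c _ _ t
  have hq {T : E} (t : T ⟶ W) : Hom.at q t (t ≫ n) rfl = d.hom.app (op (Over.mk t)) :=
    homMk_at (X := P) n d _ _ t
  refine ⟨P, p, q, 𝟙 W, Category.id_comp _, Category.id_comp _, ?_, ?_⟩
  · refine Hom.hext (hm.trans hn.symm) fun T t s h h' => ?_
    have e₁ : (t ≫ m) ≫ Hom.bs f = s := (Category.assoc _ _ _).trans h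
    have e₂ : (t ≫ n) ≫ Hom.bs g = s := (Category.assoc _ _ _).trans h'
    have e : t ≫ r = s := by rw [← hm]; exact h
    subst e
    rw [Hom.at_comp p f t (t ≫ m) _ h rfl e₁, Hom.at_comp q g t (t ≫ n) _ h' rfl e₂]
    exact (congrArg (· ≫ _) (hp t)).trans
      (Eq.trans congr(($(H.w)).hom.app (op (Over.mk t))) (congrArg (· ≫ _) (hq t)).symm)
  · intro x y hxy
    have em : 𝟙 W ≫ m = m := Category.id_comp m
    have en : 𝟙 W ≫ n = n := Category.id_comp n
    have er : 𝟙 W ≫ r = r := Category.id_comp r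
    obtain ⟨z, hz, hz'⟩ := exists_section H (op (Over.mk (𝟙 W)))
      (X.toPsh.res (𝟙 W) m (𝟙 W ≫ m) rfl x) (Y.toPsh.res (𝟙 W) n (𝟙 W ≫ n) rfl y) (by
        have h₁ := congr($(Hom.res_at f (𝟙 W) m (𝟙 W ≫ m) r (𝟙 W ≫ r) rfl hm
          (by rw [em, er, hm]) rfl) x)
        have h₂ := congr($(Hom.res_at g (𝟙 W) n (𝟙 W ≫ n) r (𝟙 W ≫ r) rfl hn
          (by rw [en, er, hn]) rfl) y)
        exact h₁.trans ((congrArg (Z.toPsh.res (𝟙 W) r (𝟙 W ≫ r) rfl) hxy).trans h₂.symm))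
    have key {V : AlgOver φ} (v : P ⟶ V) (l : W ⟶ V.base) (h : 𝟙 W ≫ Hom.bs v = l)
        (l' : W ⟶ V.base) (h' : 𝟙 W ≫ Hom.bs v = l') (a : V.sec l)
        (ha : Hom.at v (𝟙 W) l' h' z = V.toPsh.res (𝟙 W) l l' (by rw [← h', h]; simp) a) :
        Hom.at v (𝟙 W) l h z = a := by
      obtain rfl : l = l' := h.symm.trans h'
      exact ha.trans congr($(PshOver.res_id V.toPsh l _) a)
    exact ⟨z, key p m _ (𝟙 W ≫ m) rfl x (congr($(hp (𝟙 W)) z).trans hz),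
      key q n _ (𝟙 W ≫ n) rfl y (congr($(hq (𝟙 W)) z).trans hz')⟩

/-- A sieve on `(U, C)` is covering if, for all `V ⟶ U`, any finite set of sections of `C` over `V` lifts
to the members of the sieve locally on `V`. -/
def topology (φ : A ⟶ B) : GrothendieckTopology (AlgOver φ) where
  sieves X := {S | ∀ ⦃V : E⦄ (f : V ⟶ X.base) (Λ : Set (X.sec f)), Λ.Finite →
    liftSieve S f Λ ∈ K V}
  top_mem' X V f Λ _ := by
    convert K.top_mem V
    ext W k
    refine iff_of_true ⟨X, 𝟙 X, trivial, k ≫ f, Category.comp_id _, fun x hx =>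
      ⟨X.toPsh.res k f (k ≫ f) rfl x, ?_⟩⟩ trivial
    exact congr($(PshOver.Hom.id_at_self X.toPsh (k ≫ f) _) _)
  pullback_stable' X X' S h hS V f Λ hΛ := by
    refine K.superset_covering ?_ (hS (f ≫ Hom.bs h) (Hom.at h f _ rfl '' Λ) (hΛ.image _))
    rintro W k ⟨Y, g, hg, m, w, H⟩
    obtain ⟨P, p, q, j, hp, hq, e, he⟩ := exists_fibre_product g h m (k ≫ f) _ w
      (Category.assoc _ _ _)
    refine ⟨P, q, ?_, j, hq, fun x hx => ?_⟩
    · change S (q ≫ h)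
      rw [← e]
      exact S.downward_closed hg p
    · obtain ⟨y, hy⟩ := H _ ⟨x, hx, rfl⟩
      obtain ⟨z, -, hz⟩ := he y (X'.toPsh.res k f (k ≫ f) rfl x) (hy.trans
        congr($(Hom.res_at h k f (k ≫ f) _ (k ≫ f ≫ Hom.bs h) rfl rfl (Category.assoc _ _ _)
          rfl) x).symm)
      exact ⟨z, hz⟩
  transitive' X S hS R hR V f Λ hΛ := by
    refine K.transitive (hS f Λ hΛ) _ ?_
    rintro W k ⟨Y, g, hg, m, w, H⟩
    choose! y hy using H
    refine K.superset_covering ?_ (hR hg m (y '' Λ) (hΛ.image _))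
    rintro W' j ⟨Z, h, hh, m', w', H'⟩
    refine ⟨Z, h ≫ g, hh, m', ?_, fun x hx => ?_⟩
    · change m' ≫ Hom.bs h ≫ Hom.bs g = _
      rw [← Category.assoc, w', Category.assoc, w, Category.assoc]
    · obtain ⟨z, hz⟩ := H' _ ⟨x, hx, rfl⟩
      refine ⟨z, ?_⟩
      have e : (j ≫ m) ≫ Hom.bs g = (j ≫ k) ≫ f := by
        rw [Category.assoc, w, Category.assoc]
      have e₁ := congr($(Hom.at_comp h g m' (j ≫ m) ((j ≫ k) ≫ f)
        (by change m' ≫ Hom.bs h ≫ Hom.bs g = _; rw [← Category.assoc, w', e]) w' e) z)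
      have e₂ := congr($(Hom.res_at g j m (j ≫ m) (k ≫ f) ((j ≫ k) ≫ f) rfl w e
        (Category.assoc _ _ _).symm) (y x))
      have e₃ := congr($(PshOver.res_res X.toPsh j k f (k ≫ f) ((j ≫ k) ≫ f) rfl
        (Category.assoc _ _ _).symm) x)
      refine e₁.trans ((congrArg (Hom.at g (j ≫ m) _ e) hz).trans (e₂.trans (Eq.trans ?_ e₃)))
      exact congrArg (X.toPsh.res j (k ≫ f) ((j ≫ k) ≫ f) _) (hy x hx)


variable (M : PresheafOfModules.{u} (B.obj ⋙ forget₂ CommRingCat.{u} RingCat.{u}))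

/-- For `X = (U, C)`, the restriction of the `B`-module `M` to the slice over `U`, as a `C`-module. -/
noncomputable def mod (X : AlgOver φ) :
    PresheafOfModules.{u} (X.ring.obj ⋙ forget₂ CommRingCat.{u} RingCat.{u}) :=
  (PresheafOfModules.pushforward (F := Over.forget X.base)
    (R := B.obj ⋙ forget₂ CommRingCat.{u} RingCat.{u})
    (Functor.whiskerRight X.toB.hom (forget₂ CommRingCat.{u} RingCat.{u}))).obj M

end AlgOver

section Derivation

variable {D : Type (u + 1)} [Category.{u} D] {S R : Dᵒᵖ ⥤ CommRingCat.{u}}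
  {N : PresheafOfModules.{u} (R ⋙ forget₂ CommRingCat.{u} RingCat.{u})} {φ : S ⟶ R}

namespace Derivation

instance : Zero (N.Derivation' φ) := ⟨{ d := 0 }⟩

instance : Add (N.Derivation' φ) where
  add d e :=
    { d := d.d + e.d
      d_mul := fun a b => by
        simp only [AddMonoidHom.add_apply, d.d_mul, e.d_mul, smul_add]
        abel
      d_map := fun f x => by
        simp only [AddMonoidHom.add_apply, d.d_map, e.d_map, map_add]
        rfl
      d_app := fun a => by
        exact (congrArg₂ (· + ·) (PresheafOfModules.Derivation'.d_app d a)
          (PresheafOfModules.Derivation'.d_app e a)).trans (add_zero 0) }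

instance : Neg (N.Derivation' φ) where
  neg d :=
    { d := -d.d
      d_mul := fun a b => by
        simp only [AddMonoidHom.neg_apply, d.d_mul, smul_neg, neg_add]
      d_map := fun f x => by
        simp only [AddMonoidHom.neg_apply, d.d_map, map_neg]
        rfl
      d_app := fun a => by
        exact (congrArg Neg.neg (PresheafOfModules.Derivation'.d_app d a)).trans neg_zero }

lemma hext {d e : N.Derivation' φ} (h : ∀ (T : Dᵒᵖ) (x : R.obj T), d.d x = e.d x) : d = e := by
  refine PresheafOfModules.Derivation.ext ?_
  funext T
  exact AddMonoidHom.ext (h T)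

instance : AddCommGroup (N.Derivation' φ) :=
  { AddGroup.ofLeftAxioms (fun _ _ _ => hext fun _ _ => add_assoc _ _ _)
      (fun _ => hext fun _ _ => zero_add _)
      (fun _ => hext fun _ _ => neg_add_cancel _) with
    add_comm := fun _ _ => hext fun _ _ => add_comm _ _ }

end Derivation

end Derivation

namespace AlgOver

variable {φ : A ⟶ B} (M : PresheafOfModules.{u} (B.obj ⋙ forget₂ CommRingCat.{u} RingCat.{u}))

/-- `Der_A(C, M)` for `X = (U, C)`: the `A`-derivations of `C` with values in `M`. -/
abbrev Der (X : AlgOver φ) : Type (u + 1) := (X.mod M).Derivation' X.str.hom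

variable {M}

def Der.at {X : AlgOver φ} (δ : X.Der M) {T : E} (t : T ⟶ X.base) :
    X.sec t →+ M.obj (op T) :=
  δ.d (X := op (Over.mk t))

lemma Der.at_mul {X : AlgOver φ} (δ : X.Der M) {T : E} (t : T ⟶ X.base) (a b : X.sec t) :
    Der.at δ t (a * b) = X.toBAt t a • Der.at δ t b + X.toBAt t b • Der.at δ t a :=
  δ.d_mul (X := op (Over.mk t)) a b

lemma Der.at_one {X : AlgOver φ} (δ : X.Der M) {T : E} (t : T ⟶ X.base) :
    Der.at δ t 1 = 0 :=
  δ.d_one (op (Over.mk t))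

lemma Der.at_strAt {X : AlgOver φ} (δ : X.Der M) {T : E} (t : T ⟶ X.base) (a : A.obj.obj (op T)) :
    Der.at δ t (X.strAt t a) = 0 :=
  PresheafOfModules.Derivation'.d_app δ (X := op (Over.mk t)) a

lemma Der.at_res {X : AlgOver φ} (δ : X.Der M) {S T : E} (k : S ⟶ T) (t : T ⟶ X.base)
    (s : S ⟶ X.base) (h : k ≫ t = s) (x : X.sec t) :
    Der.at δ s (X.toPsh.res k t s h x) = M.map k.op (Der.at δ t x) :=
  δ.d_map (Over.homMk k h : Over.mk s ⟶ Over.mk t).op x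

lemma Der.hext {X : AlgOver φ} {δ ε : X.Der M}
    (h : ∀ ⦃T : E⦄ (t : T ⟶ X.base) (x : X.sec t), Der.at δ t x = Der.at ε t x) : δ = ε :=
  Derivation.hext fun T x => h T.unop.hom x

/-- The derivation `c ↦ δ (f c)`. -/
noncomputable def Der.comp {X Y : AlgOver φ} (f : X ⟶ Y) (δ : Y.Der M) : X.Der M where
  d {T} := (Der.at δ (T.unop.hom ≫ Hom.bs f)).comp
    (Hom.at f T.unop.hom _ rfl).hom.toAddMonoidHom
  d_mul {T} a b := by
    have e (c : X.sec T.unop.hom) := congr($(Hom.at_toBAt f T.unop.hom _ rfl) c)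
    refine (congrArg (Der.at δ _) (map_mul (Hom.at f T.unop.hom _ rfl).hom a b)).trans ((Der.at_mul δ _ _ _).trans ?_)
    exact congrArg₂ (· + ·)
      (congrArg (fun c : B.obj.obj (op T.unop.left) =>
        c • Der.at δ _ (Hom.at f T.unop.hom _ rfl b)) (e a))
      (congrArg (fun c : B.obj.obj (op T.unop.left) =>
        c • Der.at δ _ (Hom.at f T.unop.hom _ rfl a)) (e b))
  d_map {S T} k x := by
    have e := congr($(Hom.res_at f k.unop.left S.unop.hom T.unop.hom (S.unop.hom ≫ Hom.bs f)
      (T.unop.hom ≫ Hom.bs f) (Over.w _) rfl rfl (by rw [← Category.assoc, Over.w])) x)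
    exact (congrArg (Der.at δ _) e).trans (Der.at_res δ _ _ _ _ _)
  d_app {T} a := by
    have e := congr($(Hom.strAt_at f T.unop.hom _ rfl) a)
    exact (congrArg (Der.at δ _) e).trans (Der.at_strAt δ _ _)

lemma Der.comp_at {X Y : AlgOver φ} (f : X ⟶ Y) (δ : Y.Der M) {T : E} (t : T ⟶ X.base)
    (s : T ⟶ Y.base) (h : t ≫ Hom.bs f = s) (x : X.sec t) :
    Der.at (Der.comp f δ) t x = Der.at δ s (Hom.at f t s h x) := by
  subst h
  rfl

end AlgOver

/-- The presheaf of abelian groups `(U, C) ↦ Der_A(C, M)` on `A-Alg/B`. -/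
noncomputable def derPresheaf (φ : A ⟶ B)
    (M : PresheafOfModules.{u} (B.obj ⋙ forget₂ CommRingCat.{u} RingCat.{u})) :
    (AlgOver φ)ᵒᵖ ⥤ AddCommGrpCat.{u + 1} where
  obj X := AddCommGrpCat.of (X.unop.Der M)
  map f := AddCommGrpCat.ofHom
    (AddMonoidHom.mk' (AlgOver.Der.comp f.unop) fun _ _ => AlgOver.Der.hext fun _ _ _ => rfl)
  map_id X := by
    refine AddCommGrpCat.hom_ext (AddMonoidHom.ext fun δ => ?_)
    refine AlgOver.Der.hext fun T t x => ?_
    have e := AlgOver.Der.comp_at (𝟙 X.unop) δ t t (Category.comp_id t) x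
    exact e.trans (congrArg _ congr($(PshOver.Hom.id_at_self X.unop.toPsh t _) x))
  map_comp {X Y Z} f g := by
    refine AddCommGrpCat.hom_ext (AddMonoidHom.ext fun δ => ?_)
    refine AlgOver.Der.hext fun T t x => ?_
    have e := AlgOver.Der.comp_at (g.unop ≫ f.unop) δ t _ rfl x
    refine e.trans (Eq.symm ?_)
    refine (AlgOver.Der.comp_at g.unop (AlgOver.Der.comp f.unop δ) t _ rfl x).trans ?_
    have h : (t ≫ AlgOver.Hom.bs g.unop) ≫ AlgOver.Hom.bs f.unop =
      t ≫ AlgOver.Hom.bs (g.unop ≫ f.unop) := Category.assoc _ _ _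
    refine (AlgOver.Der.comp_at f.unop δ _ _ h _).trans (congrArg _ ?_)
    exact congr($(AlgOver.Hom.at_comp g.unop f.unop t _ _ rfl rfl h) x).symm

section Exal

variable {D : Type (u + 1)} [Category.{u} D] {L : GrothendieckTopology D}
  {A B : Sheaf L CommRingCat.{u}}

/-- A square-zero extension of the sheaf of `A`-algebras `B` by the `B`-module `M`: a sheaf of
`A`-algebras with a locally surjective homomorphism onto `B`, whose kernel is identified with `M`.
By `mul_incl`, the kernel has square zero and its `B`-module structure is that of `M`. -/
structure Exal (φ : A ⟶ B)
    (M : PresheafOfModules.{u} (B.obj ⋙ forget₂ CommRingCat.{u} RingCat.{u})) where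
  ring : Sheaf L CommRingCat.{u}
  str : A ⟶ ring
  proj : ring ⟶ B
  str_proj : str ≫ proj = φ
  incl : ∀ T : Dᵒᵖ, M.obj T →+ ring.obj.obj T
  incl_map : ∀ ⦃S T : Dᵒᵖ⦄ (k : S ⟶ T) (m : M.obj S),
    ring.obj.map k (incl S m) = incl T (M.map k m)
  incl_injective : ∀ T : Dᵒᵖ, Function.Injective (incl T)
  proj_eq_zero_iff : ∀ (T : Dᵒᵖ) (x : ring.obj.obj T),
    proj.hom.app T x = 0 ↔ ∃ m : M.obj T, incl T m = x
  locallySurjective : Presheaf.IsLocallySurjective L proj.hom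
  mul_incl : ∀ (T : Dᵒᵖ) (x : ring.obj.obj T) (m : M.obj T),
    x * incl T m = incl T ((show B.obj.obj T from proj.hom.app T x) • m)

namespace Exal

variable {φ : A ⟶ B} {M : PresheafOfModules.{u} (B.obj ⋙ forget₂ CommRingCat.{u} RingCat.{u})}

/-- Maps of `A`-algebras inducing the identity on `B` and on `M`. -/
@[ext]
structure Hom (X Y : Exal φ M) where
  hom : X.ring ⟶ Y.ring
  str_hom : X.str ≫ hom = Y.str
  hom_proj : hom ≫ Y.proj = X.proj
  hom_incl : ∀ (T : Dᵒᵖ) (m : M.obj T), hom.hom.app T (X.incl T m) = Y.incl T m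

instance : Category.{u + 1} (Exal φ M) where
  Hom := Hom
  id X := ⟨𝟙 _, Category.comp_id _, Category.id_comp _, fun _ _ => rfl⟩
  comp f g := ⟨f.hom ≫ g.hom, by rw [← Category.assoc, f.str_hom, g.str_hom],
    by rw [Category.assoc, g.hom_proj, f.hom_proj],
    fun T m => (congrArg _ (f.hom_incl T m)).trans (g.hom_incl T m)⟩
  id_comp f := Hom.ext (Category.id_comp f.hom)
  comp_id f := Hom.ext (Category.comp_id f.hom)
  assoc f g h := Hom.ext (Category.assoc f.hom g.hom h.hom)

end Exal

end Exal


section Total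

variable {φ : A ⟶ B} {M : PresheafOfModules.{u} (B.obj ⋙ forget₂ CommRingCat.{u} RingCat.{u})}

variable (φ M) in
/-- The total category of the fibered category of extensions over `A-Alg/B`; the fibre over `(U, C)`
is the category of square-zero extensions of the `A_U`-algebra `C` by `M`. -/
structure ExalOver where
  base : AlgOver φ
  ext : Exal base.str (base.mod M)

namespace ExalOver

/-- The algebra `(U, C')` of an extension `C'` of `C`. -/
abbrev total (X : ExalOver φ M) : AlgOver φ where
  base := X.base.base
  ring := X.ext.ring
  str := X.ext.str
  toB := X.ext.proj ≫ X.base.toB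
  str_toB := by rw [← Category.assoc, X.ext.str_proj, X.base.str_toB]

/-- The projection `(U, C') ⟶ (U, C)`. -/
def toBase (X : ExalOver φ M) : X.total ⟶ X.base where
  hom :=
    { base := 𝟙 _
      app := X.ext.proj.hom ≫ (PshOver.Hom.id X.base.toPsh).app }
  strAt_at T t s h := by
    obtain rfl : t = s := (Category.comp_id t).symm.trans h
    refine (congrArg (_ ≫ ·) ((Category.assoc _ _ _).trans
      (congrArg (_ ≫ ·) (PshOver.Hom.id_at_self X.base.toPsh t h)))).trans ?_
    exact (congrArg (_ ≫ ·) (Category.comp_id _)).trans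
      congr(($X.ext.str_proj).hom.app (op (Over.mk t)))
  at_toBAt T t s h := by
    obtain rfl : t = s := (Category.comp_id t).symm.trans h
    refine (congrArg (· ≫ _) ((Category.assoc _ _ _).trans
      (congrArg (_ ≫ ·) (PshOver.Hom.id_at_self X.base.toPsh t h)))).trans ?_
    exact congrArg (· ≫ _) (Category.comp_id _)

def inclAt (X : ExalOver φ M) {T : E} (t : T ⟶ X.base.base) : M.obj (op T) →+ X.total.sec t :=
  X.ext.incl (op (Over.mk t))

/-- A morphism from an extension of `(U₁, C₁)` to an extension of `(U₂, C₂)`: a commutative square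
in `A-Alg/B` which induces the identity on `M`. -/
@[ext]
structure Hom (X Y : ExalOver φ M) where
  base : X.base ⟶ Y.base
  total : X.total ⟶ Y.total
  w : total ≫ Y.toBase = X.toBase ≫ base
  at_inclAt : ∀ ⦃T : E⦄ (t : T ⟶ X.total.base) (s : T ⟶ Y.total.base)
    (h : t ≫ AlgOver.Hom.bs total = s) (m : M.obj (op T)),
    AlgOver.Hom.at total t s h (X.inclAt t m) = Y.inclAt s m

instance : Category.{u + 1} (ExalOver φ M) where
  Hom := Hom
  id X :=
    { base := 𝟙 _
      total := 𝟙 _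
      w := (Category.id_comp _).trans (Category.comp_id _).symm
      at_inclAt := fun T t s h m => by
        obtain rfl : t = s := (Category.comp_id t).symm.trans h
        exact congr($(PshOver.Hom.id_at_self X.total.toPsh t h) (X.inclAt t m)) }
  comp {X Y Z} f g :=
    { base := f.base ≫ g.base
      total := f.total ≫ g.total
      w := by rw [Category.assoc, g.w, ← Category.assoc, f.w, Category.assoc]
      at_inclAt := fun T t s h m => by
        have h' : (t ≫ AlgOver.Hom.bs f.total) ≫ AlgOver.Hom.bs g.total = s :=
          (Category.assoc _ _ _).trans h
        refine congr($(AlgOver.Hom.at_comp f.total g.total t _ s h rfl h') (X.inclAt t m)).trans ?_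
        exact (congrArg _ (f.at_inclAt t _ rfl m)).trans (g.at_inclAt _ s h' m) }
  id_comp f := Hom.ext (Category.id_comp f.base) (Category.id_comp f.total)
  comp_id f := Hom.ext (Category.comp_id f.base) (Category.comp_id f.total)
  assoc f g h := Hom.ext (Category.assoc f.base g.base h.base)
    (Category.assoc f.total g.total h.total)

variable (φ M) in
def proj : ExalOver φ M ⥤ AlgOver φ where
  obj X := X.base
  map f := f.base

end ExalOver


namespace ExalOver

lemma inclAt_res (X : ExalOver φ M) {S T : E} (k : S ⟶ T) (t : T ⟶ X.base.base)
    (s : S ⟶ X.base.base) (h : k ≫ t = s) (m : M.obj (op T)) :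
    X.total.toPsh.res k t s h (X.inclAt t m) = X.inclAt s (M.map k.op m) :=
  X.ext.incl_map (Over.homMk k h : Over.mk s ⟶ Over.mk t).op m

lemma mul_inclAt (X : ExalOver φ M) {T : E} (t : T ⟶ X.base.base) (x : X.total.sec t)
    (m : M.obj (op T)) : x * X.inclAt t m = X.inclAt t (X.total.toBAt t x • m) :=
  X.ext.mul_incl (op (Over.mk t)) x m

lemma proj_inclAt (X : ExalOver φ M) {T : E} (t : T ⟶ X.base.base) (m : M.obj (op T)) :
    X.ext.proj.hom.app (op (Over.mk t)) (X.inclAt t m) = 0 :=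
  (X.ext.proj_eq_zero_iff _ _).2 ⟨m, rfl⟩

lemma toBAt_inclAt (X : ExalOver φ M) {T : E} (t : T ⟶ X.base.base) (m : M.obj (op T)) :
    X.total.toBAt t (X.inclAt t m) = 0 :=
  (congrArg (X.base.toBAt t) (X.proj_inclAt t m)).trans (map_zero (X.base.toBAt t).hom)

lemma inclAt_mul_inclAt (X : ExalOver φ M) {T : E} (t : T ⟶ X.base.base) (m n : M.obj (op T)) :
    X.inclAt t m * X.inclAt t n = 0 := by
  rw [mul_inclAt, toBAt_inclAt]
  exact (congrArg _ (zero_smul (B.obj.obj (op T)) (n : M.obj (op T)))).trans (map_zero _)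

lemma toBase_at (X : ExalOver φ M) {T : E} (t : T ⟶ X.total.base)
    (h : t ≫ AlgOver.Hom.bs X.toBase = t) :
    AlgOver.Hom.at X.toBase t t h = X.ext.proj.hom.app (op (Over.mk t)) :=
  ((Category.assoc _ _ _).trans
    (congrArg (_ ≫ ·) (PshOver.Hom.id_at_self X.base.toPsh t h))).trans (Category.comp_id _)

/-- The ring homomorphism `y ↦ s y + δ y` on sections. -/
def translateAt {X : ExalOver φ M} {Y : AlgOver φ} (s : Y ⟶ X.total) (δ : Y.Der M) {T : E}
    (t : T ⟶ Y.base) (r : T ⟶ X.total.base) (h : t ≫ AlgOver.Hom.bs s = r) :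
    Y.sec t →+* X.total.sec r where
  toFun y := AlgOver.Hom.at s t r h y + X.inclAt r (AlgOver.Der.at δ t y)
  map_one' := by
    rw [AlgOver.Der.at_one, map_zero, add_zero]
    exact map_one (AlgOver.Hom.at s t r h).hom
  map_zero' := by
    rw [map_zero, map_zero, map_zero, add_zero]
  map_add' a b := by
    rw [map_add, map_add, map_add]
    exact add_add_add_comm _ _ _ _
  map_mul' a b := by
    have e (c : Y.sec t) : X.total.toBAt r (AlgOver.Hom.at s t r h c) = Y.toBAt t c :=
      congr($(AlgOver.Hom.at_toBAt s t r h) c)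
    have e₁ : AlgOver.Hom.at s t r h (a * b) =
      AlgOver.Hom.at s t r h a * AlgOver.Hom.at s t r h b :=
      map_mul (AlgOver.Hom.at s t r h).hom a b
    have e₂ := X.mul_inclAt r (AlgOver.Hom.at s t r h a) (AlgOver.Der.at δ t b)
    have e₃ := X.mul_inclAt r (AlgOver.Hom.at s t r h b) (AlgOver.Der.at δ t a)
    have e₄ := X.inclAt_mul_inclAt r (AlgOver.Der.at δ t a) (AlgOver.Der.at δ t b)
    rw [e] at e₂ e₃
    rw [AlgOver.Der.at_mul, map_add, e₁, ← e₂, ← e₃, add_mul, mul_add, mul_add, e₄, add_zero]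
    ring

lemma translateAt_apply {X : ExalOver φ M} {Y : AlgOver φ} (s : Y ⟶ X.total) (δ : Y.Der M)
    {T : E} (t : T ⟶ Y.base) (r : T ⟶ X.total.base) (h : t ≫ AlgOver.Hom.bs s = r)
    (y : Y.sec t) : translateAt s δ t r h y =
      AlgOver.Hom.at s t r h y + X.inclAt r (AlgOver.Der.at δ t y) := rfl

lemma res_translateAt {X : ExalOver φ M} {Y : AlgOver φ} (s : Y ⟶ X.total) (δ : Y.Der M)
    {S T : E} (k : S ⟶ T) (t : T ⟶ Y.base) (t' : S ⟶ Y.base) (r : T ⟶ X.total.base)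
    (r' : S ⟶ X.total.base) (ht : k ≫ t = t') (hr : k ≫ r = r')
    (h : t ≫ AlgOver.Hom.bs s = r) (h' : t' ≫ AlgOver.Hom.bs s = r') (y : Y.sec t) :
    translateAt s δ t' r' h' (Y.toPsh.res k t t' ht y) =
      X.total.toPsh.res k r r' hr (translateAt s δ t r h y) := by
  rw [translateAt_apply, translateAt_apply, AlgOver.Der.at_res]
  have e : AlgOver.Hom.at s t' r' h' (Y.toPsh.res k t t' ht y) =
      X.total.toPsh.res k r r' hr (AlgOver.Hom.at s t r h y) :=
    congr($(AlgOver.Hom.res_at s k t t' r r' ht h h' hr) y)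
  rw [e, ← inclAt_res X k r r' hr]
  exact (map_add (X.total.toPsh.res k r r' hr).hom _ _).symm

/-- The morphism `s + δ`. -/
def translate {X : ExalOver φ M} {Y : AlgOver φ} (s : Y ⟶ X.total) (δ : Y.Der M) :
    Y ⟶ X.total where
  hom :=
    { base := AlgOver.Hom.bs (Y := X.total) s
      app :=
        { app := fun T => CommRingCat.ofHom (translateAt s δ T.unop.hom
            (T.unop.hom ≫ AlgOver.Hom.bs (Y := X.total) s) rfl)
          naturality := fun S T k => by
            refine CommRingCat.hom_ext (RingHom.ext fun y => ?_)
            exact res_translateAt s δ k.unop.left S.unop.hom T.unop.hom _ _ (Over.w k.unop)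
              (by rw [← Category.assoc, Over.w]) rfl rfl y } }
  strAt_at T t r h := by
    subst h
    refine (congrArg (_ ≫ ·) (PshOver.Hom.at_eq (X := Y.toPsh) (Y := X.total.toPsh) _ t)).trans ?_
    refine CommRingCat.hom_ext (RingHom.ext fun a => ?_)
    refine (congrArg (_ + ·) ((congrArg (X.inclAt _) (AlgOver.Der.at_strAt δ t a)).trans
      (map_zero (X.inclAt _)))).trans ((add_zero _).trans ?_)
    exact congr($(AlgOver.Hom.strAt_at s t _ rfl) a)
  at_toBAt T t r h := by
    subst h
    refine (congrArg (· ≫ _) (PshOver.Hom.at_eq (X := Y.toPsh) (Y := X.total.toPsh) _ t)).trans ?_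
    refine CommRingCat.hom_ext (RingHom.ext fun a => ?_)
    refine (map_add (X.total.toBAt (t ≫ AlgOver.Hom.bs (Y := X.total) s)).hom _ _).trans ?_
    refine (congrArg (_ + ·) (X.toBAt_inclAt _ _)).trans ((add_zero _).trans ?_)
    exact congr($(AlgOver.Hom.at_toBAt s t _ rfl) a)

lemma bs_translate {X : ExalOver φ M} {Y : AlgOver φ} (s : Y ⟶ X.total) (δ : Y.Der M) :
    AlgOver.Hom.bs (translate s δ) = AlgOver.Hom.bs s := rfl

lemma translate_at {X : ExalOver φ M} {Y : AlgOver φ} (s : Y ⟶ X.total) (δ : Y.Der M)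
    {T : E} (t : T ⟶ Y.base) (r : T ⟶ X.total.base) (h : t ≫ AlgOver.Hom.bs s = r)
    (y : Y.sec t) : AlgOver.Hom.at (translate s δ) t r h y =
      AlgOver.Hom.at s t r h y + X.inclAt r (AlgOver.Der.at δ t y) := by
  subst h
  exact congr($(PshOver.Hom.at_eq (X := Y.toPsh) (Y := X.total.toPsh)
    (AlgOver.Hom.hom (translate s δ)) t) y)

lemma translate_toBase {X : ExalOver φ M} {Y : AlgOver φ} (s : Y ⟶ X.total) (δ : Y.Der M) :
    translate s δ ≫ X.toBase = s ≫ X.toBase := by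
  refine AlgOver.Hom.hext rfl fun T t r h h' => ?_
  have hr : t ≫ AlgOver.Hom.bs s = r :=
    (Category.comp_id _).symm.trans ((Category.assoc _ _ _).trans h)
  have hr' : r ≫ AlgOver.Hom.bs (X := X.total) (Y := X.base) X.toBase = r := Category.comp_id r
  rw [AlgOver.Hom.at_comp (translate s δ) X.toBase t r r h hr hr',
    AlgOver.Hom.at_comp s X.toBase t r r h' hr hr', toBase_at]
  refine CommRingCat.hom_ext (RingHom.ext fun y => ?_)
  refine (congrArg _ (translate_at s δ t r hr y)).trans ?_
  refine (map_add (X.ext.proj.hom.app (op (Over.mk r))).hom _ _).trans ?_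
  exact (congrArg (_ + ·) (X.proj_inclAt _ _)).trans (add_zero _)

lemma translate_zero {X : ExalOver φ M} {Y : AlgOver φ} (s : Y ⟶ X.total) :
    translate s (0 : Y.Der M) = s := by
  refine AlgOver.Hom.hext rfl fun T t r h h' => ?_
  refine CommRingCat.hom_ext (RingHom.ext fun y => ?_)
  exact (translate_at s 0 t r h y).trans ((congrArg (_ + ·) (map_zero (X.inclAt r))).trans
    (add_zero _))

lemma translate_add {X : ExalOver φ M} {Y : AlgOver φ} (s : Y ⟶ X.total) (δ ε : Y.Der M) :
    translate s (δ + ε) = translate (translate s ε) δ := by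
  refine AlgOver.Hom.hext rfl fun T t r h h' => ?_
  refine CommRingCat.hom_ext (RingHom.ext fun y => ?_)
  refine (translate_at s (δ + ε) t r h y).trans (Eq.trans ?_
    (translate_at (translate s ε) δ t r h y).symm)
  rw [translate_at s ε t r h y, add_assoc]
  refine congrArg (_ + ·) ((map_add (X.inclAt r) (AlgOver.Der.at δ t y)
    (AlgOver.Der.at ε t y)).trans (add_comm _ _))

lemma comp_translate {X : ExalOver φ M} {Y Z : AlgOver φ} (f : Z ⟶ Y) (s : Y ⟶ X.total)
    (δ : Y.Der M) : f ≫ translate s δ = translate (f ≫ s) (AlgOver.Der.comp f δ) := by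
  refine AlgOver.Hom.hext rfl fun T t r h h' => ?_
  refine CommRingCat.hom_ext (RingHom.ext fun y => ?_)
  have hr : (t ≫ AlgOver.Hom.bs f) ≫ AlgOver.Hom.bs s = r := (Category.assoc _ _ _).trans h
  refine congr($(AlgOver.Hom.at_comp f (translate s δ) t _ r h rfl hr) y).trans ?_
  refine (translate_at s δ _ r hr _).trans (Eq.symm ?_)
  refine (translate_at (f ≫ s) _ t r h' y).trans ?_
  rw [AlgOver.Hom.at_comp f s t _ r h' rfl hr, AlgOver.Der.comp_at f δ t _ rfl]
  rfl

lemma translate_comp {X X' : ExalOver φ M} {Y : AlgOver φ} (s : Y ⟶ X.total)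
    (δ : Y.Der M) (f : X ⟶ X') :
    translate s δ ≫ Hom.total f = translate (s ≫ Hom.total f) δ := by
  refine AlgOver.Hom.hext rfl fun T t r h h' => ?_
  refine CommRingCat.hom_ext (RingHom.ext fun y => ?_)
  have hr : (t ≫ AlgOver.Hom.bs s) ≫ AlgOver.Hom.bs (Hom.total f) = r :=
    (Category.assoc _ _ _).trans h
  refine congr($(AlgOver.Hom.at_comp (translate s δ) (Hom.total f) t _ r h rfl hr) y).trans ?_
  refine Eq.trans ?_ (translate_at (s ≫ Hom.total f) δ t r h' y).symm
  rw [AlgOver.Hom.at_comp s (Hom.total f) t _ r h' rfl hr]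
  refine (congrArg (AlgOver.Hom.at (Hom.total f) (t ≫ AlgOver.Hom.bs (Y := X.total) s) r hr)
    (translate_at s δ t _ rfl y)).trans ?_
  refine (map_add (AlgOver.Hom.at (Hom.total f) _ r hr).hom _ _).trans ?_
  exact congrArg (_ + ·) (Hom.at_inclAt f _ r hr _)

end ExalOver

end Total

end Site


section Torsor

universe u₁ v₁ w₁
variable {D : Type u₁} [Category.{v₁} D]

/-- A presheaf of sets with an action of the presheaf of abelian groups `G`. -/
structure ActPresheaf (G : Dᵒᵖ ⥤ AddCommGrpCat.{w₁}) where
  psh : Dᵒᵖ ⥤ Type w₁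
  act : ∀ {T : Dᵒᵖ}, G.obj T → psh.obj T → psh.obj T
  zero_act : ∀ {T : Dᵒᵖ} (p : psh.obj T), act 0 p = p
  add_act : ∀ {T : Dᵒᵖ} (g h : G.obj T) (p : psh.obj T), act (g + h) p = act g (act h p)
  map_act : ∀ {S T : Dᵒᵖ} (k : S ⟶ T) (g : G.obj S) (p : psh.obj S),
    psh.map k (act g p) = act (G.map k g) (psh.map k p)

/-- `P` is a `G`-torsor: a sheaf of sets, locally nonempty, on which `G` acts simply transitively. -/
structure ActPresheaf.IsTorsor (L : GrothendieckTopology D) {G : Dᵒᵖ ⥤ AddCommGrpCat.{w₁}}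
    (P : ActPresheaf G) : Prop where
  isSheaf : Presieve.IsSheaf L P.psh
  existsUnique : ∀ {T : Dᵒᵖ} (p q : P.psh.obj T), ∃! g : G.obj T, P.act g p = q
  locally_nonempty : ∀ T : D, ∃ S ∈ L T, ∀ ⦃T' : D⦄ (k : T' ⟶ T), S k →
    Nonempty (P.psh.obj (op T'))

/-- Pairs `(X, P)` of an object `X` of `D` and a presheaf `P` on the slice over `X` with an action of
the restriction of `G`. -/
structure ActOver (G : Dᵒᵖ ⥤ AddCommGrpCat.{w₁}) where
  base : D
  fib : ActPresheaf ((Over.forget base).op ⋙ G)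

namespace ActOver

variable {G : Dᵒᵖ ⥤ AddCommGrpCat.{w₁}}

abbrev toPsh (P : ActOver G) : PshOver D (Type w₁) where
  base := P.base
  psh := P.fib.psh

def act (P : ActOver G) {T : D} (t : T ⟶ P.base) (g : G.obj (op T))
    (p : P.fib.psh.obj (op (Over.mk t))) : P.fib.psh.obj (op (Over.mk t)) :=
  P.fib.act (T := op (Over.mk t)) g p

/-- Equivariant maps from `P` to the restriction of `Q` along a morphism of `D`. -/
@[ext]
structure Hom (P Q : ActOver G) where
  hom : PshOver.Hom P.toPsh Q.toPsh
  at_act : ∀ ⦃T : D⦄ (t : T ⟶ P.base) (s : T ⟶ Q.base) (h : t ≫ hom.base = s)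
    (g : G.obj (op T)) (p : P.fib.psh.obj (op (Over.mk t))),
    hom.at t s h (P.act t g p) = Q.act s g (hom.at t s h p)

instance : Category (ActOver G) where
  Hom := Hom
  id P :=
    { hom := PshOver.Hom.id P.toPsh
      at_act := fun T t s h g p => by
        obtain rfl : t = s := (Category.comp_id t).symm.trans h
        have e := PshOver.Hom.id_at_self P.toPsh t h
        exact congr($e (P.act t g p)).trans (congrArg _ congr($e p)).symm }
  comp {P Q R} f g :=
    { hom := f.hom.comp g.hom
      at_act := fun T t s h a p => by
        have h' : (t ≫ f.hom.base) ≫ g.hom.base = s := (Category.assoc _ _ _).trans h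
        have e := PshOver.Hom.comp_at f.hom g.hom t _ s h rfl h'
        refine congr($e (P.act t a p)).trans (Eq.trans ?_ (congrArg _ congr($e p)).symm)
        exact (congrArg _ (f.at_act t _ rfl a p)).trans (g.at_act _ s h' a _) }
  id_comp f := Hom.ext (Category.id_comp (obj := PshOver D (Type w₁)) f.hom)
  comp_id f := Hom.ext (Category.comp_id (obj := PshOver D (Type w₁)) f.hom)
  assoc f g h := Hom.ext (Category.assoc (obj := PshOver D (Type w₁)) (Hom.hom f) (Hom.hom g)
    (Hom.hom h))

variable (G) in
def proj : ActOver G ⥤ D where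
  obj P := P.base
  map f := (Hom.hom f).base

/-- The objects `(X, P)` of `ActOver G` with `P` a torsor. -/
abbrev isTorsor (L : GrothendieckTopology D) (G : Dᵒᵖ ⥤ AddCommGrpCat.{w₁}) :
    ObjectProperty (ActOver G) :=
  fun P => P.fib.IsTorsor (L.over P.base)

end ActOver

/-- The classifying stack of `G`-torsors, as a category over `D`: its fibre over `X` is the category of
torsors under the restriction of `G` to the slice over `X`. -/
def classifyingStack (L : GrothendieckTopology D) (G : Dᵒᵖ ⥤ AddCommGrpCat.{w₁}) :
    BasedCategory D :=
  BasedCategory.ofFunctor ((ActOver.isTorsor L G).ι ⋙ ActOver.proj G)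

end Torsor


section Comparison

variable {E : Type (u + 1)} [Category.{u} E] {K : GrothendieckTopology E}
  {A B : Sheaf K CommRingCat.{u}} {φ : A ⟶ B}
  {M : PresheafOfModules.{u} (B.obj ⋙ forget₂ CommRingCat.{u} RingCat.{u})}

/-- The presheaf on the slice over `X.base = (U, C)` represented by `(U, C') ⟶ (U, C)`; a derivation `δ`
acts on a section `s` by `s ↦ s + δ`. -/
noncomputable def ExalOver.toActOver (X : ExalOver φ M) : ActOver (derPresheaf φ M) where
  base := X.base
  fib :=
    { psh := yoneda.obj (Over.mk X.toBase)
      act := fun {T} δ s => Over.homMk (ExalOver.translate s.left (show T.unop.left.Der M from δ))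
        ((ExalOver.translate_toBase _ _).trans (Over.w s))
      zero_act := fun s => Over.OverMorphism.ext (ExalOver.translate_zero s.left)
      add_act := fun δ ε s => Over.OverMorphism.ext (ExalOver.translate_add s.left δ ε)
      map_act := fun k δ s => Over.OverMorphism.ext
        (ExalOver.comp_translate k.unop.left s.left δ) }

noncomputable def ExalOver.toPshHom {X Y : ExalOver φ M} (f : X ⟶ Y) :
    PshOver.Hom X.toActOver.toPsh Y.toActOver.toPsh where
  base := ExalOver.Hom.base f
  app :=
    { app := fun T => ↾ fun (s : T.unop ⟶ Over.mk X.toBase) =>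
        (Over.homMk (s.left ≫ ExalOver.Hom.total f) (by
          exact ((Category.assoc _ _ _).trans (congrArg (s.left ≫ ·) (ExalOver.Hom.w f))).trans
            ((Category.assoc _ _ _).symm.trans
              (congrArg (· ≫ ExalOver.Hom.base f) (Over.w s)))) :
          (Over.map (ExalOver.Hom.base f)).obj T.unop ⟶ Over.mk Y.toBase)
      naturality := fun S T k => by
        ext s
        exact Over.OverMorphism.ext (Category.assoc _ _ _) }

lemma ExalOver.toPshHom_at {X Y : ExalOver φ M} (f : X ⟶ Y) {T : AlgOver φ} (t : T ⟶ X.base)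
    (r : T ⟶ Y.base) (h : t ≫ ExalOver.Hom.base f = r) (s : Over.mk t ⟶ Over.mk X.toBase) :
    (show Over.mk r ⟶ Over.mk Y.toBase from (ExalOver.toPshHom f).at t r h s).left =
      s.left ≫ ExalOver.Hom.total f := by
  subst h
  exact congrArg (fun z : Over.mk (t ≫ ExalOver.Hom.base f) ⟶ Over.mk Y.toBase => z.left)
    congr($(PshOver.Hom.at_eq (ExalOver.toPshHom f) t) s)

variable (φ M) in
/-- An extension `C'` of `(U, C)` is sent to the presheaf which `(U, C')` represents over `(U, C)`. -/
noncomputable def ExalOver.toActOverFunctor : ExalOver φ M ⥤ ActOver (derPresheaf φ M) where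
  obj X := X.toActOver
  map {X Y} f :=
    { hom := ExalOver.toPshHom f
      at_act := fun T t r h δ s => by
        refine Over.OverMorphism.ext ((ExalOver.toPshHom_at f t r h _).trans ?_)
        refine (ExalOver.translate_comp _ _ f).trans ?_
        exact congrArg (ExalOver.translate · _) (ExalOver.toPshHom_at f t r h s).symm }
  map_id X := by
    refine ActOver.Hom.ext (PshOver.Hom.ext rfl fun T t r h h' => ?_)
    obtain rfl : t = r := (Category.comp_id t).symm.trans h
    ext s
    refine Over.OverMorphism.ext ((ExalOver.toPshHom_at (𝟙 X) t t h s).trans ?_)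
    refine (Category.comp_id _).trans ?_
    exact congrArg (fun z : Over.mk t ⟶ Over.mk X.toBase => z.left)
      congr($(PshOver.Hom.id_at_self X.toActOver.toPsh t h) s).symm
  map_comp {X Y Z} f g := by
    refine ActOver.Hom.ext (PshOver.Hom.ext rfl fun T t r h h' => ?_)
    have hr : (t ≫ ExalOver.Hom.base f) ≫ ExalOver.Hom.base g = r := (Category.assoc _ _ _).trans h
    ext s
    refine Over.OverMorphism.ext ((ExalOver.toPshHom_at (f ≫ g) t r h s).trans ?_)
    have e := PshOver.Hom.comp_at (ExalOver.toPshHom f) (ExalOver.toPshHom g) t _ r h rfl hr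
    refine Eq.trans ?_ (congrArg (fun z : Over.mk r ⟶ Over.mk Z.toBase => z.left)
      congr($e s)).symm
    refine Eq.trans ?_ (ExalOver.toPshHom_at g _ r hr _).symm
    refine Eq.trans ?_ (congrArg (· ≫ ExalOver.Hom.total g)
      (ExalOver.toPshHom_at f t _ rfl s)).symm
    exact (Category.assoc _ _ _).symm

namespace Exal

/-- For an extension `B'` of `B` and `Y = (U, C)`: the `A_U`-algebra maps `C ⟶ B'_U` over `B_U`. -/
structure Lift (X : Exal φ M) (Y : AlgOver φ) where
  hom : Y.ring ⟶ X.ring.over Y.base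
  str_hom : Y.str ≫ hom = (K.overPullback CommRingCat.{u} Y.base).map X.str
  hom_proj : hom ≫ (K.overPullback CommRingCat.{u} Y.base).map X.proj = Y.toB

namespace Lift

variable {X : Exal φ M} {Y Z : AlgOver φ}

def app (s : X.Lift Y) {T : E} (t : T ⟶ Y.base) : Y.sec t ⟶ X.ring.obj.obj (op T) :=
  s.hom.hom.app (op (Over.mk t))

lemma strAt_at (s : X.Lift Y) {T : E} (t : T ⟶ Y.base) :
    Y.strAt t ≫ s.app t = X.str.hom.app (op T) :=
  congr(($s.str_hom).hom.app (op (Over.mk t)))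

lemma at_proj (s : X.Lift Y) {T : E} (t : T ⟶ Y.base) :
    s.app t ≫ X.proj.hom.app (op T) = Y.toBAt t :=
  congr(($s.hom_proj).hom.app (op (Over.mk t)))

lemma res_at (s : X.Lift Y) {S T : E} (k : S ⟶ T) (t : T ⟶ Y.base) (r : S ⟶ Y.base)
    (h : k ≫ t = r) : Y.toPsh.res k t r h ≫ s.app r = s.app t ≫ X.ring.obj.map k.op :=
  s.hom.hom.naturality (Over.homMk k h : Over.mk r ⟶ Over.mk t).op

lemma hext {s s' : X.Lift Y} (h : ∀ ⦃T : E⦄ (t : T ⟶ Y.base), s.app t = s'.app t) : s = s' := by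
  obtain ⟨a, _, _⟩ := s
  obtain ⟨b, _, _⟩ := s'
  obtain rfl : a = b := by
    ext T : 3
    exact h T.unop.hom
  rfl

def mk' (at' : ∀ ⦃T : E⦄ (t : T ⟶ Y.base), Y.sec t →+* X.ring.obj.obj (op T))
    (h₁ : ∀ ⦃S T : E⦄ (k : S ⟶ T) (t : T ⟶ Y.base) (r : S ⟶ Y.base) (h : k ≫ t = r)
      (y : Y.sec t), at' r (Y.toPsh.res k t r h y) = X.ring.obj.map k.op (at' t y))
    (h₂ : ∀ ⦃T : E⦄ (t : T ⟶ Y.base) (a : A.obj.obj (op T)),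
      at' t (Y.strAt t a) = X.str.hom.app (op T) a)
    (h₃ : ∀ ⦃T : E⦄ (t : T ⟶ Y.base) (y : Y.sec t),
      X.proj.hom.app (op T) (at' t y) = Y.toBAt t y) : X.Lift Y where
  hom :=
    { hom :=
        { app := fun T => CommRingCat.ofHom (at' T.unop.hom)
          naturality := fun S T k => CommRingCat.hom_ext (RingHom.ext fun y =>
            h₁ k.unop.left S.unop.hom T.unop.hom (Over.w k.unop) y) } }
  str_hom := by
    ext T : 3
    exact CommRingCat.hom_ext (RingHom.ext fun a => h₂ T.unop.hom a)
  hom_proj := by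
    ext T : 3
    exact CommRingCat.hom_ext (RingHom.ext fun y => h₃ T.unop.hom y)

/-- The lift induced on `Z` by a morphism `f : Z ⟶ Y`. -/
def comp (f : Z ⟶ Y) (s : X.Lift Y) : X.Lift Z :=
  mk' (fun T t => (AlgOver.Hom.at f t _ rfl ≫ s.app (t ≫ AlgOver.Hom.bs f)).hom)
    (fun S T k t r h y => by
      have h' : k ≫ t ≫ AlgOver.Hom.bs f = r ≫ AlgOver.Hom.bs f := by rw [← h, Category.assoc]
      have e := congr($(AlgOver.Hom.res_at f k t r _ _ h rfl rfl h') y)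
      exact (congrArg (s.app _) e).trans congr($(s.res_at k _ _ h') _))
    (fun T t a => (congrArg (s.app _) congr($(AlgOver.Hom.strAt_at f t _ rfl) a)).trans
      congr($(s.strAt_at _) a))
    (fun T t y => congr($(s.at_proj _) _).trans congr($(AlgOver.Hom.at_toBAt f t _ rfl) y))

lemma comp_at (f : Z ⟶ Y) (s : X.Lift Y) {T : E} (t : T ⟶ Z.base) (r : T ⟶ Y.base)
    (h : t ≫ AlgOver.Hom.bs f = r) :
    (s.comp f).app t = AlgOver.Hom.at f t r h ≫ s.app r := by
  subst h
  rfl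

/-- The lift `s + δ`. -/
def translate (s : X.Lift Y) (δ : Y.Der M) : X.Lift Y :=
  mk' (fun T t =>
      { toFun := fun y => s.app t y + X.incl (op T) (AlgOver.Der.at δ t y)
        map_one' := by
          rw [AlgOver.Der.at_one, map_zero, add_zero]
          exact map_one (s.app t).hom
        map_zero' := by rw [map_zero, map_zero, map_zero, add_zero]
        map_add' := fun a b => by
          rw [map_add, map_add, map_add]
          exact add_add_add_comm _ _ _ _
        map_mul' := fun a b => by
          have e (c : Y.sec t) : X.proj.hom.app (op T) (s.app t c) = Y.toBAt t c :=
            congr($(s.at_proj t) c)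
          have e₁ : s.app t (a * b) = s.app t a * s.app t b := map_mul (s.app t).hom a b
          have e₂ := X.mul_incl (op T) (s.app t a) (AlgOver.Der.at δ t b)
          have e₃ := X.mul_incl (op T) (s.app t b) (AlgOver.Der.at δ t a)
          have e₄ : X.incl (op T) (AlgOver.Der.at δ t a) * X.incl (op T) (AlgOver.Der.at δ t b) =
              0 := by
            rw [X.mul_incl, (X.proj_eq_zero_iff _ _).2 ⟨_, rfl⟩]
            exact (congrArg _ (zero_smul (B.obj.obj (op T)) (AlgOver.Der.at δ t b))).trans
              (map_zero _)
          rw [e] at e₂ e₃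
          have e₅ : X.incl (op T) (AlgOver.Der.at δ t (a * b)) =
              s.app t a * X.incl (op T) (AlgOver.Der.at δ t b) +
                s.app t b * X.incl (op T) (AlgOver.Der.at δ t a) := by
            rw [AlgOver.Der.at_mul, map_add, e₂, e₃]
          rw [e₁, e₅, add_mul, mul_add, mul_add, e₄, add_zero]
          ring })
    (fun S T k t r h y => by
      have e := congr($(s.res_at k t r h) y)
      have e' := X.incl_map k.op (AlgOver.Der.at δ t y)
      refine (congrArg₂ (· + ·) e (congrArg _ (AlgOver.Der.at_res δ k t r h y))).trans ?_
      exact (congrArg (_ + ·) e'.symm).trans (map_add (X.ring.obj.map k.op).hom _ _).symm)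
    (fun T t a => (congrArg (_ + ·) ((congrArg (X.incl (op T)) (AlgOver.Der.at_strAt δ t a)).trans
      (map_zero (X.incl (op T))))).trans ((add_zero _).trans congr($(s.strAt_at t) a)))
    (fun T t y => (map_add (X.proj.hom.app (op T)).hom _ _).trans
      ((congrArg (_ + ·) ((X.proj_eq_zero_iff _ _).2 ⟨_, rfl⟩)).trans
        ((add_zero _).trans congr($(s.at_proj t) y))))

lemma translate_at (s : X.Lift Y) (δ : Y.Der M) {T : E} (t : T ⟶ Y.base) (y : Y.sec t) :
    (s.translate δ).app t y = s.app t y + X.incl (op T) (AlgOver.Der.at δ t y) := rfl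

end Lift

/-- The presheaf on `A-Alg/B` represented by an extension `B'` of `B`, with the action `s ↦ s + δ` of
derivations. -/
noncomputable def liftPresheaf (X : Exal φ M) : ActPresheaf (derPresheaf φ M) where
  psh :=
    { obj := fun Y => X.Lift Y.unop
      map := fun f => ↾ fun s => s.comp f.unop
      map_id := fun Y => by
        ext s
        refine Lift.hext fun T t => ?_
        refine (Lift.comp_at (𝟙 Y.unop) s t t (Category.comp_id t)).trans ?_
        exact (congrArg (· ≫ _) (PshOver.Hom.id_at_self Y.unop.toPsh t _)).trans
          (Category.id_comp _)
      map_comp := fun {Y₁ Y₂ Y₃} f g => by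
        ext s
        refine Lift.hext fun T t => ?_
        have h : (t ≫ AlgOver.Hom.bs g.unop) ≫ AlgOver.Hom.bs f.unop =
          t ≫ AlgOver.Hom.bs (g.unop ≫ f.unop) := Category.assoc _ _ _
        refine (Lift.comp_at (g.unop ≫ f.unop) s t _ rfl).trans (Eq.trans ?_
          (Lift.comp_at g.unop (s.comp f.unop) t _ rfl).symm)
        rw [Lift.comp_at f.unop s _ _ h, AlgOver.Hom.at_comp g.unop f.unop t _ _ rfl rfl h,
          Category.assoc] }
  act {Y} δ s := s.translate (show Y.unop.Der M from δ)
  zero_act s := Lift.hext fun T t => CommRingCat.hom_ext (RingHom.ext fun y =>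
    (congrArg (_ + ·) (map_zero (X.incl (op T)))).trans (add_zero _))
  add_act {Y} δ ε s := Lift.hext fun T t => CommRingCat.hom_ext (RingHom.ext fun y => by
    refine Eq.trans (congrArg (fun z : X.ring.obj.obj (op T) => s.app t y + z) ?_)
      (add_assoc (s.app t y) _ _).symm
    exact (map_add (X.incl (op T)) (AlgOver.Der.at (show Y.unop.Der M from δ) t y)
      (AlgOver.Der.at (show Y.unop.Der M from ε) t y)).trans (add_comm _ _))
  map_act {Y Z} k δ s := Lift.hext fun T t => CommRingCat.hom_ext (RingHom.ext fun y => rfl)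

end Exal

end Comparison


section Cohomology

universe u₁ v₁ w₁ w₂

variable {D : Type u₁} [Category.{v₁} D] {L : GrothendieckTopology D}
  [HasSheafify L AddCommGrpCat.{w₁}] [HasExt.{w₂} (Sheaf L AddCommGrpCat.{w₁})]

/-- The section `1` of the constant sheaf `ℤ`. -/
noncomputable def constOne (L : GrothendieckTopology D) [HasSheafify L AddCommGrpCat.{w₁}]
    (T : Dᵒᵖ) :
    ((constantSheaf L AddCommGrpCat.{w₁}).obj (AddCommGrpCat.of (ULift.{w₁} ℤ))).obj.obj T :=
  (toSheafify L ((Functor.const Dᵒᵖ).obj (AddCommGrpCat.of (ULift.{w₁} ℤ)))).app T (ULift.up 1)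

/-- `c ∈ H¹(L, F)` is the cohomology class of the `F`-torsor `P`: there are a short exact sequence
`0 ⟶ F ⟶ I ⟶ Q ⟶ 0` of abelian sheaves, a global section `x` of `Q`, given as a morphism `ℤ ⟶ Q`,
and an `F`-equivariant map from `P` to the `F`-torsor of sections of `I` over `x`, such that `c` is
the image of `x` under the connecting homomorphism `H⁰(L, Q) ⟶ H¹(L, F)`. -/
def IsTorsorClass (F : Sheaf L AddCommGrpCat.{w₁}) (P : ActPresheaf F.obj)
    (c : Sheaf.H.{w₂} F 1) : Prop :=
  ∃ (I Q : Sheaf L AddCommGrpCat.{w₁}) (i : F ⟶ I) (q : I ⟶ Q) (w : i ≫ q = 0)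
    (hS : (ShortComplex.mk i q w).ShortExact)
    (x : (constantSheaf L AddCommGrpCat.{w₁}).obj (AddCommGrpCat.of (ULift.{w₁} ℤ)) ⟶ Q)
    (f : ∀ T : Dᵒᵖ, P.psh.obj T → I.obj.obj T),
    (∀ ⦃S T : Dᵒᵖ⦄ (k : S ⟶ T) (p : P.psh.obj S), f T (P.psh.map k p) = I.obj.map k (f S p)) ∧
    (∀ (T : Dᵒᵖ) (g : F.obj.obj T) (p : P.psh.obj T), f T (P.act g p) = i.hom.app T g + f T p) ∧
    (∀ (T : Dᵒᵖ) (p : P.psh.obj T), q.hom.app T (f T p) = x.hom.app T (constOne L T)) ∧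
    c = (Abelian.Ext.mk₀ x).comp hS.extClass (zero_add 1)

end Cohomology

/-- A Grothendieck topos: a category equivalent to the category of sheaves of sets on a small
site. -/
class IsGrothendieckTopos (E : Type (u + 1)) [Category.{u} E] : Prop where
  exists_equivalence : ∃ (C : Type u) (_ : SmallCategory C) (J : GrothendieckTopology C),
    Nonempty (E ≌ Sheaf J (Type u))

section BasedEquivalence

universe v₁ u₁ v₂ u₂ v₃ u₃

/-- An equivalence of categories over `𝒮`. -/
def IsBasedEquivalence {𝒮 : Type u₁} [Category.{v₁} 𝒮] {𝒳 : BasedCategory.{v₂, u₂} 𝒮}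
    {𝒴 : BasedCategory.{v₃, u₃} 𝒮} (F : BasedFunctor 𝒳 𝒴) : Prop :=
  ∃ G : BasedFunctor 𝒴 𝒳, Nonempty (F.comp G ≅ BasedFunctor.id 𝒳) ∧
    Nonempty (G.comp F ≅ BasedFunctor.id 𝒴)

end BasedEquivalence

section Main

variable {E : Type (u + 1)} [Category.{u} E] {K : GrothendieckTopology E}
  {A B : Sheaf K CommRingCat.{u}} (φ : A ⟶ B)
  (M : PresheafOfModules.{u} (B.obj ⋙ forget₂ CommRingCat.{u} RingCat.{u}))

/-- The fibered category of square-zero extensions over `A-Alg/B`. -/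
def exalFibered : BasedCategory (AlgOver φ) :=
  BasedCategory.ofFunctor (ExalOver.proj φ M)

variable {φ M} in
/-- The functor from extensions to the classifying stack, given that the presheaves represented by
extensions are torsors. -/
noncomputable def exalToTorsors
    (h : ∀ X : ExalOver φ M, X.toActOver.fib.IsTorsor ((AlgOver.topology φ).over X.base)) :
    BasedFunctor (exalFibered φ M) (classifyingStack (AlgOver.topology φ) (derPresheaf φ M)) where
  toFunctor := (ActOver.isTorsor (AlgOver.topology φ) (derPresheaf φ M)).lift
    (ExalOver.toActOverFunctor φ M) h
  w := rfl

end Main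

end SqZero

/-! Let `C'` be an extension of `C` by `M`. Two algebra maps into `C'` with the same composite to
`C` differ by a derivation into `M`, because the kernel has square zero
(`ExalOver.existsUnique_translate`). Such maps exist locally on the site: finitely many sections of
`C` lift locally to `C'`, so the sieve of maps to `(U, C)` that factor through `(U, C')` is
covering. They also glue (`AlgOver.exists_hom_of_cover`). Hence `(U, C')` represents a torsor
(`ExalOver.toActOver_isTorsor`). The gluing shows why the topology lifts finite sets of sections:
additivity, multiplicativity and the Leibniz rule each involve two sections, which must lift to one
and the same member of the sieve. The same argument makes derivations a sheaf
(`derPresheaf_isSheaf`).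

The functor to torsors is fully faithful. By Yoneda, a map of represented presheaves comes from a
map of total algebras. Equivariance makes that map the identity on `M`, because the two projections
of `C' ×_C C'` differ by the derivation `(x, y) ↦ y - x` (`ExalOver.totalOfHom_inclAt`).

Essential surjectivity is the hard part. If `C'` represents a torsor `P`, then every algebra `Y`
over `(U, C)` with a point `p` of `P` has a map to `C'`. So `C'` is generated locally by symbols
`p_a(y) + n`, where the chart `a` records `Y`, `p` and a map `T ⟶ Y.base`, `y` is a section of `Y`
and `n` a section of `M`. Over the fibre product of two charts their points differ by a unique
derivation `δ`, and this forces `p_a(y) = p_b(y') + δ(y, y')` (`Chart.exists_common`,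
`Chart.Diff.eq_zero`). Sheafified classes of these symbols are the required sheaf of sets. Its ring
operations come from the trivial square-zero extensions attached to the charts (`RingAtlas`). It is
built one universe too high, but it is an extension of `C` by `M` and therefore small
(`Realization.small`). A point of `P` gives a section of the new extension equivariantly, and an
equivariant map of torsors is an isomorphism (`ActPresheaf.IsTorsor.bijective`). The classifying
stack is fibered because torsors restrict, and the extensions inherit this through the equivalence.

For the cohomological statement, `(⊤, B)` is the final object of the site, so torsors on the site
are torsors on the slice over it, and extensions of `B` are extensions over this one object. Torsors
under an abelian sheaf `F` are classified by `H¹` in the usual way. With `0 ⟶ F ⟶ I ⟶ Q ⟶ 0` and `I`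
injective, a torsor maps equivariantly to `I` and gives a global section of `Q`, well defined up to
sections of `I` (`exists_preimageMap`, `PreimageMap.exists_eq_add`). Conversely the local preimages
of a section of `Q` form a torsor. -/

namespace SqZero

/-! ### Equivalences and fibrations over a base category. -/

section Based

universe v₁ u₁ v₂ u₂ v₃ u₃

variable {𝒮 : Type u₁} [Category.{v₁} 𝒮] {𝒳 : BasedCategory.{v₂, u₂} 𝒮}
  {𝒴 : BasedCategory.{v₃, u₃} 𝒮}

/-- A fully faithful functor over `𝒮` which is essentially surjective on fibres is an equivalence
over `𝒮`. -/
lemma IsBasedEquivalence.of_fullyFaithful (F : BasedFunctor 𝒳 𝒴) [F.toFunctor.Full]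
    [F.toFunctor.Faithful]
    (H : ∀ y : 𝒴.obj, ∃ (x : 𝒳.obj) (e : F.obj x ≅ y),
      𝒴.p.IsHomLift (𝟙 (𝒴.p.obj y)) e.hom) : IsBasedEquivalence F := by
  choose x e he using H
  have hi (y) : 𝒴.p.IsHomLift (𝟙 (𝒴.p.obj y)) (e y).inv := IsHomLift.lift_id_inv _ _ _
  let G₀ : 𝒴.obj ⥤ 𝒳.obj :=
    { obj := x
      map := fun f => F.toFunctor.preimage ((e _).hom ≫ f ≫ (e _).inv)
      map_id := fun y => F.toFunctor.map_injective (by simp)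
      map_comp := fun f g => F.toFunctor.map_injective (by simp) }
  have hF {y y' : 𝒴.obj} (f : y ⟶ y') :
      F.toFunctor.map (G₀.map f) = (e y).hom ≫ f ≫ (e y').inv := F.toFunctor.map_preimage _
  have hG {y y' : 𝒴.obj} (f : y ⟶ y') : 𝒳.p.IsHomLift (𝒴.p.map f) (G₀.map f) := by
    rw [← F.isHomLift_iff, hF]
    have : 𝒴.p.IsHomLift (𝟙 _ ≫ 𝒴.p.map f ≫ 𝟙 _) ((e y).hom ≫ f ≫ (e y').inv) := inferInstance
    simpa using this
  -- A based functor commutes strictly with the projections. The chosen isomorphisms lie over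
  -- identities, which gives equal base objects and not merely isomorphic ones.
  have hobj (y : 𝒴.obj) : 𝒳.p.obj (x y) = 𝒴.p.obj y :=
    (F.w_obj (x y)).symm.trans (IsHomLift.domain_eq 𝒴.p (𝟙 (𝒴.p.obj y)) (e y).hom)
  let G : BasedFunctor 𝒴 𝒳 :=
    { toFunctor := G₀
      w := CategoryTheory.Functor.ext hobj fun y y' f =>
        IsHomLift.fac' 𝒳.p (𝒴.p.map f) (G₀.map f) }
  have hpre (a : 𝒳.obj) : F.toFunctor.map (F.toFunctor.preimageIso (e (F.obj a))).hom =
      (e (F.obj a)).hom := F.toFunctor.map_preimage _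
  have hnat {y y' : 𝒴.obj} (f : y ⟶ y') :
      F.toFunctor.map (G₀.map f) ≫ (e y').hom = (e y).hom ≫ f := by
    rw [hF, Category.assoc, Category.assoc, Iso.inv_hom_id, Category.comp_id]
  refine ⟨G, ⟨BasedNatIso.mkNatIso
    (NatIso.ofComponents (fun a => F.toFunctor.preimageIso (e (F.obj a)))
      fun {a b} f => F.toFunctor.map_injective ?_) fun a => ?_⟩,
    ⟨BasedNatIso.mkNatIso (NatIso.ofComponents e fun {y y'} f => ?_) fun a => ?_⟩⟩
  · refine (F.toFunctor.map_comp _ _).trans (Eq.trans ?_ (F.toFunctor.map_comp _ _).symm)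
    exact (congrArg (_ ≫ ·) (hpre b)).trans ((hnat (F.toFunctor.map f)).trans
      (congrArg (· ≫ _) (hpre a)).symm)
  · rw [← F.isHomLift_iff]
    have h := he (F.obj a)
    rw [F.w_obj] at h
    exact (hpre a).symm ▸ h
  · exact hnat f
  · exact he a

/-- Cartesian lifts are transported backwards: take one in `𝒴`, replace its source by an isomorphic
object `F x` of the same fibre, and take the preimage. Full faithfulness carries the universal
property over. -/
lemma isFibered_of_fullyFaithful (F : BasedFunctor 𝒳 𝒴) [F.toFunctor.Full]
    [F.toFunctor.Faithful]
    (H : ∀ y : 𝒴.obj, ∃ (x : 𝒳.obj) (e : F.obj x ≅ y),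
      𝒴.p.IsHomLift (𝟙 (𝒴.p.obj y)) e.hom) [𝒴.p.IsFibered] : 𝒳.p.IsFibered := by
  refine Functor.IsFibered.of_exists_isStronglyCartesian fun a R f => ?_
  obtain ⟨b, φ, hφ⟩ := IsPreFibered.exists_isCartesian 𝒴.p (F.w_obj a) f
  obtain ⟨x, e, he⟩ := H b
  rw [IsHomLift.domain_eq 𝒴.p f φ] at he
  have hψ : F.toFunctor.map (F.toFunctor.preimage (e.hom ≫ φ)) = e.hom ≫ φ :=
    F.toFunctor.map_preimage _
  have hl : 𝒳.p.IsHomLift f (F.toFunctor.preimage (e.hom ≫ φ)) := by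
    rw [← F.isHomLift_iff, hψ]
    infer_instance
  have hc : 𝒴.p.IsStronglyCartesian f φ := inferInstance
  have hi : 𝒴.p.IsHomLift (𝟙 R) e.inv := IsHomLift.lift_id_inv _ _ _
  refine ⟨x, F.toFunctor.preimage (e.hom ≫ φ), { toIsHomLift := hl, universal_property' := ?_ }⟩
  intro c g φ' hφ'
  have hg : 𝒴.p.IsHomLift (g ≫ f) (F.map φ') := F.preserves_isHomLift _ _
  -- `F c` and `c` have equal but not syntactically identical images in `𝒮`, hence the `eqToHom` in
  -- front of `g`.
  obtain ⟨χ, ⟨hχ, hχ'⟩, huniq⟩ :=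
    Functor.IsStronglyCartesian.universal_property 𝒴.p f φ
      (eqToHom (F.w_obj c) ≫ g) (eqToHom (F.w_obj c) ≫ g ≫ f) (by simp) (F.map φ')
  have hχg : 𝒴.p.IsHomLift g χ := by
    simpa using hχ
  refine ⟨F.toFunctor.preimage (χ ≫ e.inv), ⟨?_, ?_⟩, ?_⟩
  · rw [← F.isHomLift_iff, F.toFunctor.map_preimage]
    infer_instance
  · apply F.toFunctor.map_injective
    rw [F.toFunctor.map_comp, hψ, F.toFunctor.map_preimage]
    simpa using hχ'
  · rintro π ⟨hπ, hπ'⟩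
    apply F.toFunctor.map_injective
    have hFπ : 𝒴.p.IsHomLift g (F.map π) := F.preserves_isHomLift _ _
    rw [F.toFunctor.map_preimage, ← huniq (F.map π ≫ e.hom) ⟨?_, ?_⟩]
    · simp
    · have : 𝒴.p.IsHomLift g (F.map π ≫ e.hom) := inferInstance
      simpa using this
    · rw [← hπ', F.toFunctor.map_comp, hψ, Category.assoc]

end Based


/-! ### Morphisms of presheaves on slices, given section by section. -/

namespace PshOver

universe v₁ u₁ v₂ u₂

variable {C : Type u₁} [Category.{v₁} C] {D : Type u₂} [Category.{v₂} D]

/-- A morphism of `PshOver C D` from natural maps on sections. -/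
def Hom.ofAt {X Y : PshOver C D} (b : X.base ⟶ Y.base)
    (a : ∀ {T : C} (t : T ⟶ X.base),
      X.psh.obj (op (Over.mk t)) ⟶ Y.psh.obj (op (Over.mk (t ≫ b))))
    (ha : ∀ {S T : C} (k : S ⟶ T) (t : T ⟶ X.base) (s : S ⟶ X.base) (h : k ≫ t = s),
      X.res k t s h ≫ a s =
        a t ≫ Y.res k (t ≫ b) (s ≫ b) (by rw [← h, Category.assoc])) : Hom X Y where
  base := b
  app :=
    { app := fun T => a T.unop.hom
      naturality := fun S T k => ha k.unop.left S.unop.hom T.unop.hom (Over.w k.unop) }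

lemma Hom.ofAt_at {X Y : PshOver C D} (b : X.base ⟶ Y.base)
    (a : ∀ {T : C} (t : T ⟶ X.base),
      X.psh.obj (op (Over.mk t)) ⟶ Y.psh.obj (op (Over.mk (t ≫ b))))
    (ha : ∀ {S T : C} (k : S ⟶ T) (t : T ⟶ X.base) (s : S ⟶ X.base) (h : k ≫ t = s),
      X.res k t s h ≫ a s =
        a t ≫ Y.res k (t ≫ b) (s ≫ b) (by rw [← h, Category.assoc]))
    {T : C} (t : T ⟶ X.base) : (Hom.ofAt b a ha).at t (t ≫ b) rfl = a t :=
  Hom.at_eq (Hom.ofAt b a ha) t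

lemma Hom.at_congr {X Y : PshOver C D} {f g : Hom X Y} (e : f = g) {T : C} (t : T ⟶ X.base)
    (s : T ⟶ Y.base) (h : t ≫ f.base = s) : f.at t s h = g.at t s (by rw [← e, h]) := by
  subst e
  rfl

end PshOver

/-! ### Torsors, their restriction, and the classifying stack as a fibered category. -/

section TorsorLemmas

universe u₁ v₁ w₁

variable {D : Type u₁} [Category.{v₁} D] {L : GrothendieckTopology D}
  {G : Dᵒᵖ ⥤ AddCommGrpCat.{w₁}}

namespace ActPresheaf

/-- An equivariant map between torsors is bijective. -/
lemma IsTorsor.bijective {P Q : ActPresheaf G} (hP : P.IsTorsor L) (hQ : Q.IsTorsor L)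
    (θ : P.psh ⟶ Q.psh)
    (hθ : ∀ (T : Dᵒᵖ) (g : G.obj T) (p : P.psh.obj T),
      θ.app T (P.act g p) = Q.act g (θ.app T p)) (T : Dᵒᵖ) :
    Function.Bijective (θ.app T) := by
  -- If `p` and `g p` have the same image, `g` fixes that image, so `g = 0` by simple transitivity
  -- in `Q`.
  have inj (T : Dᵒᵖ) : Function.Injective (θ.app T) := fun p p' e => by
    obtain ⟨g, rfl, -⟩ := hP.existsUnique p p'
    obtain ⟨_, -, hu⟩ := hQ.existsUnique (θ.app T p) (θ.app T p)
    have h₁ := hu g ((hθ T g p).symm.trans e.symm)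
    have h₂ := hu 0 (Q.zero_act _)
    rw [h₁.trans h₂.symm, P.zero_act]
  refine ⟨inj T, fun q => ?_⟩
  obtain ⟨S, hS, hne⟩ := hP.locally_nonempty T.unop
  have hex {T' : D} (k : T' ⟶ T.unop) (hk : S k) :
      ∃ p : P.psh.obj (op T'), θ.app (op T') p = Q.psh.map k.op q := by
    obtain ⟨p⟩ := hne k hk
    obtain ⟨g, hg, -⟩ := hQ.existsUnique (θ.app _ p) (Q.psh.map k.op q)
    exact ⟨P.act g p, (hθ _ _ _).trans hg⟩
  choose p hp using @hex
  have hnat {T₁ T₂ : D} (k : T₁ ⟶ T₂) (x : P.psh.obj (op T₂)) :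
      θ.app (op T₁) (P.psh.map k.op x) = Q.psh.map k.op (θ.app (op T₂) x) :=
    congr($(θ.naturality k.op) x)
  -- Local preimages of `q` exist wherever `P` has points. They agree on overlaps because their
  -- images do and `θ` is injective.
  obtain ⟨x, hx, -⟩ := hP.isSheaf S hS (fun T' k hk => p k hk) (by
    intro Y₁ Y₂ Z g₁ g₂ f₁ f₂ h₁ h₂ e
    apply inj
    rw [hnat, hnat, hp, hp, ← Functor.map_comp_apply, ← Functor.map_comp_apply, ← op_comp,
      ← op_comp, e])
  refine ⟨x, (hQ.isSheaf.isSeparated S hS).ext fun T' k hk => ?_⟩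
  rw [← hnat k x, hx k hk, hp]

/-- A cover in the slice topology is a cover of the underlying object. Quantifying over every `s`
equal to `k ≫ t` spares later uses a transport along equalities of objects of the slice. -/
lemma over_locally_nonempty {X : D} {P : ActPresheaf ((Over.forget X).op ⋙ G)}
    (hP : P.IsTorsor (L.over X)) {T : D} (t : T ⟶ X) :
    ∃ S ∈ L T, ∀ ⦃T' : D⦄ (k : T' ⟶ T), S k → ∀ s, k ≫ t = s →
      Nonempty (P.psh.obj (op (Over.mk s))) := by
  obtain ⟨S, hS, hne⟩ := hP.locally_nonempty (Over.mk t)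
  refine ⟨_, hS, fun T' k hk s hs => ?_⟩
  subst hs
  exact hne _ ((Sieve.overEquiv_iff S k).1 hk)

lemma over_locally_nonempty' {X : D} {P : ActPresheaf ((Over.forget X).op ⋙ G)}
    (hP : ∀ {T : D} (t : T ⟶ X), ∃ S ∈ L T, ∀ ⦃T' : D⦄ (k : T' ⟶ T), S k →
      Nonempty (P.psh.obj (op (Over.mk (k ≫ t))))) (T : Over X) :
    ∃ S ∈ L.over X T, ∀ ⦃T' : Over X⦄ (k : T' ⟶ T), S k → Nonempty (P.psh.obj (op T')) := by
  obtain ⟨S, hS, hne⟩ := hP T.hom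
  refine ⟨_, L.overEquiv_symm_mem_over T S hS, fun T' k hk => ?_⟩
  obtain ⟨p⟩ := hne k.left hk
  exact ⟨P.psh.map (Over.homMk (𝟙 _) (by simp) : T' ⟶ Over.mk (k.left ≫ T.hom)).op p⟩

end ActPresheaf

namespace ActOver

/-- The restriction of `P` along a morphism to its base. -/
def pullback (P : ActOver G) {R : D} (f : R ⟶ P.base) : ActOver G where
  base := R
  fib :=
    { psh := (Over.map f).op ⋙ P.fib.psh
      act := fun {T} g p => P.fib.act (T := (Over.map f).op.obj T) g p
      zero_act := fun _ => P.fib.zero_act _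
      add_act := fun _ _ _ => P.fib.add_act _ _ _
      map_act := fun k g p => P.fib.map_act ((Over.map f).op.map k) g p }

lemma isTorsor_pullback (P : ActOver G) (hP : P.fib.IsTorsor (L.over P.base)) {R : D}
    (f : R ⟶ P.base) : (P.pullback f).fib.IsTorsor (L.over R) where
  isSheaf := (Over.map f).op_comp_isSheaf_of_types (L.over R) (L.over P.base)
    ⟨P.fib.psh, (isSheaf_iff_isSheaf_of_type _ _).2 hP.isSheaf⟩
  existsUnique {T} p q := hP.existsUnique (T := (Over.map f).op.obj T) p q
  locally_nonempty := ActPresheaf.over_locally_nonempty' fun {T} t => by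
    obtain ⟨S, hS, hne⟩ := ActPresheaf.over_locally_nonempty hP (t ≫ f)
    exact ⟨S, hS, fun T' k hk => hne k hk _ (Category.assoc _ _ _).symm⟩

/-- The projection from the restriction of `P` to `P`. -/
def pullbackHom (P : ActOver G) {R : D} (f : R ⟶ P.base) : P.pullback f ⟶ P where
  hom := { base := f, app := 𝟙 _ }
  at_act T t s h g p := by
    subst h
    have e := PshOver.Hom.at_eq (X := (P.pullback f).toPsh) (Y := P.toPsh)
      { base := f, app := 𝟙 _ } t
    exact congr($e _).trans (congrArg (P.act (t ≫ f) g) congr($e p)).symm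

lemma pullbackHom_at (P : ActOver G) {R : D} (f : R ⟶ P.base) {T : D} (t : T ⟶ R)
    (p : (P.pullback f).fib.psh.obj (op (Over.mk t))) :
    (Hom.hom (P.pullbackHom f)).at t (t ≫ f) rfl p = p :=
  congr($(PshOver.Hom.at_eq (X := (P.pullback f).toPsh) (Y := P.toPsh)
      { base := f, app := 𝟙 _ } t) p)

lemma comp_hom_at {P Q R : ActOver G} (f : P ⟶ Q) (g : Q ⟶ R) {T : D} (t : T ⟶ P.base)
    (r : T ⟶ Q.base) (s : T ⟶ R.base) (h : t ≫ (Hom.hom (f ≫ g)).base = s)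
    (hf : t ≫ (Hom.hom f).base = r) (hg : r ≫ (Hom.hom g).base = s) :
    (Hom.hom (f ≫ g)).at t s h = (Hom.hom f).at t r hf ≫ (Hom.hom g).at r s hg :=
  PshOver.Hom.comp_at (Hom.hom f) (Hom.hom g) t r s h hf hg

/-- The universal property that makes `pullbackHom` cartesian. The pullback has the same sections as
`P`, so the components of `ψ` serve unchanged as those of the lift. -/
lemma exists_unique_lift (P : ActOver G) {R : D} (f : R ⟶ P.base) (Q : ActOver G)
    (g : Q.base ⟶ R) (ψ : Q ⟶ P) (hψ : (ActOver.proj G).map ψ = g ≫ f) :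
    ∃! χ : Q ⟶ P.pullback f, (ActOver.proj G).map χ = g ∧ χ ≫ P.pullbackHom f = ψ := by
  have hb {T : D} (t : T ⟶ Q.base) : t ≫ (Hom.hom ψ).base = (t ≫ g) ≫ f := by
    rw [Category.assoc]
    exact congrArg _ hψ
  let χ₀ : PshOver.Hom Q.toPsh (P.pullback f).toPsh :=
    PshOver.Hom.ofAt g (fun t => (Hom.hom ψ).at t ((t ≫ g) ≫ f) (hb t)) (fun k t s h =>
      PshOver.Hom.res_at (Hom.hom ψ) k t s _ _ h (hb t) (hb s))
  have hχ₀ {T : D} (t : T ⟶ Q.base) : χ₀.at t (t ≫ g) rfl =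
      (Hom.hom ψ).at t ((t ≫ g) ≫ f) (hb t) :=
    PshOver.Hom.ofAt_at (X := Q.toPsh) (Y := (P.pullback f).toPsh) g _ _ t
  let χ : Q ⟶ P.pullback f :=
    { hom := χ₀
      at_act := fun T t s h a p => by
        subst h
        exact congr($(hχ₀ t) _).trans ((Hom.at_act ψ t _ (hb t) a p).trans
          (congrArg (P.act _ a) congr($(hχ₀ t) p)).symm) }
  refine ⟨χ, ⟨rfl, ?_⟩, ?_⟩
  · refine Hom.ext (PshOver.Hom.ext hψ.symm fun T t s h h' => ?_)
    obtain rfl : s = (t ≫ g) ≫ f := h'.symm.trans (hb t)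
    rw [comp_hom_at χ (P.pullbackHom f) t (t ≫ g) _ h rfl rfl]
    ext p
    exact (P.pullbackHom_at f _ _).trans congr($(hχ₀ t) p)
  · rintro χ' ⟨h₁, h₂⟩
    refine Hom.ext (PshOver.Hom.ext h₁ fun T t s h h' => ?_)
    obtain rfl : t ≫ g = s := h'
    refine Eq.trans ?_ (hχ₀ t).symm
    have e := comp_hom_at χ' (P.pullbackHom f) t (t ≫ g) ((t ≫ g) ≫ f)
      (by rw [h₂]; exact hb t) h rfl
    refine Eq.trans ?_ (e.symm.trans (PshOver.Hom.at_congr (congrArg Hom.hom h₂) t _ _))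
    ext p
    exact (P.pullbackHom_at f _ _).symm

end ActOver

lemma classifyingStack_isFibered (L : GrothendieckTopology D) (G : Dᵒᵖ ⥤ AddCommGrpCat.{w₁}) :
    (classifyingStack L G).p.IsFibered := by
  refine Functor.IsFibered.of_exists_isStronglyCartesian
    (p := (ActOver.isTorsor L G).ι ⋙ ActOver.proj G) fun P R f => ?_
  let Q : (ActOver.isTorsor L G).FullSubcategory :=
    ⟨P.obj.pullback f, P.obj.isTorsor_pullback P.property f⟩
  let φ : Q ⟶ P := ObjectProperty.homMk (P.obj.pullbackHom f)
  have hl : ((ActOver.isTorsor L G).ι ⋙ ActOver.proj G).IsHomLift f φ :=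
    IsHomLift.map ((ActOver.isTorsor L G).ι ⋙ ActOver.proj G) φ
  refine ⟨Q, φ, ?_⟩
  refine { toIsHomLift := hl, universal_property' := fun {Z} g ψ hψ => ?_ }
  have e := IsHomLift.eq_of_isHomLift ((ActOver.isTorsor L G).ι ⋙ ActOver.proj G) (g ≫ f) ψ
  obtain ⟨χ, ⟨h₁, h₂⟩, hu⟩ := P.obj.exists_unique_lift f Z.obj g ψ.hom e.symm
  let χ₀ : Z ⟶ Q := ObjectProperty.homMk χ
  refine ⟨χ₀, ⟨?_, ObjectProperty.hom_ext _ h₂⟩, ?_⟩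
  · subst h₁
    exact IsHomLift.map ((ActOver.isTorsor L G).ι ⋙ ActOver.proj G) χ₀
  · rintro χ' ⟨h₁', h₂'⟩
    refine ObjectProperty.hom_ext _ (hu _ ⟨?_, congrArg (·.hom) h₂'⟩)
    exact (@IsHomLift.eq_of_isHomLift _ _ _ _ ((ActOver.isTorsor L G).ι ⋙ ActOver.proj G)
      Z Q g χ' h₁').symm

end TorsorLemmas

end SqZero

/-! ### Global sections and left exactness for abelian sheaves. -/

namespace SqZero

section GlobalSections

universe u₁ v₁ w₁ w₂

variable {D : Type u₁} [Category.{v₁} D] {L : GrothendieckTopology D}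
  [HasSheafify L AddCommGrpCat.{w₁}]

/-- The group `ℤ` is free on `1` and sheafification is a left adjoint, so a global section, here a
compatible family over all objects, is the same as a map out of the constant sheaf. -/
lemma exists_hom_constOne (Q : Sheaf L AddCommGrpCat.{w₁}) (s : ∀ T : Dᵒᵖ, Q.obj.obj T)
    (hs : ∀ ⦃S T : Dᵒᵖ⦄ (k : S ⟶ T), Q.obj.map k (s S) = s T) :
    ∃ x : (constantSheaf L AddCommGrpCat.{w₁}).obj (AddCommGrpCat.of (ULift.{w₁} ℤ)) ⟶ Q,
      ∀ T, x.hom.app T (constOne L T) = s T := by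
  let η : (Functor.const Dᵒᵖ).obj (AddCommGrpCat.of (ULift.{w₁} ℤ)) ⟶ Q.obj :=
    { app := fun T => AddCommGrpCat.ofHom
        (((smulAddHom ℤ (Q.obj.obj T)).flip (s T)).comp AddEquiv.ulift.toAddMonoidHom)
      naturality := fun S T k => by
        ext n
        change n.down • s T = Q.obj.map k (n.down • s S)
        rw [map_zsmul, hs] }
  refine ⟨⟨sheafifyLift L η Q.property⟩, fun T => ?_⟩
  have e := congr(($(toSheafify_sheafifyLift L η Q.property)).app T (ULift.up 1))
  exact e.trans (one_smul ℤ (s T))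

lemma hom_ext_constOne {Q : Sheaf L AddCommGrpCat.{w₁}}
    {x y : (constantSheaf L AddCommGrpCat.{w₁}).obj (AddCommGrpCat.of (ULift.{w₁} ℤ)) ⟶ Q}
    (h : ∀ T, x.hom.app T (constOne L T) = y.hom.app T (constOne L T)) : x = y := by
  apply Sheaf.hom_ext
  refine sheafify_hom_ext L _ _ Q.property ?_
  ext T n
  let a : ULift.{w₁} ℤ →+ Q.obj.obj T := (toSheafify L
    ((Functor.const Dᵒᵖ).obj (AddCommGrpCat.of (ULift.{w₁} ℤ))) ≫ x.hom).app T |>.hom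
  let b : ULift.{w₁} ℤ →+ Q.obj.obj T := (toSheafify L
    ((Functor.const Dᵒᵖ).obj (AddCommGrpCat.of (ULift.{w₁} ℤ))) ≫ y.hom).app T |>.hom
  change a n = b n
  have hn : n = n.down • (ULift.up 1 : ULift.{w₁} ℤ) := by
    exact ULift.ext _ _ (by simp)
  rw [hn, map_zsmul, map_zsmul]
  exact congrArg _ (h T)

lemma map_constOne {S T : Dᵒᵖ} (k : S ⟶ T) :
    ((constantSheaf L AddCommGrpCat.{w₁}).obj
      (AddCommGrpCat.of (ULift.{w₁} ℤ))).obj.map k (constOne L S) = constOne L T :=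
  congr($((toSheafify L
    ((Functor.const Dᵒᵖ).obj (AddCommGrpCat.of (ULift.{w₁} ℤ)))).naturality k) (ULift.up 1)).symm

lemma map_app_constOne {Q : Sheaf L AddCommGrpCat.{w₁}}
    (x : (constantSheaf L AddCommGrpCat.{w₁}).obj (AddCommGrpCat.of (ULift.{w₁} ℤ)) ⟶ Q)
    {S T : Dᵒᵖ} (k : S ⟶ T) :
    Q.obj.map k (x.hom.app S (constOne L S)) = x.hom.app T (constOne L T) := by
  rw [← map_constOne k]
  exact congr($(x.hom.naturality k) (constOne L S)).symm

variable {S : ShortComplex (Sheaf L AddCommGrpCat.{w₁})} (hS : S.ShortExact)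

include hS in
lemma app_injective (T : Dᵒᵖ) : Function.Injective (S.f.hom.app T) := by
  have := hS.mono_f
  have : Mono (((sheafToPresheaf L AddCommGrpCat.{w₁}) ⋙ (evaluation _ _).obj T).map S.f) :=
    inferInstance
  exact (AddCommGrpCat.mono_iff_injective _).1 this

include hS in
-- Taking sections over `T` is left exact on sheaves.
lemma exists_app_eq {T : Dᵒᵖ} (s : S.X₂.obj.obj T) (h : S.g.hom.app T s = 0) :
    ∃ a : S.X₁.obj.obj T, S.f.hom.app T a = s := by
  have := hS.mono_f
  have e := hS.exact.map_of_mono_of_preservesKernel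
    ((sheafToPresheaf L AddCommGrpCat.{w₁}) ⋙ (evaluation _ _).obj T) this inferInstance
  rw [ShortComplex.ab_exact_iff] at e
  exact e s h

end GlobalSections

/-! ### Torsors under an abelian sheaf are classified by `H¹`. -/

section TorsorClass

universe w w₂

variable {D : Type w} [Category.{w} D] {L : GrothendieckTopology D}

/-- The torsor of local preimages of a global section of the quotient of a short exact sequence. -/
def preimageTorsor (S : ShortComplex (Sheaf L AddCommGrpCat.{w}))
    (x : (constantSheaf L AddCommGrpCat.{w}).obj (AddCommGrpCat.of (ULift.{w} ℤ)) ⟶ S.X₃) :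
    ActPresheaf S.X₁.obj where
  psh :=
    { obj := fun T => { s : S.X₂.obj.obj T // S.g.hom.app T s = x.hom.app T (constOne L T) }
      map := fun {T T'} k => ↾ fun s => ⟨S.X₂.obj.map k s.1,
        congr($(S.g.hom.naturality k) s.1).trans
          ((congrArg (S.X₃.obj.map k) s.2).trans (map_app_constOne x k))⟩
      map_id := fun T => by
        ext s
        exact congr($(S.X₂.obj.map_id T) s.1)
      map_comp := fun k k' => by
        ext s
        exact congr($(S.X₂.obj.map_comp k k') s.1) }
  act {T} a s := ⟨S.f.hom.app T a + s.1, by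
    rw [map_add, s.2]
    exact (congrArg (· + _) congr(($S.zero).hom.app T a)).trans (zero_add _)⟩
  zero_act s := Subtype.ext (by
    change S.f.hom.app _ 0 + s.1 = s.1
    rw [map_zero, zero_add])
  add_act a b s := Subtype.ext (by
    change S.f.hom.app _ (a + b) + s.1 = S.f.hom.app _ a + (S.f.hom.app _ b + s.1)
    rw [map_add, add_assoc])
  map_act {T T'} k a s := Subtype.ext ((map_add (S.X₂.obj.map k).hom _ _).trans
    (congrArg (· + _) congr($(S.f.hom.naturality k) a).symm))

/-- The condition that cuts the preimages out of `S.X₂` is an equality in the separated presheaf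
`S.X₃`, so it can be checked locally. Left exactness gives simple transitivity, and local points
exist because an epimorphism of sheaves is locally surjective. -/
lemma preimageTorsor_isTorsor {S : ShortComplex (Sheaf L AddCommGrpCat.{w})} (hS : S.ShortExact)
    (x : (constantSheaf L AddCommGrpCat.{w}).obj (AddCommGrpCat.of (ULift.{w} ℤ)) ⟶ S.X₃) :
    (preimageTorsor S x).IsTorsor L where
  isSheaf := by
    have h₂ := (isSheaf_iff_isSheaf_of_type _ _).1 ((Presheaf.isSheaf_iff_isSheaf_forget L _
      (forget AddCommGrpCat.{w})).1 S.X₂.property)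
    have h₃ := (isSheaf_iff_isSheaf_of_type _ _).1 ((Presheaf.isSheaf_iff_isSheaf_forget L _
      (forget AddCommGrpCat.{w})).1 S.X₃.property)
    intro T R hR s hs
    obtain ⟨y, hy, huniq⟩ := h₂ R hR (fun T' k hk => (s k hk).1)
      (fun Y₁ Y₂ Z g₁ g₂ f₁ f₂ k₁ k₂ e => congrArg Subtype.val (hs g₁ g₂ k₁ k₂ e))
    refine ⟨⟨y, (h₃.isSeparated R hR).ext fun T' k hk => ?_⟩, fun T' k hk => Subtype.ext (hy k hk),
      fun z hz => Subtype.ext (huniq z.1 fun T' k hk => congrArg Subtype.val (hz k hk))⟩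
    refine Eq.trans ?_ (map_app_constOne x k.op).symm
    refine Eq.trans ?_ (s k hk).2
    refine congr($(S.g.hom.naturality k.op) y).symm.trans ?_
    exact congrArg (S.g.hom.app _) (hy k hk)
  existsUnique {T} p q := by
    obtain ⟨a, ha⟩ := exists_app_eq hS (q.1 - p.1) (by rw [map_sub, p.2, q.2, sub_self])
    refine ⟨a, Subtype.ext ?_, fun b hb => app_injective hS T ?_⟩
    · exact (congrArg (· + p.1) ha).trans (sub_add_cancel _ _)
    · rw [ha]
      exact eq_sub_of_add_eq (congrArg Subtype.val hb)
  locally_nonempty T := by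
    have := hS.epi_g
    have hg : Sheaf.IsLocallySurjective S.g := (Sheaf.isLocallySurjective_iff_epi' _ _).2 this
    refine ⟨_, Presheaf.imageSieve_mem L S.g.hom (x.hom.app (op T) (constOne L (op T))), ?_⟩
    rintro T' k ⟨s, hs⟩
    exact ⟨⟨s, hs.trans (map_app_constOne x k.op)⟩⟩

/-- An equivariant map from `P` to the torsor of preimages of `x`. -/
structure PreimageMap (S : ShortComplex (Sheaf L AddCommGrpCat.{w})) (P : ActPresheaf S.X₁.obj)
    (x : (constantSheaf L AddCommGrpCat.{w}).obj (AddCommGrpCat.of (ULift.{w} ℤ)) ⟶ S.X₃) where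
  app : ∀ T : Dᵒᵖ, P.psh.obj T → S.X₂.obj.obj T
  app_map : ∀ ⦃T T' : Dᵒᵖ⦄ (k : T ⟶ T') (p : P.psh.obj T),
    app T' (P.psh.map k p) = S.X₂.obj.map k (app T p)
  app_act : ∀ (T : Dᵒᵖ) (g : S.X₁.obj.obj T) (p : P.psh.obj T),
    app T (P.act g p) = S.f.hom.app T g + app T p
  g_app : ∀ (T : Dᵒᵖ) (p : P.psh.obj T), S.g.hom.app T (app T p) = x.hom.app T (constOne L T)

namespace PreimageMap

variable {S : ShortComplex (Sheaf L AddCommGrpCat.{w})} {P : ActPresheaf S.X₁.obj}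
  {x x' : (constantSheaf L AddCommGrpCat.{w}).obj (AddCommGrpCat.of (ULift.{w} ℤ)) ⟶ S.X₃}

/-- The morphism to the torsor of preimages. -/
def toHom (f : PreimageMap S P x) : P.psh ⟶ (preimageTorsor S x).psh where
  app T := ↾ fun p => ⟨f.app T p, f.g_app T p⟩
  naturality T T' k := by
    ext p
    exact Subtype.ext (f.app_map k p)

lemma toHom_act (f : PreimageMap S P x) (T : Dᵒᵖ) (g : S.X₁.obj.obj T) (p : P.psh.obj T) :
    f.toHom.app T (P.act g p) = (preimageTorsor S x).act g (f.toHom.app T p) :=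
  Subtype.ext (f.app_act T g p)

/-- Adding a global section of the middle term. -/
noncomputable def add (f : PreimageMap S P x)
    (e : (constantSheaf L AddCommGrpCat.{w}).obj (AddCommGrpCat.of (ULift.{w} ℤ)) ⟶ S.X₂)
    (he : x + e ≫ S.g = x') : PreimageMap S P x' where
  app T p := f.app T p + e.hom.app T (constOne L T)
  app_map T T' k p := by rw [f.app_map, map_add, map_app_constOne]
  app_act T g p := by rw [f.app_act, add_assoc]
  g_app T p := by
    rw [map_add, f.g_app, ← he]
    rfl

end PreimageMap

section FunctionSheaf

/-- The presheaf of maps of presheaves from `P` to `F`. -/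
def functionPresheaf (P : Dᵒᵖ ⥤ Type w) (F : Dᵒᵖ ⥤ AddCommGrpCat.{w}) :
    Dᵒᵖ ⥤ AddCommGrpCat.{w} where
  -- Functions `P ⟶ F` are encoded as additive maps from the free abelian groups on `P`, so that
  -- they add up as natural transformations.
  obj T := AddCommGrpCat.of ((Over.forget T.unop).op ⋙ P ⋙ AddCommGrpCat.free ⟶
    (Over.forget T.unop).op ⋙ F)
  map k := AddCommGrpCat.ofHom (AddMonoidHom.mk' (Functor.whiskerLeft (Over.map k.unop).op)
    fun _ _ => rfl)
  map_id T := by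
    exact AddCommGrpCat.hom_ext (AddMonoidHom.ext fun x =>
      congr($((presheafHom (P ⋙ AddCommGrpCat.free) F).map_id T) x))
  map_comp k k' := by
    exact AddCommGrpCat.hom_ext (AddMonoidHom.ext fun x =>
      congr($((presheafHom (P ⋙ AddCommGrpCat.free) F).map_comp k k') x))

/-- An internal hom is a sheaf as soon as its target is. -/
lemma functionPresheaf_isSheaf (P : Dᵒᵖ ⥤ Type w) {F : Dᵒᵖ ⥤ AddCommGrpCat.{w}}
    (hF : Presheaf.IsSheaf L F) : Presheaf.IsSheaf L (functionPresheaf P F) := by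
  refine (Presheaf.isSheaf_iff_isSheaf_forget L _ (forget AddCommGrpCat.{w})).2 ?_
  exact Presheaf.IsSheaf.hom (P ⋙ AddCommGrpCat.free) F hF

section

variable {P : Dᵒᵖ ⥤ Type w} {F : Dᵒᵖ ⥤ AddCommGrpCat.{w}}

/-- A section of `functionPresheaf P F` from a compatible family of functions. -/
def functionMk {T : Dᵒᵖ} (a : ∀ (Y : Over T.unop), P.obj (op Y.left) → F.obj (op Y.left))
    (ha : ∀ {Y Z : Over T.unop} (k : Y ⟶ Z) (p : P.obj (op Z.left)),
      a Y (P.map k.left.op p) = F.map k.left.op (a Z p)) : (functionPresheaf P F).obj T :=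
  show (Over.forget T.unop).op ⋙ P ⋙ AddCommGrpCat.free ⟶ (Over.forget T.unop).op ⋙ F from
  { app := fun Y => AddCommGrpCat.ofHom (FreeAbelianGroup.lift (a Y.unop))
    naturality := fun Y Z k => by
      refine AddCommGrpCat.hom_ext (FreeAbelianGroup.lift_ext _ _ fun p => ?_)
      refine (FreeAbelianGroup.lift_apply_of (a Z.unop) (P.map k.unop.left.op p)).trans ?_
      exact (ha k.unop p).trans (congrArg (F.map k.unop.left.op)
        (FreeAbelianGroup.lift_apply_of (a Y.unop) p).symm) }

/-- The value of a section of `functionPresheaf P F`. -/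
def functionEval {T : Dᵒᵖ} (x : (functionPresheaf P F).obj T) (Y : Over T.unop)
    (p : P.obj (op Y.left)) : F.obj (op Y.left) :=
  NatTrans.app (show (Over.forget T.unop).op ⋙ P ⋙ AddCommGrpCat.free ⟶
    (Over.forget T.unop).op ⋙ F from x) (op Y) (FreeAbelianGroup.of p)

lemma functionEval_ext {T : Dᵒᵖ} {x y : (functionPresheaf P F).obj T}
    (h : ∀ (Y : Over T.unop) (p : P.obj (op Y.left)), functionEval x Y p = functionEval y Y p) :
    x = y :=
  NatTrans.ext (funext fun Y => AddCommGrpCat.hom_ext (FreeAbelianGroup.lift_ext _ _ (h Y.unop)))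

lemma functionEval_mk {T : Dᵒᵖ}
    (a : ∀ (Y : Over T.unop), P.obj (op Y.left) → F.obj (op Y.left))
    (ha : ∀ {Y Z : Over T.unop} (k : Y ⟶ Z) (p : P.obj (op Z.left)),
      a Y (P.map k.left.op p) = F.map k.left.op (a Z p)) (Y : Over T.unop)
    (p : P.obj (op Y.left)) : functionEval (functionMk a ha) Y p = a Y p :=
  FreeAbelianGroup.lift_apply_of _ _

lemma functionEval_add {T : Dᵒᵖ} (x y : (functionPresheaf P F).obj T) (Y : Over T.unop)
    (p : P.obj (op Y.left)) : functionEval (x + y) Y p = functionEval x Y p + functionEval y Y p :=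
  rfl

/-- A constant function. -/
def functionConst {T : Dᵒᵖ} (g : F.obj T) : (functionPresheaf P F).obj T :=
  functionMk (fun Y _ => F.map Y.hom.op g) fun {Y Z} k p => by
    rw [← Functor.map_comp_apply, ← op_comp, Over.w]

lemma functionEval_functionConst {T : Dᵒᵖ} (g : F.obj T) (Y : Over T.unop) (p : P.obj (op Y.left)) :
    functionEval (functionConst (P := P) g) Y p = F.map Y.hom.op g :=
  FreeAbelianGroup.lift_apply_of _ p

lemma functionConst_add {T : Dᵒᵖ} (g h : F.obj T) :
    functionConst (P := P) (g + h) = functionConst g + functionConst h := by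
  refine functionEval_ext fun Y p => ?_
  rw [functionEval_add, functionEval_functionConst, functionEval_functionConst,
    functionEval_functionConst, map_add]

variable (P F) in
/-- The inclusion of the constant functions. -/
def constFunction : F ⟶ functionPresheaf P F where
  app T := AddCommGrpCat.ofHom
    (show F.obj T →+ (functionPresheaf P F).obj T from AddMonoidHom.mk' functionConst
      functionConst_add)
  naturality S T k := by
    refine AddCommGrpCat.hom_ext (AddMonoidHom.ext fun g => functionEval_ext fun Y p => ?_)
    refine (functionEval_functionConst _ Y p).trans (Eq.trans ?_
      (functionEval_functionConst _ ((Over.map k.unop).obj Y) p).symm)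
    exact (Functor.map_comp_apply F k Y.hom.op g).symm

lemma constFunction_app {T : Dᵒᵖ} (g : F.obj T) :
    (constFunction P F).app T g = functionConst (P := P) g :=
  rfl

end

end FunctionSheaf

/-- A torsor under `F` maps to a sheaf of groups containing `F`. -/
lemma exists_equivariant_map {F : Sheaf L AddCommGrpCat.{w}} {P : ActPresheaf F.obj}
    (hP : P.IsTorsor L) :
    ∃ (I : Sheaf L AddCommGrpCat.{w}) (i : F ⟶ I) (_ : Mono i)
      (f : ∀ T : Dᵒᵖ, P.psh.obj T → I.obj.obj T),
      (∀ ⦃S T : Dᵒᵖ⦄ (k : S ⟶ T) (p : P.psh.obj S),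
        f T (P.psh.map k p) = I.obj.map k (f S p)) ∧
      (∀ (T : Dᵒᵖ) (g : F.obj.obj T) (p : P.psh.obj T),
        f T (P.act g p) = i.hom.app T g + f T p) := by
  -- `d p q` is the difference `q - p` in `F`.
  choose d hd₀ hu₀ using fun (T : Dᵒᵖ) => hP.existsUnique (T := T)
  have hd {T : Dᵒᵖ} (p q : P.psh.obj T) : P.act (d T p q) p = q := hd₀ T p q
  have hu {T : Dᵒᵖ} {p q : P.psh.obj T} {g : F.obj.obj T} (h : P.act g p = q) : d T p q = g :=
    (hu₀ T p q g h).symm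
  have hd_map {S T : Dᵒᵖ} (k : S ⟶ T) (p q : P.psh.obj S) :
      d T (P.psh.map k p) (P.psh.map k q) = F.obj.map k (d S p q) :=
    hu (by rw [← P.map_act, hd])
  have hd_act {T : Dᵒᵖ} (g : F.obj.obj T) (p q : P.psh.obj T) :
      d T p (P.act g q) = g + d T p q :=
    hu (by rw [P.add_act, hd])
  let I : Sheaf L AddCommGrpCat.{w} :=
    ⟨functionPresheaf P.psh F.obj, functionPresheaf_isSheaf P.psh F.property⟩
  let i : F ⟶ I := ⟨constFunction P.psh F.obj⟩
  -- A constant function is recovered by evaluating it at a point. Points of `P` exist only locally,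
  -- which suffices because `F` is separated.
  have inj (T : Dᵒᵖ) : Function.Injective ((constFunction P.psh F.obj).app T) := by
    intro a b hab
    obtain ⟨R, hR, hne⟩ := hP.locally_nonempty T.unop
    have hF := (isSheaf_iff_isSheaf_of_type _ _).1 ((Presheaf.isSheaf_iff_isSheaf_forget L _
      (forget AddCommGrpCat.{w})).1 F.property)
    refine (hF.isSeparated R hR).ext fun T' k hk => ?_
    obtain ⟨p⟩ := hne k hk
    rw [constFunction_app, constFunction_app] at hab
    exact (functionEval_functionConst a (Over.mk k) p).symm.trans
      ((congrArg (fun z => functionEval z (Over.mk k) p) hab).trans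
        (functionEval_functionConst b (Over.mk k) p))
  have hi₀ : Mono (constFunction P.psh F.obj) := by
    have (T : Dᵒᵖ) : Mono ((constFunction P.psh F.obj).app T) :=
      (AddCommGrpCat.mono_iff_injective _).2 (inj T)
    exact NatTrans.mono_of_mono_app _
  have hi : Mono i := (sheafToPresheaf L AddCommGrpCat.{w}).mono_of_mono_map hi₀
  have hc (T : Dᵒᵖ) (p : P.psh.obj T) {Y Z : Over T.unop} (k : Y ⟶ Z)
      (q : P.psh.obj (op Z.left)) : d _ (P.psh.map k.left.op q) (P.psh.map Y.hom.op p) =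
        F.obj.map k.left.op (d _ q (P.psh.map Z.hom.op p)) := by
    rw [← hd_map, ← Functor.map_comp_apply, ← op_comp, Over.w]
  -- The point `p` becomes the function `q ↦ p - q`. Moving `p` by `g` adds the constant `g`.
  let f (T : Dᵒᵖ) (p : P.psh.obj T) : (functionPresheaf P.psh F.obj).obj T :=
    functionMk (fun Y q => d _ q (P.psh.map Y.hom.op p)) (hc T p)
  have hf (T : Dᵒᵖ) (p : P.psh.obj T) (Y : Over T.unop) (q : P.psh.obj (op Y.left)) :
      functionEval (f T p) Y q = d _ q (P.psh.map Y.hom.op p) := functionEval_mk _ (hc T p) Y q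
  refine ⟨I, i, hi, f, fun S T k p => functionEval_ext fun Y q => ?_,
    fun T g p => functionEval_ext fun Y q => ?_⟩
  · refine (hf T _ Y q).trans (Eq.trans ?_ (hf S p ((Over.map k.unop).obj Y) q).symm)
    exact congrArg (d _ q) (Functor.map_comp_apply P.psh k Y.hom.op p).symm
  · refine (hf T _ Y q).trans ?_
    rw [P.map_act, hd_act]
    exact congrArg₂ (· + ·) (functionEval_functionConst g Y q).symm (hf T p Y q).symm

/-- A constant map from a torsor to a sheaf of groups is a global section. -/
lemma ActPresheaf.IsTorsor.exists_globalSection {G : Dᵒᵖ ⥤ AddCommGrpCat.{w}} {P : ActPresheaf G}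
    (hP : P.IsTorsor L) (Q : Sheaf L AddCommGrpCat.{w}) (φ : ∀ T : Dᵒᵖ, P.psh.obj T → Q.obj.obj T)
    (hmap : ∀ {T T' : Dᵒᵖ} (k : T ⟶ T') (p : P.psh.obj T),
      φ T' (P.psh.map k p) = Q.obj.map k (φ T p))
    (hact : ∀ {T : Dᵒᵖ} (g : G.obj T) (p : P.psh.obj T), φ T (P.act g p) = φ T p) :
    ∃ x : (constantSheaf L AddCommGrpCat.{w}).obj (AddCommGrpCat.of (ULift.{w} ℤ)) ⟶ Q,
      ∀ (T : Dᵒᵖ) (p : P.psh.obj T), φ T p = x.hom.app T (constOne L T) := by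
  have hφ {T : Dᵒᵖ} (p q : P.psh.obj T) : φ T p = φ T q := by
    obtain ⟨g, rfl, -⟩ := hP.existsUnique p q
    rw [hact]
  have h₃ := (isSheaf_iff_isSheaf_of_type _ _).1 ((Presheaf.isSheaf_iff_isSheaf_forget L _
    (forget AddCommGrpCat.{w})).1 Q.property)
  -- All points over one object have the same value, so the local values glue. `P` may have no point
  -- over `T` itself; hence `s` is characterized by its restrictions to the objects that carry
  -- points.
  have hs (T : Dᵒᵖ) : ∃ s : Q.obj.obj T, ∀ {T' : Dᵒᵖ} (k : T ⟶ T') (p : P.psh.obj T'),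
      Q.obj.map k s = φ T' p := by
    obtain ⟨R, hR, hne⟩ := hP.locally_nonempty T.unop
    let p {T' : D} (k : T' ⟶ T.unop) (hk : R k) : P.psh.obj (op T') := (hne k hk).some
    obtain ⟨s, hs, -⟩ := h₃ R hR (fun T' k hk => φ _ (p k hk)) (by
      intro Y₁ Y₂ Z g₁ g₂ f₁ f₂ h₁ h₂ e
      exact (hmap g₁.op (p f₁ h₁)).symm.trans ((hφ _ _).trans (hmap g₂.op (p f₂ h₂))))
    refine ⟨s, fun {T'} k q => ?_⟩
    refine (h₃.isSeparated _ (L.pullback_stable k.unop hR)).ext fun T'' j hj => ?_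
    have e := hs (j ≫ k.unop) hj
    refine (Functor.map_comp_apply Q.obj k j.op s).symm.trans (e.trans ?_)
    exact (hφ _ (P.psh.map j.op q)).trans (hmap j.op q)
  choose s hs using hs
  obtain ⟨x, hx⟩ := exists_hom_constOne Q s fun T T' k => by
    obtain ⟨R, hR, hne⟩ := hP.locally_nonempty T'.unop
    refine (h₃.isSeparated _ hR).ext fun T'' j hj => ?_
    obtain ⟨q⟩ := hne j hj
    exact (Functor.map_comp_apply Q.obj k j.op _).symm.trans
      ((hs T (k ≫ j.op) q).trans (hs T' j.op q).symm)
  refine ⟨x, fun T p => ?_⟩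
  rw [hx]
  refine (hs T (𝟙 T) p).symm.trans ?_
  exact congr($(Q.obj.map_id T) (s T))

/-- Embed the torsor in a sheaf of groups that contains `S.X₁`, and extend `S.f` to that sheaf by
injectivity of `S.X₂`. The composite from `P` to `S.X₃` is invariant under `S.X₁`, hence a global
section. -/
lemma exists_preimageMap {S : ShortComplex (Sheaf L AddCommGrpCat.{w})} [Injective S.X₂]
    {P : ActPresheaf S.X₁.obj} (hP : P.IsTorsor L) :
    ∃ x, Nonempty (PreimageMap S P x) := by
  obtain ⟨I, i, hi, f, hf₁, hf₂⟩ := exists_equivariant_map hP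
  let a : I ⟶ S.X₂ := Injective.factorThru S.f i
  have ha (T : Dᵒᵖ) (g : S.X₁.obj.obj T) : a.hom.app T (i.hom.app T g) = S.f.hom.app T g :=
    congr(($(Injective.comp_factorThru S.f i)).hom.app T g)
  obtain ⟨x, hx⟩ := hP.exists_globalSection S.X₃
    (fun T p => S.g.hom.app T (a.hom.app T (f T p)))
    (fun {T T'} k p => by
      rw [hf₁]
      exact (congrArg (S.g.hom.app T') congr($(a.hom.naturality k) (f T p))).trans
        congr($(S.g.hom.naturality k) (a.hom.app T (f T p))))
    (fun {T} g p => by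
      rw [hf₂, map_add, map_add, ha]
      exact (congrArg (· + _) congr(($S.zero).hom.app T g)).trans (zero_add _))
  exact ⟨x, ⟨{
    app := fun T p => a.hom.app T (f T p)
    app_map := fun T T' k p =>
      (congrArg (a.hom.app T') (hf₁ k p)).trans congr($(a.hom.naturality k) (f T p))
    app_act := fun T g p => by rw [hf₂, map_add, ha]
    g_app := hx }⟩⟩

/-- Two equivariant maps from a torsor to torsors of preimages differ by a global section. -/
lemma PreimageMap.exists_eq_add {S : ShortComplex (Sheaf L AddCommGrpCat.{w})}
    {P : ActPresheaf S.X₁.obj} (hP : P.IsTorsor L) {x x'} (f : PreimageMap S P x)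
    (f' : PreimageMap S P x') : ∃ e, x' = x + e ≫ S.g := by
  -- The translations cancel in the difference of two equivariant maps, so the difference is
  -- invariant.
  obtain ⟨e, he⟩ := hP.exists_globalSection S.X₂ (fun T p => f'.app T p - f.app T p)
    (fun k p => by rw [f.app_map, f'.app_map, map_sub])
    (fun g p => by rw [f.app_act, f'.app_act, add_sub_add_left_eq_sub])
  refine ⟨e, hom_ext_constOne fun T => ?_⟩
  have hs := (isSheaf_iff_isSheaf_of_type _ _).1 ((Presheaf.isSheaf_iff_isSheaf_forget L _
    (forget AddCommGrpCat.{w})).1 S.X₃.property)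
  obtain ⟨R, hR, hne⟩ := hP.locally_nonempty T.unop
  refine (hs.isSeparated _ hR).ext fun T' j hj => ?_
  obtain ⟨p⟩ := hne j hj
  refine (map_app_constOne x' j.op).trans (Eq.trans ?_ (map_app_constOne (x + e ≫ S.g) j.op).symm)
  refine Eq.trans ?_ (congrArg (x.hom.app _ (constOne L _) + S.g.hom.app _ ·) (he _ p))
  refine Eq.trans ?_ (congrArg (· + _) (f.g_app _ p))
  refine (f'.g_app _ p).symm.trans (Eq.trans ?_ (map_add (S.g.hom.app _).hom _ _))
  rw [add_sub_cancel]

variable [EnoughInjectives (Sheaf L AddCommGrpCat.{w})] in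
lemma exists_injective_shortExact (F : Sheaf L AddCommGrpCat.{w}) :
    ∃ (I Q : Sheaf L AddCommGrpCat.{w}) (i : F ⟶ I) (q : I ⟶ Q) (w : i ≫ q = 0),
      Injective I ∧ (ShortComplex.mk i q w).ShortExact :=
  ⟨_, _, Injective.ι F, cokernel.π (Injective.ι F), cokernel.condition _, inferInstance,
    { exact := ShortComplex.exact_cokernel _ }⟩

variable [HasExt.{w₂} (Sheaf L AddCommGrpCat.{w})]

lemma PreimageMap.isTorsorClass {S : ShortComplex (Sheaf L AddCommGrpCat.{w})}
    (hS : S.ShortExact) {P : ActPresheaf S.X₁.obj} {x} (f : PreimageMap S P x) :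
    IsTorsorClass S.X₁ P ((Abelian.Ext.mk₀ x).comp hS.extClass (zero_add 1)) :=
  ⟨S.X₂, S.X₃, S.f, S.g, S.zero, hS, x, f.app, f.app_map, f.app_act, f.g_app, rfl⟩

/-- Precomposing the equivariant map to `I` with `θ` keeps the exact sequence and the section of
`Q`. This makes the class an invariant of isomorphism. -/
lemma IsTorsorClass.of_hom {F : Sheaf L AddCommGrpCat.{w}}
    {P P' : ActPresheaf F.obj} {c : Sheaf.H.{w₂} F 1}
    (h : IsTorsorClass F P' c) (θ : P.psh ⟶ P'.psh)
    (hθ : ∀ (T : Dᵒᵖ) (g : F.obj.obj T) (p : P.psh.obj T),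
      θ.app T (P.act g p) = P'.act g (θ.app T p)) : IsTorsorClass F P c := by
  obtain ⟨I, Q, i, q, w, hS, x, f, hf₁, hf₂, hf₃, rfl⟩ := h
  refine ⟨I, Q, i, q, w, hS, x, fun T p => f T (θ.app T p), ?_, ?_, ?_, rfl⟩
  · intro T T' k p
    exact (congrArg (f T') congr($(θ.naturality k) p)).trans (hf₁ k _)
  · intro T g p
    change f T (θ.app T (P.act g p)) = _
    rw [hθ, hf₂]
  · intro T p
    exact hf₃ T _

/-- Two classes may be witnessed by different exact sequences. Each of these maps to a given
sequence with injective middle term, by the identity on the left, and naturality of the connecting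
map moves the computation there. All comparisons can thus be made in a single sequence. -/
lemma IsTorsorClass.exists_preimageMap {S : ShortComplex (Sheaf L AddCommGrpCat.{w})}
    (hS : S.ShortExact) [Injective S.X₂] {P : ActPresheaf S.X₁.obj} {c : Sheaf.H.{w₂} S.X₁ 1}
    (h : IsTorsorClass S.X₁ P c) :
    ∃ x, Nonempty (PreimageMap S P x) ∧
      c = (Abelian.Ext.mk₀ x).comp hS.extClass (zero_add 1) := by
  obtain ⟨I, Q, i, q, w, hS', x, f, hf₁, hf₂, hf₃, rfl⟩ := h
  have := hS'.mono_f
  let a : I ⟶ S.X₂ := Injective.factorThru S.f i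
  have ha : i ≫ a = S.f := Injective.comp_factorThru S.f i
  have hepi := hS'.epi_g
  let b : Q ⟶ S.X₃ := hS'.exact.desc (a ≫ S.g) (by
    change i ≫ a ≫ S.g = 0
    rw [← Category.assoc, ha, S.zero])
  have hb : q ≫ b = a ≫ S.g := hS'.exact.g_desc _ _
  refine ⟨x ≫ b, ⟨{
    app := fun T p => a.hom.app T (f T p)
    app_map := fun T T' k p =>
      (congrArg (a.hom.app T') (hf₁ k p)).trans congr($(a.hom.naturality k) (f T p))
    app_act := fun T g p => by
      rw [hf₂, map_add, ← ha]
      rfl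
    g_app := fun T p =>
      congr(($hb).hom.app T (f T p)).symm.trans (congrArg (b.hom.app T) (hf₃ T p)) }⟩, ?_⟩
  -- The identity in degree one is what keeps the class unchanged under `extClass_naturality`.
  · let φ : ShortComplex.mk i q w ⟶ S :=
      { τ₁ := 𝟙 _, τ₂ := a, τ₃ := b, comm₁₂ := by simp [ha], comm₂₃ := hb.symm }
    have e := ShortComplex.ShortExact.extClass_naturality hS' hS φ
    change _ = (Abelian.Ext.mk₀ b).comp hS.extClass (zero_add 1) at e
    rw [← Abelian.Ext.mk₀_comp_mk₀, Abelian.Ext.comp_assoc_of_second_deg_zero, ← e]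
    exact congrArg (fun z => (Abelian.Ext.mk₀ x).comp z (zero_add 1))
      (Abelian.Ext.comp_mk₀_id _).symm

/-- Long exact sequence: the difference `x' - x` is killed by the connecting map, so it comes from
the middle term. -/
lemma exists_eq_add_of_comp_extClass_eq {S : ShortComplex (Sheaf L AddCommGrpCat.{w})}
    (hS : S.ShortExact) {Z : Sheaf L AddCommGrpCat.{w}} {x x' : Z ⟶ S.X₃}
    (h : (Abelian.Ext.mk₀ x).comp hS.extClass (zero_add 1) =
      (Abelian.Ext.mk₀ x').comp hS.extClass (zero_add 1)) : ∃ e : Z ⟶ S.X₂, x + e ≫ S.g = x' := by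
  obtain ⟨e, he⟩ := Abelian.Ext.covariant_sequence_exact₃ Z hS (Abelian.Ext.mk₀ (x' - x))
    (zero_add 1) (by
      rw [sub_eq_add_neg, Abelian.Ext.mk₀_add, Abelian.Ext.mk₀_neg, Abelian.Ext.add_comp,
        Abelian.Ext.neg_comp, h, add_neg_cancel])
  obtain ⟨e, rfl⟩ := (Abelian.Ext.mk₀_bijective _ _).2 e
  rw [Abelian.Ext.mk₀_comp_mk₀] at he
  exact ⟨e, by rw [(Abelian.Ext.mk₀_bijective _ _).1 he]; abel⟩

variable [EnoughInjectives (Sheaf L AddCommGrpCat.{w})] {F : Sheaf L AddCommGrpCat.{w}}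

lemma ActPresheaf.IsTorsor.exists_isTorsorClass {P : ActPresheaf F.obj} (hP : P.IsTorsor L) :
    ∃ c : Sheaf.H.{w₂} F 1, IsTorsorClass F P c := by
  obtain ⟨I, Q, i, q, w, _, hS⟩ := exists_injective_shortExact F
  have : Injective (ShortComplex.mk i q w).X₂ := ‹Injective I›
  obtain ⟨x, ⟨f⟩⟩ := SqZero.exists_preimageMap (S := ShortComplex.mk i q w) hP
  exact ⟨_, f.isTorsorClass hS⟩

/-- Both classes are computed in one injective sequence. There the two sections of the quotient
differ by the image of a section of `I`, and the connecting map kills such an image. -/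
lemma IsTorsorClass.unique {P : ActPresheaf F.obj} (hP : P.IsTorsor L) {c c' : Sheaf.H.{w₂} F 1}
    (h : IsTorsorClass F P c) (h' : IsTorsorClass F P c') : c = c' := by
  obtain ⟨I, Q, i, q, w, _, hS⟩ := exists_injective_shortExact F
  have : Injective (ShortComplex.mk i q w).X₂ := ‹Injective I›
  obtain ⟨x, ⟨f⟩, rfl⟩ := h.exists_preimageMap hS
  obtain ⟨x', ⟨f'⟩, rfl⟩ := h'.exists_preimageMap hS
  obtain ⟨e, rfl⟩ := f.exists_eq_add hP f'
  rw [Abelian.Ext.mk₀_add, Abelian.Ext.add_comp, ← Abelian.Ext.mk₀_comp_mk₀,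
    Abelian.Ext.comp_assoc_of_second_deg_zero, hS.comp_extClass, Abelian.Ext.comp_zero, add_zero]

/-- `Ext¹` into an injective sheaf vanishes, so every class is a connecting image of some section
`x`. The torsor of preimages of `x` realizes it. -/
lemma exists_isTorsor_isTorsorClass (c : Sheaf.H.{w₂} F 1) :
    ∃ P : ActPresheaf F.obj, P.IsTorsor L ∧ IsTorsorClass F P c := by
  obtain ⟨I, Q, i, q, w, _, hS⟩ := exists_injective_shortExact F
  have : Injective (ShortComplex.mk i q w).X₂ := ‹Injective I›
  obtain ⟨x, hx⟩ := Abelian.Ext.covariant_sequence_exact₁ _ hS c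
    (Abelian.Ext.eq_zero_of_injective _) (zero_add 1)
  obtain ⟨x, rfl⟩ := (Abelian.Ext.mk₀_bijective _ _).2 x
  refine ⟨preimageTorsor (ShortComplex.mk i q w) x, preimageTorsor_isTorsor hS x, ?_⟩
  rw [← hx]
  let f : PreimageMap (ShortComplex.mk i q w) (preimageTorsor (ShortComplex.mk i q w) x) x :=
    { app := fun T p => p.1
      app_map := fun T T' k p => rfl
      app_act := fun T g p => rfl
      g_app := fun T p => p.2 }
  exact f.isTorsorClass hS

/-- Torsors with the same cohomology class are isomorphic. -/
lemma IsTorsorClass.exists_hom {P P' : ActPresheaf F.obj} (hP' : P'.IsTorsor L)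
    {c : Sheaf.H.{w₂} F 1} (h : IsTorsorClass F P c) (h' : IsTorsorClass F P' c) :
    ∃ θ : P.psh ⟶ P'.psh, ∀ (T : Dᵒᵖ) (g : F.obj.obj T) (p : P.psh.obj T),
      θ.app T (P.act g p) = P'.act g (θ.app T p) := by
  obtain ⟨I, Q, i, q, w, _, hS⟩ := exists_injective_shortExact F
  have : Injective (ShortComplex.mk i q w).X₂ := ‹Injective I›
  obtain ⟨x, ⟨f⟩, rfl⟩ := h.exists_preimageMap hS
  obtain ⟨x', ⟨f'⟩, hx⟩ := h'.exists_preimageMap hS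
  -- The two sections differ by the image of `e`. Adding `e` moves `P` into the torsor of preimages
  -- of the second section, and `f'` identifies `P'` with that torsor.
  obtain ⟨e, rfl⟩ := exists_eq_add_of_comp_extClass_eq hS hx
  have hb := hP'.bijective (preimageTorsor_isTorsor hS _) f'.toHom f'.toHom_act
  have : IsIso f'.toHom := by
    have (T : Dᵒᵖ) : IsIso (f'.toHom.app T) := (isIso_iff_bijective _).2 (hb T)
    exact NatIso.isIso_of_isIso_app _
  have hinv (T : Dᵒᵖ) (z) : f'.toHom.app T ((inv f'.toHom).app T z) = z :=
    congr(($(IsIso.inv_hom_id f'.toHom)).app T z)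
  refine ⟨(f.add e rfl).toHom ≫ inv f'.toHom, fun T g p => (hb T).1 ?_⟩
  refine (hinv T _).trans (Eq.trans ?_ (f'.toHom_act T g _).symm)
  refine ((f.add e rfl).toHom_act T g p).trans ?_
  exact congrArg _ (hinv T _).symm

end TorsorClass

end SqZero

/-! ### Sheaves on slices and gluing of functions along covers of `A-Alg/B`. -/

namespace SqZero

section OverSheaf

universe u₁ v₁ w₁

variable {C : Type u₁} [Category.{v₁} C] {J : GrothendieckTopology C} {U : C}
  {G : (Over U)ᵒᵖ ⥤ Type w₁} (hG : Presieve.IsSheaf (J.over U) G)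

include hG in
lemma over_ext {V : C} {v : V ⟶ U} {R : Sieve V} (hR : R ∈ J V) {x y : G.obj (op (Over.mk v))}
    (h : ∀ ⦃W : C⦄ (k : W ⟶ V), R k →
      G.map (Over.homMk k rfl : Over.mk (k ≫ v) ⟶ Over.mk v).op x =
        G.map (Over.homMk k rfl : Over.mk (k ≫ v) ⟶ Over.mk v).op y) : x = y := by
  refine (hG.isSeparated _ (J.overEquiv_symm_mem_over (Over.mk v) R hR)).ext fun W k hk => ?_
  let j : W ⟶ Over.mk (k.left ≫ v) := Over.homMk (𝟙 _) ((Category.id_comp _).trans (Over.w k))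
  have e : k = j ≫ (Over.homMk k.left rfl : Over.mk (k.left ≫ v) ⟶ Over.mk v) := by
    ext
    exact (Category.id_comp _).symm
  have := h k.left hk
  rw [e, op_comp, Functor.map_comp_apply, Functor.map_comp_apply, this]

include hG in
-- The gluing axiom of the slice site in terms of covers of the underlying object. The family is
-- indexed by every `w` equal to `k ≫ v`, so its members need no transport between equal objects of
-- the slice.
lemma over_glue {V : C} {v : V ⟶ U} {R : Sieve V} (hR : R ∈ J V)
    (x : ∀ ⦃W : C⦄ (k : W ⟶ V), R k → ∀ w : W ⟶ U, k ≫ v = w → G.obj (op (Over.mk w)))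
    (hx : ∀ ⦃W W' : C⦄ (k : W ⟶ V) (hk : R k) (j : W' ⟶ W) (w : W ⟶ U) (w' : W' ⟶ U)
      (h : k ≫ v = w) (h' : j ≫ w = w'),
      G.map (Over.homMk j h' : Over.mk w' ⟶ Over.mk w).op (x k hk w h) =
        x (j ≫ k) (R.downward_closed hk j) w' (by rw [Category.assoc, h, h'])) :
    ∃ y : G.obj (op (Over.mk v)), ∀ ⦃W : C⦄ (k : W ⟶ V) (hk : R k) (w : W ⟶ U) (h : k ≫ v = w),
      G.map (Over.homMk k h : Over.mk w ⟶ Over.mk v).op y = x k hk w h := by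
  obtain ⟨y, hy, -⟩ := hG _ (J.overEquiv_symm_mem_over (Over.mk v) R hR)
    (fun W k hk => x k.left hk W.hom (Over.w k)) ((Presieve.compatible_iff_sieveCompatible _).2
      fun W W' k j hk => (hx k.left hk j.left W.hom W'.hom (Over.w k) (Over.w j)).symm)
  exact ⟨y, fun W k hk w h => hy (Over.homMk k h : Over.mk w ⟶ Over.mk v) hk⟩

end OverSheaf

variable {E : Type (u + 1)} [Category.{u} E] {K : GrothendieckTopology E}
  {A B : Sheaf K CommRingCat.{u}} {φ : A ⟶ B}

namespace AlgOver

/-- Compatible families of functions on the members of a covering sieve glue. -/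
lemma exists_glue {Y : AlgOver φ} {S : Sieve Y} (hS : S ∈ topology φ Y)
    {G : (Over Y.base)ᵒᵖ ⥤ Type u} (hG : Presieve.IsSheaf (K.over Y.base) G)
    (F : ∀ {Z : AlgOver φ} (f : Z ⟶ Y), S f → ∀ {T : E} (t : T ⟶ Z.base) (s : T ⟶ Y.base),
      t ≫ Hom.bs f = s → Z.sec t → G.obj (op (Over.mk s)))
    (F_res : ∀ {Z : AlgOver φ} (f : Z ⟶ Y) (hf : S f) {T T' : E} (k : T' ⟶ T) (t : T ⟶ Z.base)
      (t' : T' ⟶ Z.base) (s : T ⟶ Y.base) (s' : T' ⟶ Y.base) (h : t ≫ Hom.bs f = s)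
      (ht : k ≫ t = t') (hs : k ≫ s = s') (z : Z.sec t),
      G.map (Over.homMk k hs : Over.mk s' ⟶ Over.mk s).op (F f hf t s h z) =
        F f hf t' s' (by rw [← hs, ← ht, Category.assoc, h]) (Z.toPsh.res k t t' ht z))
    (F_comp : ∀ {Z Z' : AlgOver φ} (f : Z ⟶ Y) (hf : S f) (g : Z' ⟶ Z) {T : E} (t' : T ⟶ Z'.base)
      (t : T ⟶ Z.base) (s : T ⟶ Y.base) (h : t ≫ Hom.bs f = s) (h' : t' ≫ Hom.bs g = t)
      (h'' : t' ≫ Hom.bs (g ≫ f) = s) (z : Z'.sec t'),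
      F (g ≫ f) (S.downward_closed hf g) t' s h'' z = F f hf t s h (Hom.at g t' t h' z)) :
    ∃ Φ : ∀ {T : E} (s : T ⟶ Y.base), Y.sec s → G.obj (op (Over.mk s)),
      (∀ {T T' : E} (k : T' ⟶ T) (s : T ⟶ Y.base) (s' : T' ⟶ Y.base) (hs : k ≫ s = s')
        (y : Y.sec s), G.map (Over.homMk k hs : Over.mk s' ⟶ Over.mk s).op (Φ s y) =
          Φ s' (Y.toPsh.res k s s' hs y)) ∧
      ∀ {Z : AlgOver φ} (f : Z ⟶ Y) (hf : S f) {T : E} (t : T ⟶ Z.base) (s : T ⟶ Y.base)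
        (h : t ≫ Hom.bs f = s) (z : Z.sec t), Φ s (Hom.at f t s h z) = F f hf t s h z := by
  -- The value depends only on the image of the section in `Y`: two sections with the same image
  -- come from one section of a fibre product, and `F_comp` compares the values there.
  have F_eq {Z Z' : AlgOver φ} (f : Z ⟶ Y) (hf : S f) (f' : Z' ⟶ Y) (hf' : S f') {T : E}
      (t : T ⟶ Z.base) (t' : T ⟶ Z'.base) (s : T ⟶ Y.base) (h : t ≫ Hom.bs f = s)
      (h' : t' ≫ Hom.bs f' = s) (z : Z.sec t) (z' : Z'.sec t')
      (e : Hom.at f t s h z = Hom.at f' t' s h' z') : F f hf t s h z = F f' hf' t' s h' z' := by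
    obtain ⟨P, p, q, j, hp, hq, w, H⟩ := exists_fibre_product f f' t t' s h h'
    obtain ⟨x, rfl, rfl⟩ := H z z' e
    have hj : j ≫ Hom.bs (p ≫ f) = s := by
      rw [← h, ← hp]
      exact (Category.assoc _ _ _).symm
    rw [← F_comp f hf p j t s h hp hj x, ← F_comp f' hf' q j t' s h' hq (by rw [← w, hj]) x]
    congr 1
  -- The value at `y` is glued from the values at local lifts of `y`, which the topology provides
  -- for `{y}`. The characterization refers to all lifts over all restrictions, so that it does not
  -- depend on the choices.
  have hex {T : E} (s : T ⟶ Y.base) (y : Y.sec s) : ∃ x : G.obj (op (Over.mk s)),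
      ∀ {W : E} (k : W ⟶ T) (w : W ⟶ Y.base) (hw : k ≫ s = w) {Z : AlgOver φ} (f : Z ⟶ Y)
        (hf : S f) (t : W ⟶ Z.base) (h : t ≫ Hom.bs f = w) (z : Z.sec t),
        Hom.at f t w h z = Y.toPsh.res k s w hw y →
        G.map (Over.homMk k hw : Over.mk w ⟶ Over.mk s).op x = F f hf t w h z := by
    have hR := hS s {y} (Set.finite_singleton y)
    have key {W : E} (k : W ⟶ T) (hk : liftSieve S s {y} k) (w : W ⟶ Y.base) (hw : k ≫ s = w) :
        ∃ (Z : AlgOver φ) (f : Z ⟶ Y) (_ : S f) (t : W ⟶ Z.base) (h : t ≫ Hom.bs f = w)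
          (z : Z.sec t), Hom.at f t w h z = Y.toPsh.res k s w hw y := by
      subst hw
      obtain ⟨Z, f, hf, t, h, H⟩ := hk
      obtain ⟨z, hz⟩ := H y rfl
      exact ⟨Z, f, hf, t, h, z, hz⟩
    choose Z f hf t h z hz using @key
    have hres {W W' : E} (k : W ⟶ T) (w : W ⟶ Y.base) (hw : k ≫ s = w) (j : W' ⟶ W)
        (w' : W' ⟶ Y.base) (hj : j ≫ w = w') {Z : AlgOver φ} (f : Z ⟶ Y) (t : W ⟶ Z.base)
        (h : t ≫ Hom.bs f = w) (z : Z.sec t) (hz : Hom.at f t w h z = Y.toPsh.res k s w hw y) :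
        Hom.at f (j ≫ t) w' (by rw [Category.assoc, h, hj]) (Z.toPsh.res j t (j ≫ t) rfl z) =
          Y.toPsh.res (j ≫ k) s w' (by rw [Category.assoc, hw, hj]) y := by
      refine congr($(Hom.res_at f j t (j ≫ t) w w' rfl h (by rw [Category.assoc, h, hj]) hj)
        z).trans ?_
      exact (congrArg (Y.toPsh.res j w w' hj) hz).trans
        congr($(PshOver.res_res Y.toPsh j k s w w' hw hj) y)
    obtain ⟨x, hx⟩ := over_glue hG hR (fun W k hk w hw => F (f k hk w hw) (hf k hk w hw)
      (t k hk w hw) w (h k hk w hw) (z k hk w hw)) (by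
        intro W W' k hk j w w' hw hw'
        rw [F_res _ _ j _ (j ≫ t k hk w hw) w w' (h k hk w hw) rfl hw']
        apply F_eq
        exact (hres k w hw j w' hw' _ _ _ _ (hz k hk w hw)).trans (hz _ _ _ _).symm)
    refine ⟨x, fun {W} k w hw {Z'} f' hf' t' h' z' hz' => ?_⟩
    refine over_ext hG (K.pullback_stable k hR) fun W' j hj => ?_
    rw [F_res _ _ j _ (j ≫ t') w (j ≫ w) h' rfl rfl]
    refine (Functor.map_comp_apply G _ _ x).symm.trans ?_
    refine (hx (j ≫ k) hj (j ≫ w) (by rw [Category.assoc, hw])).trans ?_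
    apply F_eq
    exact (hz _ _ _ _).trans (hres k w hw j _ rfl _ _ _ _ hz').symm
  choose Φ hΦ using @hex
  refine ⟨Φ, fun {T T'} k s s' hs y => ?_, fun {Z} f hf {T} t s h z => ?_⟩
  · refine over_ext hG (hS s' {Y.toPsh.res k s s' hs y} (Set.finite_singleton _)) ?_
    rintro W j ⟨Z, f, hf, t, h, H⟩
    obtain ⟨z, hz⟩ := H _ rfl
    rw [hΦ s' _ j _ rfl f hf t h z hz]
    refine (Functor.map_comp_apply G _ _ _).symm.trans ?_
    refine hΦ s y (j ≫ k) (j ≫ s') (by rw [Category.assoc, hs]) f hf t h z (hz.trans ?_)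
    exact congr($(PshOver.res_res Y.toPsh j k s s' (j ≫ s') hs rfl) y)
  -- Here `z` is itself a lift of its image, over the identity of `T`.
  · have e := hΦ s (Hom.at f t s h z) (𝟙 T) s (Category.id_comp s) f hf t h z
      congr($(PshOver.res_id Y.toPsh s _) _).symm
    refine Eq.trans ?_ e
    exact congr($(G.map_id _) _).symm

end AlgOver

end SqZero

/-! ### Gluing morphisms of algebras. -/

namespace SqZero

variable {E : Type (u + 1)} [Category.{u} E] {K : GrothendieckTopology E}
  {A B : Sheaf K CommRingCat.{u}} {φ : A ⟶ B}
  {M : PresheafOfModules.{u} (B.obj ⋙ forget₂ CommRingCat.{u} RingCat.{u})}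

namespace AlgOver

/-- Sections over `Y.base` agree if they agree wherever a given finite set of sections lifts to a
covering sieve. -/
lemma ext_of_lift {Y : AlgOver φ} {S : Sieve Y} (hS : S ∈ topology φ Y)
    {G : (Over Y.base)ᵒᵖ ⥤ Type u} (hG : Presieve.IsSheaf (K.over Y.base) G) {T : E}
    {s : T ⟶ Y.base} {Λ : Set (Y.sec s)} (hΛ : Λ.Finite) {x y : G.obj (op (Over.mk s))}
    (H : ∀ {W : E} (k : W ⟶ T) {Z : AlgOver φ} (f : Z ⟶ Y), S f → ∀ (t : W ⟶ Z.base)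
      (h : t ≫ Hom.bs f = k ≫ s),
      (∀ a ∈ Λ, ∃ z, Hom.at f t (k ≫ s) h z = Y.toPsh.res k s (k ≫ s) rfl a) →
      G.map (Over.homMk k rfl : Over.mk (k ≫ s) ⟶ Over.mk s).op x =
        G.map (Over.homMk k rfl : Over.mk (k ≫ s) ⟶ Over.mk s).op y) : x = y := by
  refine over_ext hG (hS s Λ hΛ) ?_
  rintro W k ⟨Z, f, hf, t, h, hz⟩
  exact H k f hf t h hz

/-- A morphism of `AlgOver φ` from natural ring homomorphisms on sections. -/
def homOfAt {X Y : AlgOver φ} (b : X.base ⟶ Y.base)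
    (a : ∀ {T : E} (t : T ⟶ X.base), X.sec t →+* Y.sec (t ≫ b))
    (h₁ : ∀ {S T : E} (k : S ⟶ T) (t : T ⟶ X.base) (s : S ⟶ X.base) (h : k ≫ t = s)
      (x : X.sec t), a s (X.toPsh.res k t s h x) =
        Y.toPsh.res k (t ≫ b) (s ≫ b) (by rw [← h, Category.assoc]) (a t x))
    (h₂ : ∀ {T : E} (t : T ⟶ X.base) (r : A.obj.obj (op T)),
      a t (X.strAt t r) = Y.strAt (t ≫ b) r)
    (h₃ : ∀ {T : E} (t : T ⟶ X.base) (x : X.sec t), Y.toBAt (t ≫ b) (a t x) = X.toBAt t x) :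
    X ⟶ Y :=
  homMk b
    { hom :=
        { app := fun T => CommRingCat.ofHom (a T.unop.hom)
          naturality := fun S T k => CommRingCat.hom_ext (RingHom.ext fun x =>
            h₁ k.unop.left S.unop.hom T.unop.hom (Over.w k.unop) x) } }
    (by
      ext T : 3
      exact CommRingCat.hom_ext (RingHom.ext fun r => h₂ T.unop.hom r))
    (by
      ext T : 3
      exact CommRingCat.hom_ext (RingHom.ext fun x => h₃ T.unop.hom x))

section homOfAt

variable {X Y : AlgOver φ} (b : X.base ⟶ Y.base)
    (a : ∀ {T : E} (t : T ⟶ X.base), X.sec t →+* Y.sec (t ≫ b))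
    (h₁ : ∀ {S T : E} (k : S ⟶ T) (t : T ⟶ X.base) (s : S ⟶ X.base) (h : k ≫ t = s)
      (x : X.sec t), a s (X.toPsh.res k t s h x) =
        Y.toPsh.res k (t ≫ b) (s ≫ b) (by rw [← h, Category.assoc]) (a t x))
    (h₂ : ∀ {T : E} (t : T ⟶ X.base) (r : A.obj.obj (op T)),
      a t (X.strAt t r) = Y.strAt (t ≫ b) r)
    (h₃ : ∀ {T : E} (t : T ⟶ X.base) (x : X.sec t), Y.toBAt (t ≫ b) (a t x) = X.toBAt t x)

lemma homOfAt_at {T : E} (t : T ⟶ X.base) (x : X.sec t) :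
    Hom.at (homOfAt b a h₁ h₂ h₃) t (t ≫ b) rfl x = a t x :=
  congr($(PshOver.Hom.at_eq (X := X.toPsh) (Y := Y.toPsh) (Hom.hom (homOfAt b a h₁ h₂ h₃)) t) x)

end homOfAt

lemma hom_ext_at {X Y : AlgOver φ} {f g : X ⟶ Y} (hb : Hom.bs f = Hom.bs g)
    (h : ∀ ⦃T : E⦄ (t : T ⟶ X.base) (s : T ⟶ Y.base) (h : t ≫ Hom.bs f = s)
      (h' : t ≫ Hom.bs g = s) (x : X.sec t), Hom.at f t s h x = Hom.at g t s h' x) : f = g :=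
  Hom.hext hb fun _ t s h₁ h₂ => CommRingCat.hom_ext (RingHom.ext fun x => h t s h₁ h₂ x)

lemma at_congr_hom {X Y : AlgOver φ} {f g : X ⟶ Y} (e : f = g) {T : E} (t : T ⟶ X.base)
    (s : T ⟶ Y.base) (h : t ≫ Hom.bs f = s) (x : X.sec t) :
    Hom.at f t s h x = Hom.at g t s (e ▸ h) x := by
  subst e
  rfl

lemma at_comp_apply {X Y Z : AlgOver φ} (f : X ⟶ Y) (g : Y ⟶ Z) {T : E} (t : T ⟶ X.base)
    (r : T ⟶ Y.base) (s : T ⟶ Z.base) (h : t ≫ Hom.bs (f ≫ g) = s) (hf : t ≫ Hom.bs f = r)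
    (hg : r ≫ Hom.bs g = s) (x : X.sec t) :
    Hom.at (f ≫ g) t s h x = Hom.at g r s hg (Hom.at f t r hf x) :=
  congr($(Hom.at_comp f g t r s h hf hg) x)

lemma res_at_apply {X Y : AlgOver φ} (f : X ⟶ Y) {S T : E} (k : S ⟶ T) (t : T ⟶ X.base)
    (s : S ⟶ X.base) (t' : T ⟶ Y.base) (s' : S ⟶ Y.base) (h : k ≫ t = s)
    (ht : t ≫ Hom.bs f = t') (hs : s ≫ Hom.bs f = s') (h' : k ≫ t' = s') (x : X.sec t) :
    Hom.at f s s' hs (X.toPsh.res k t s h x) = Y.toPsh.res k t' s' h' (Hom.at f t t' ht x) :=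
  congr($(Hom.res_at f k t s t' s' h ht hs h') x)

lemma res_res_apply (X : AlgOver φ) {R S T : E} (j : R ⟶ S) (k : S ⟶ T) (t : T ⟶ X.base)
    (s : S ⟶ X.base) (r : R ⟶ X.base) (h : k ≫ t = s) (h' : j ≫ s = r) (l : R ⟶ T)
    (hl : j ≫ k = l) (h'' : l ≫ t = r) (x : X.sec t) :
    X.toPsh.res j s r h' (X.toPsh.res k t s h x) = X.toPsh.res l t r h'' x := by
  subst hl
  exact congr($(PshOver.res_res X.toPsh j k t s r h h') x)

lemma forget_isSheaf {C : Type (u + 1)} [Category.{u} C] {J : GrothendieckTopology C}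
    (F : Sheaf J CommRingCat.{u}) : Presieve.IsSheaf J (F.obj ⋙ forget CommRingCat.{u}) := by
  have := CommRingCat.adj.{u}.rightAdjoint_preservesLimits
  exact (isSheaf_iff_isSheaf_of_type _ _).1 (Presheaf.isSheaf_comp_of_isSheaf J _
    (forget CommRingCat.{u}) F.property)

lemma pullRing_isSheaf (X : AlgOver φ) {W : E} (b : W ⟶ X.base) :
    Presieve.IsSheaf (K.over W) ((X.pullRing b).obj ⋙ forget CommRingCat.{u}) :=
  forget_isSheaf _

lemma strAt_res_apply (X : AlgOver φ) {S T : E} (k : S ⟶ T) (t : T ⟶ X.base) (s : S ⟶ X.base)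
    (h : k ≫ t = s) (a : A.obj.obj (op T)) :
    X.toPsh.res k t s h (X.strAt t a) = X.strAt s (A.obj.map k.op a) :=
  congr($(X.strAt_res k t s h) a)

lemma res_toBAt_apply (X : AlgOver φ) {S T : E} (k : S ⟶ T) (t : T ⟶ X.base) (s : S ⟶ X.base)
    (h : k ≫ t = s) (x : X.sec t) :
    X.toBAt s (X.toPsh.res k t s h x) = B.obj.map k.op (X.toBAt t x) :=
  congr($(X.res_toBAt k t s h) x)

lemma at_strAt_apply {X Y : AlgOver φ} (f : X ⟶ Y) {T : E} (t : T ⟶ X.base) (s : T ⟶ Y.base)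
    (h : t ≫ Hom.bs f = s) (a : A.obj.obj (op T)) :
    Hom.at f t s h (X.strAt t a) = Y.strAt s a :=
  congr($(Hom.strAt_at f t s h) a)

lemma at_toBAt_apply {X Y : AlgOver φ} (f : X ⟶ Y) {T : E} (t : T ⟶ X.base) (s : T ⟶ Y.base)
    (h : t ≫ Hom.bs f = s) (x : X.sec t) :
    Y.toBAt s (Hom.at f t s h x) = X.toBAt t x :=
  congr($(Hom.at_toBAt f t s h) x)

lemma hom_ext_of_cover {X Y : AlgOver φ} {S : Sieve Y} (hS : S ∈ topology φ Y) {h h' : Y ⟶ X}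
    (hb : Hom.bs h = Hom.bs h')
    (e : ∀ {Z : AlgOver φ} (f : Z ⟶ Y), S f → f ≫ h = f ≫ h') : h = h' := by
  refine hom_ext_at hb fun T s r hr hr' y => ?_
  subst hr
  refine ext_of_lift hS (X.pullRing_isSheaf (Hom.bs h)) (Set.finite_singleton y) ?_
  intro W k Z f hf t ht hz
  obtain ⟨z, hz⟩ := hz y rfl
  have h₁ : k ≫ s ≫ Hom.bs h = (k ≫ s) ≫ Hom.bs h := (Category.assoc _ _ _).symm
  have h₂ : t ≫ Hom.bs (f ≫ h) = (k ≫ s) ≫ Hom.bs h := by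
    rw [← ht, Category.assoc]
    rfl
  refine (res_at_apply h k s (k ≫ s) (s ≫ Hom.bs h) ((k ≫ s) ≫ Hom.bs h) rfl rfl rfl h₁
    y).symm.trans (Eq.trans ?_ (res_at_apply h' k s (k ≫ s) (s ≫ Hom.bs h)
      ((k ≫ s) ≫ Hom.bs h) rfl hr' (by rw [hb]) h₁ y))
  rw [← hz]
  refine (at_comp_apply f h t _ _ h₂ ht rfl z).symm.trans (Eq.trans ?_
    (at_comp_apply f h' t _ _ (by rw [← e f hf, h₂]) ht (by rw [hb]) z))
  exact at_congr_hom (e f hf) _ _ _ z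

/-- Functions on sections glue by `exists_glue`, and the algebra identities are checked where the
sections involved lift to a member of the sieve. The map `b` of bases is part of the data, because
nothing is assumed here about gluing morphisms of `E`. -/
lemma exists_hom_of_cover {X Y : AlgOver φ} {S : Sieve Y} (hS : S ∈ topology φ Y)
    (b : Y.base ⟶ X.base) (x : ∀ {Z : AlgOver φ} (f : Z ⟶ Y), S f → (Z ⟶ X))
    (hb : ∀ {Z : AlgOver φ} (f : Z ⟶ Y) (hf : S f), Hom.bs (x f hf) = Hom.bs f ≫ b)
    (hx : ∀ {Z Z' : AlgOver φ} (f : Z ⟶ Y) (hf : S f) (g : Z' ⟶ Z),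
      x (g ≫ f) (S.downward_closed hf g) = g ≫ x f hf) :
    ∃ h : Y ⟶ X, Hom.bs h = b ∧ ∀ {Z : AlgOver φ} (f : Z ⟶ Y) (hf : S f), f ≫ h = x f hf := by
  have hb' {Z : AlgOver φ} (f : Z ⟶ Y) (hf : S f) {T : E} (t : T ⟶ Z.base) (s : T ⟶ Y.base)
      (h : t ≫ Hom.bs f = s) : t ≫ Hom.bs (x f hf) = s ≫ b := by
    rw [hb, ← Category.assoc, h]
  have hG := X.pullRing_isSheaf b
  obtain ⟨Φ, hΦ, hΦ₁⟩ : ∃ Φ : ∀ {T : E} (s : T ⟶ Y.base), Y.sec s → X.sec (s ≫ b),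
      (∀ {T T' : E} (k : T' ⟶ T) (s : T ⟶ Y.base) (s' : T' ⟶ Y.base) (hs : k ≫ s = s')
        (y : Y.sec s), (X.toPsh.res k (s ≫ b) (s' ≫ b) (by rw [← hs, Category.assoc])).hom (Φ s y) =
          Φ s' ((Y.toPsh.res k s s' hs).hom y)) ∧
      ∀ {Z : AlgOver φ} (f : Z ⟶ Y) (hf : S f) {T : E} (t : T ⟶ Z.base) (s : T ⟶ Y.base)
        (h : t ≫ Hom.bs f = s) (z : Z.sec t), Φ s ((Hom.at f t s h).hom z) =
          (Hom.at (x f hf) t (s ≫ b) (hb' f hf t s h)).hom z := exists_glue hS hG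
    (fun f hf T t s h z => Hom.at (x f hf) t (s ≫ b) (hb' f hf t s h) z)
    (fun f hf T T' k t t' s s' h ht hs z => (res_at_apply (x f hf) k t t' (s ≫ b) (s' ≫ b) ht
      (hb' f hf t s h) (hb' f hf t' s' (by rw [← hs, ← ht, Category.assoc, h]))
      (by rw [← hs, Category.assoc]) z).symm)
    (fun f hf g T t' t s h h' h'' z => (at_congr_hom (hx f hf g) _ _ _ z).trans
      (at_comp_apply g (x f hf) t' t (s ≫ b) _ h' (hb' f hf t s h) z))
  let r {T T' : E} (k : T' ⟶ T) (s : T ⟶ Y.base) : X.sec (s ≫ b) →+* X.sec ((k ≫ s) ≫ b) :=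
    (X.toPsh.res k (s ≫ b) ((k ≫ s) ≫ b) (Category.assoc _ _ _).symm).hom
  let ρ {T T' : E} (k : T' ⟶ T) (s : T ⟶ Y.base) : Y.sec s →+* Y.sec (k ≫ s) :=
    (Y.toPsh.res k s (k ≫ s) rfl).hom
  have hr {T T' : E} (k : T' ⟶ T) (s : T ⟶ Y.base) (y : Y.sec s) :
      r k s (Φ s y) = Φ (k ≫ s) (ρ k s y) := hΦ k s _ rfl y
  have key {T : E} (s : T ⟶ Y.base) {v w : X.sec (s ≫ b)} (Λ : Set (Y.sec s))
      (hΛ : Λ.Finite) (H : ∀ {W : E} (k : W ⟶ T) {Z : AlgOver φ} (f : Z ⟶ Y), S f →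
        ∀ (t : W ⟶ Z.base) (h : t ≫ Hom.bs f = k ≫ s),
        (∀ a ∈ Λ, ∃ z, Hom.at f t (k ≫ s) h z = ρ k s a) → r k s v = r k s w) : v = w :=
    ext_of_lift hS hG hΛ H
  let a {T : E} (t : T ⟶ Y.base) : Y.sec t →+* X.sec (t ≫ b) :=
    { toFun := Φ t
      -- With no sections to lift, the covering condition for `∅` still supplies local members of
      -- the sieve.
      map_zero' := by
        refine key t ∅ Set.finite_empty fun {W} k {Z} f hf u h _ => ?_
        rw [hr, map_zero, map_zero, ← map_zero (Hom.at f u (k ≫ t) h).hom, hΦ₁ f hf, map_zero]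
      map_one' := by
        refine key t ∅ Set.finite_empty fun {W} k {Z} f hf u h _ => ?_
        rw [hr, map_one, map_one, ← map_one (Hom.at f u (k ≫ t) h).hom, hΦ₁ f hf, map_one]
      -- Both sections must lift to the same member, where the given map is additive. This is where
      -- the topology has to handle sets of more than one section.
      map_add' := fun y y' => by
        refine key t {y, y'} (Set.toFinite _) fun {W} k {Z} f hf u h H => ?_
        obtain ⟨z, hz⟩ := H y (by simp)
        obtain ⟨z', hz'⟩ := H y' (by simp)
        replace hz : (Hom.at f u (k ≫ t) h).hom z = ρ k t y := hz
        replace hz' : (Hom.at f u (k ≫ t) h).hom z' = ρ k t y' := hz'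
        rw [hr, map_add, map_add, hr, hr, ← hz, ← hz', ← map_add, hΦ₁ f hf, hΦ₁ f hf,
          hΦ₁ f hf, map_add]
      map_mul' := fun y y' => by
        refine key t {y, y'} (Set.toFinite _) fun {W} k {Z} f hf u h H => ?_
        obtain ⟨z, hz⟩ := H y (by simp)
        obtain ⟨z', hz'⟩ := H y' (by simp)
        replace hz : (Hom.at f u (k ≫ t) h).hom z = ρ k t y := hz
        replace hz' : (Hom.at f u (k ≫ t) h).hom z' = ρ k t y' := hz'
        rw [hr, map_mul, map_mul, hr, hr, ← hz, ← hz', ← map_mul, hΦ₁ f hf, hΦ₁ f hf,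
          hΦ₁ f hf, map_mul] }
  let Ψ : Y ⟶ X := homOfAt b a
    (fun {T' T} k s s' h y => (hΦ k s s' h y).symm)
    (fun {T} s c => by
      refine key s ∅ Set.finite_empty fun {W} k {Z} f hf u h _ => ?_
      refine (hr k s _).trans ?_
      refine (congrArg (Φ (k ≫ s)) ((strAt_res_apply Y k s _ rfl c).trans
        (at_strAt_apply f u _ h _).symm)).trans ((hΦ₁ f hf u _ h _).trans ?_)
      exact (at_strAt_apply (x f hf) u _ _ _).trans (strAt_res_apply X k _ _ _ c).symm)
    (fun {T} s y => by
      -- Compatibility with the maps to `B` is an equality of sections of `B`, so it is local in the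
      -- sheaf `B`, not in the target algebra.
      refine ext_of_lift (G := (B.over Y.base).obj ⋙ forget CommRingCat.{u}) (s := s) hS
        (forget_isSheaf _) (Set.finite_singleton y) fun {W} k {Z} f hf u h H => ?_
      obtain ⟨z, hz⟩ := H y rfl
      refine (res_toBAt_apply X k (s ≫ b) ((k ≫ s) ≫ b) (Category.assoc _ _ _).symm _).symm.trans
        (Eq.trans ?_ (res_toBAt_apply Y k s (k ≫ s) rfl y))
      refine (congrArg (X.toBAt _) ((hr k s y).trans
        ((congrArg (Φ (k ≫ s)) hz.symm).trans (hΦ₁ f hf u _ h z)))).trans ?_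
      rw [← hz]
      exact (at_toBAt_apply (x f hf) u _ _ z).trans (at_toBAt_apply f u _ h z).symm)
  refine ⟨Ψ, rfl, fun {Z} f hf => hom_ext_at (hb f hf).symm fun T t s h h' z => ?_⟩
  have e : (t ≫ Hom.bs f) ≫ b = s := by
    rw [← h', hb, Category.assoc]
  subst e
  refine (at_comp_apply f Ψ t _ _ h rfl rfl z).trans ((homOfAt_at b a _ _ _ _ _).trans ?_)
  exact hΦ₁ f hf t _ rfl z

end AlgOver

end SqZero

/-! ### Derivations form a sheaf. -/

namespace SqZero

variable {E : Type (u + 1)} [Category.{u} E] {K : GrothendieckTopology E}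
  {A B : Sheaf K CommRingCat.{u}} {φ : A ⟶ B}
  {M : PresheafOfModules.{u} (B.obj ⋙ forget₂ CommRingCat.{u} RingCat.{u})}

namespace AlgOver

/-- The underlying presheaf of sets of `M` on the slice over `U`. -/
noncomputable abbrev overPsh (M : PresheafOfModules.{u} (B.obj ⋙ forget₂ CommRingCat.{u} RingCat.{u})) (U : E) :
    (Over U)ᵒᵖ ⥤ Type u :=
  (Over.forget U).op ⋙ M.presheaf ⋙ forget AddCommGrpCat.{u}

lemma presheaf_forget_isSheaf (hM : Presheaf.IsSheaf K M.presheaf) :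
    Presieve.IsSheaf K (M.presheaf ⋙ forget AddCommGrpCat.{u}) := by
  have := AddCommGrpCat.adj.{u}.rightAdjoint_preservesLimits
  exact (isSheaf_iff_isSheaf_of_type _ _).1 (Presheaf.isSheaf_comp_of_isSheaf K _
    (forget AddCommGrpCat.{u}) hM)

lemma overPsh_isSheaf (hM : Presheaf.IsSheaf K M.presheaf) (U : E) :
    Presieve.IsSheaf (K.over U) (overPsh M U) :=
  (Over.forget U).op_comp_isSheaf_of_types (K.over U) K
    ⟨_, (isSheaf_iff_isSheaf_of_type _ _).2 (presheaf_forget_isSheaf hM)⟩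

lemma map_smul_apply {S T : E} (k : S ⟶ T) (b : B.obj.obj (op T)) (m : M.obj (op T)) :
    (M.map k.op (b • m) : M.obj (op S)) =
      (show B.obj.obj (op S) from B.obj.map k.op b) • (show M.obj (op S) from M.map k.op m) :=
  PresheafOfModules.map_smul M k.op b m

noncomputable def Der.ofAt {X : AlgOver φ}
    (d : ∀ {T : E} (t : T ⟶ X.base), X.sec t → M.obj (op T))
    (d_add : ∀ {T : E} (t : T ⟶ X.base) (x y : X.sec t), d t (x + y) = d t x + d t y)
    (d_mul : ∀ {T : E} (t : T ⟶ X.base) (x y : X.sec t),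
      d t (x * y) = X.toBAt t x • d t y + X.toBAt t y • d t x)
    (d_str : ∀ {T : E} (t : T ⟶ X.base) (a : A.obj.obj (op T)), d t (X.strAt t a) = 0)
    (d_res : ∀ {S T : E} (k : S ⟶ T) (t : T ⟶ X.base) (x : X.sec t),
      d (k ≫ t) (X.toPsh.res k t (k ≫ t) rfl x) = M.map k.op (d t x)) : X.Der M where
  d {T} := AddMonoidHom.mk' (d T.unop.hom) (d_add T.unop.hom)
  d_mul {T} x y := d_mul T.unop.hom x y
  d_map {S T} k x := by
    have h {R : E} (r : R ⟶ X.base) (l : R ⟶ S.unop.left) (h : l ≫ S.unop.hom = r) :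
        d r (X.toPsh.res l _ r h x) = M.map l.op (d S.unop.hom x) := by
      subst h
      exact d_res l _ x
    exact h T.unop.hom k.unop.left (Over.w k.unop)
  d_app {T} a := d_str T.unop.hom a

lemma Der.ext_of_cover (hM : Presheaf.IsSheaf K M.presheaf) {Y : AlgOver φ} {S : Sieve Y}
    (hS : S ∈ topology φ Y) {δ ε : Y.Der M}
    (h : ∀ {Z : AlgOver φ} (f : Z ⟶ Y), S f → Der.comp f δ = Der.comp f ε) : δ = ε := by
  refine Der.hext fun T s y => ?_
  refine ext_of_lift (G := overPsh M Y.base) (s := s) hS (overPsh_isSheaf hM _)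
    (Set.finite_singleton y) fun {W} k {Z} f hf u hu H => ?_
  obtain ⟨z, hz⟩ := H y rfl
  refine (Der.at_res δ k s _ rfl y).symm.trans (Eq.trans ?_ (Der.at_res ε k s _ rfl y))
  rw [← hz, ← Der.comp_at, ← Der.comp_at, h f hf]

/-- The values glue in the sheaf `M`. Additivity and the Leibniz rule are verified on simultaneous
local lifts of two sections, and sections from `A` need no lifting since the structure maps are
preserved. -/
lemma Der.exists_of_cover (hM : Presheaf.IsSheaf K M.presheaf) {Y : AlgOver φ} {S : Sieve Y}
    (hS : S ∈ topology φ Y) (x : ∀ {Z : AlgOver φ} (f : Z ⟶ Y), S f → Z.Der M)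
    (hx : ∀ {Z Z' : AlgOver φ} (f : Z ⟶ Y) (hf : S f) (g : Z' ⟶ Z),
      x (g ≫ f) (S.downward_closed hf g) = Der.comp g (x f hf)) :
    ∃ δ : Y.Der M, ∀ {Z : AlgOver φ} (f : Z ⟶ Y) (hf : S f), Der.comp f δ = x f hf := by
  obtain ⟨Φ, hΦ, hΦ₁⟩ : ∃ Φ : ∀ {T : E} (s : T ⟶ Y.base), Y.sec s → M.obj (op T),
      (∀ {T T' : E} (k : T' ⟶ T) (s : T ⟶ Y.base) (s' : T' ⟶ Y.base) (hs : k ≫ s = s')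
        (y : Y.sec s), M.map k.op (Φ s y) = Φ s' ((Y.toPsh.res k s s' hs).hom y)) ∧
      ∀ {Z : AlgOver φ} (f : Z ⟶ Y) (hf : S f) {T : E} (t : T ⟶ Z.base) (s : T ⟶ Y.base)
        (h : t ≫ Hom.bs f = s) (z : Z.sec t), Φ s ((Hom.at f t s h).hom z) =
          Der.at (x f hf) t z := exists_glue hS (overPsh_isSheaf hM _)
    (fun f hf T t s h z => Der.at (x f hf) t z)
    (fun f hf T T' k t t' s s' h ht hs z => (Der.at_res _ k t t' ht z).symm)
    (fun f hf g T t' t s h h' h'' z => by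
      rw [hx f hf g]
      exact Der.comp_at g _ t' t h' z)
  have key {T : E} (s : T ⟶ Y.base) {v w : M.obj (op T)} (Λ : Set (Y.sec s))
      (hΛ : Λ.Finite) (H : ∀ {W : E} (k : W ⟶ T) {Z : AlgOver φ} (f : Z ⟶ Y), S f →
        ∀ (t : W ⟶ Z.base) (h : t ≫ Hom.bs f = k ≫ s),
        (∀ a ∈ Λ, ∃ z, (Hom.at f t (k ≫ s) h).hom z = (Y.toPsh.res k s _ rfl).hom a) →
        (M.map k.op v : M.obj (op W)) = M.map k.op w) : v = w :=
    ext_of_lift (G := overPsh M Y.base) (s := s) hS (overPsh_isSheaf hM _) hΛ H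
  refine ⟨Der.ofAt Φ (fun {T} s y y' => ?_) (fun {T} s y y' => ?_) (fun {T} s a => ?_)
    (fun {S T} k s y => (hΦ k s _ rfl y).symm), fun {Z} f hf => Der.hext fun T t z =>
      (Der.comp_at f _ t _ rfl z).trans (hΦ₁ f hf t _ rfl z)⟩
  · refine key s {y, y'} (Set.toFinite _) fun {W} k {Z} f hf u h H => ?_
    obtain ⟨z, hz⟩ := H y (by simp)
    obtain ⟨z', hz'⟩ := H y' (by simp)
    refine (hΦ k s _ rfl _).trans (Eq.trans ?_ (map_add (M.map k.op).hom _ _).symm)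
    refine Eq.trans ?_ (congrArg₂ (· + ·) (hΦ k s _ rfl y) (hΦ k s _ rfl y')).symm
    rw [map_add, ← hz, ← hz', ← map_add, hΦ₁ f hf, hΦ₁ f hf, hΦ₁ f hf, map_add]
    rfl
  · refine key s {y, y'} (Set.toFinite _) fun {W} k {Z} f hf u h H => ?_
    obtain ⟨z, hz⟩ := H y (by simp)
    obtain ⟨z', hz'⟩ := H y' (by simp)
    refine (hΦ k s _ rfl _).trans (Eq.trans ?_ (map_add (M.map k.op).hom _ _).symm)
    refine Eq.trans ?_ (congrArg₂ (· + ·) (map_smul_apply k (Y.toBAt s y) (Φ s y'))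
      (map_smul_apply k (Y.toBAt s y') (Φ s y))).symm
    -- A section and its lift act on `M` by the same scalar, because morphisms are over `B`.
    have hB (a : Y.sec s) (c : Z.sec u) (hc : (Hom.at f u (k ≫ s) h).hom c =
        (Y.toPsh.res k s _ rfl).hom a) : B.obj.map k.op (Y.toBAt s a) = Z.toBAt u c :=
      (res_toBAt_apply Y k s _ rfl a).symm.trans ((congrArg (Y.toBAt _) hc.symm).trans
        (at_toBAt_apply f u _ h c))
    rw [hB y z hz, hB y' z' hz']
    refine Eq.trans ?_ (congrArg₂ (fun v w : M.obj (op W) => Z.toBAt u z • v + Z.toBAt u z' • w)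
      (hΦ k s _ rfl y') (hΦ k s _ rfl y)).symm
    rw [map_mul, ← hz, ← hz', ← map_mul, hΦ₁ f hf, hΦ₁ f hf, hΦ₁ f hf, Der.at_mul]
  · refine key s ∅ Set.finite_empty fun {W} k {Z} f hf u h _ => ?_
    refine (hΦ k s _ rfl _).trans (Eq.trans ?_ (map_zero (M.map k.op).hom).symm)
    refine (congrArg (Φ (k ≫ s)) ((strAt_res_apply Y k s _ rfl a).trans
        (at_strAt_apply f u _ h _).symm)).trans ((hΦ₁ f hf u _ h _).trans ?_)
    exact Der.at_strAt _ _ _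

end AlgOver

lemma derPresheaf_isSheaf (hM : Presheaf.IsSheaf K M.presheaf) :
    Presheaf.IsSheaf (AlgOver.topology φ) (derPresheaf φ M) := by
  refine (Presheaf.isSheaf_iff_isSheaf_forget _ _ (forget AddCommGrpCat.{u + 1})).2 ?_
  refine (isSheaf_iff_isSheaf_of_type _ _).2 fun Y S hS x hx => ?_
  rw [Presieve.compatible_iff_sieveCompatible] at hx
  obtain ⟨δ, hδ⟩ := AlgOver.Der.exists_of_cover hM hS (fun {Z} f hf => (x f hf : Z.Der M))
    fun f hf g => hx f g hf
  exact ⟨δ, fun Z f hf => hδ f hf, fun ε hε => AlgOver.Der.ext_of_cover hM hS fun {Z} f hf =>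
    (hε f hf).trans (hδ f hf).symm⟩

end SqZero

/-! ### The torsor represented by an extension. -/

namespace SqZero

variable {E : Type (u + 1)} [Category.{u} E] {K : GrothendieckTopology E}
  {A B : Sheaf K CommRingCat.{u}} {φ : A ⟶ B}
  {M : PresheafOfModules.{u} (B.obj ⋙ forget₂ CommRingCat.{u} RingCat.{u})}

namespace ExalOver

lemma bs_eq_of_toBase {X : ExalOver φ M} {Y : AlgOver φ} {s : Y ⟶ X.total} {t : Y ⟶ X.base}
    (h : s ≫ X.toBase = t) : AlgOver.Hom.bs s = AlgOver.Hom.bs t := by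
  subst h
  exact (Category.comp_id _).symm

lemma toBase_at_apply {X : ExalOver φ M} {Y : AlgOver φ} {s : Y ⟶ X.total} {b : Y ⟶ X.base}
    (h : s ≫ X.toBase = b) {T : E} (t : T ⟶ Y.base) (r : T ⟶ X.total.base)
    (h₁ : t ≫ AlgOver.Hom.bs s = r) (h₂ : t ≫ AlgOver.Hom.bs b = r) (y : Y.sec t) :
    X.ext.proj.hom.app (op (Over.mk r)) (AlgOver.Hom.at s t r h₁ y) = AlgOver.Hom.at b t r h₂ y := by
  subst h
  have h₃ : r ≫ AlgOver.Hom.bs X.toBase = r := Category.comp_id r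
  exact congr($(X.toBase_at r h₃) _).symm.trans
    (AlgOver.at_comp_apply s X.toBase t r r h₂ h₁ h₃ y).symm

lemma inclAt_injective (X : ExalOver φ M) {T : E} (t : T ⟶ X.base.base) :
    Function.Injective (X.inclAt t) :=
  X.ext.incl_injective _

/-- Two lifts of a morphism to an extension differ by a unique derivation. -/
lemma existsUnique_translate {X : ExalOver φ M} {Y : AlgOver φ} (s s' : Y ⟶ X.total)
    (h : s ≫ X.toBase = s' ≫ X.toBase) : ∃! δ : Y.Der M, translate s δ = s' := by
  have hb : AlgOver.Hom.bs s = AlgOver.Hom.bs s' :=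
    (bs_eq_of_toBase h).trans (bs_eq_of_toBase rfl).symm
  have hb' {T : E} (t : T ⟶ Y.base) : t ≫ AlgOver.Hom.bs s' = t ≫ AlgOver.Hom.bs s := by rw [hb]
  -- The difference of the two lifts vanishes in `C`, so it lies in the kernel, which is `M`.
  have hex {T : E} (t : T ⟶ Y.base) (y : Y.sec t) : ∃ m : M.obj (op T),
      AlgOver.Hom.at s' t (t ≫ AlgOver.Hom.bs s) (hb' t) y =
        AlgOver.Hom.at s t (t ≫ AlgOver.Hom.bs s) rfl y + X.inclAt _ m := by
    have e := (toBase_at_apply h t (t ≫ AlgOver.Hom.bs s) rfl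
      (by rw [← bs_eq_of_toBase h]) y).trans
      (toBase_at_apply rfl t (t ≫ AlgOver.Hom.bs s) (hb' t)
      (by rw [← bs_eq_of_toBase h]) y).symm
    obtain ⟨m, hm⟩ := (X.ext.proj_eq_zero_iff (op (Over.mk (t ≫ AlgOver.Hom.bs (Y := X.total) s)))
      (AlgOver.Hom.at s' t (t ≫ AlgOver.Hom.bs s) (hb' t) y -
        AlgOver.Hom.at s t (t ≫ AlgOver.Hom.bs s) rfl y)).1
        ((map_sub (X.ext.proj.hom.app _).hom _ _).trans (sub_eq_zero.2 e.symm))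
    exact ⟨m, by rw [add_comm]; exact (sub_eq_iff_eq_add.1 hm.symm)⟩
  choose d hd using @hex
  have hinj {T : E} (t : T ⟶ Y.base) (y : Y.sec t) (m : M.obj (op T))
      (e : AlgOver.Hom.at s' t (t ≫ AlgOver.Hom.bs s) (hb' t) y =
        AlgOver.Hom.at s t (t ≫ AlgOver.Hom.bs s) rfl y + X.inclAt _ m) : d t y = m :=
    X.inclAt_injective _ (add_left_cancel ((hd t y).symm.trans e))
  let δ : Y.Der M := AlgOver.Der.ofAt d
    (fun {T} t x y => hinj t _ _ (by
      refine (map_add (AlgOver.Hom.at s' t (t ≫ AlgOver.Hom.bs s) (hb' t)).hom x y).trans ?_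
      refine (congrArg₂ (· + ·) (hd t x) (hd t y)).trans ?_
      rw [map_add, map_add]
      exact add_add_add_comm _ _ _ _))
    (fun {T} t x y => hinj t _ _ (by
      have e (c : Y.sec t) : X.total.toBAt _ (AlgOver.Hom.at s t _ rfl c) = Y.toBAt t c :=
        AlgOver.at_toBAt_apply s t _ rfl c
      have e₂ := X.mul_inclAt _ (AlgOver.Hom.at s t _ rfl x) (d t y)
      have e₃ := X.mul_inclAt _ (AlgOver.Hom.at s t _ rfl y) (d t x)
      have e₄ := X.inclAt_mul_inclAt (t ≫ AlgOver.Hom.bs (Y := X.total) s) (d t x) (d t y)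
      rw [e] at e₂ e₃
      refine (map_mul (AlgOver.Hom.at s' t (t ≫ AlgOver.Hom.bs s) (hb' t)).hom x y).trans ?_
      refine (congrArg₂ (· * ·) (hd t x) (hd t y)).trans ?_
      rw [map_add, map_mul, ← e₂, ← e₃]
      -- The product of the two correction terms vanishes because the kernel has square zero; the
      -- remaining cross terms are the Leibniz rule.
      rw [add_mul, mul_add, mul_add, e₄, add_zero, add_assoc]
      exact congrArg (_ + ·) (congrArg (_ + ·) (mul_comm _ _))))
    (fun {T} t a => hinj t _ _ (by
      rw [map_zero, add_zero]
      exact (AlgOver.at_strAt_apply s' t _ _ a).trans (AlgOver.at_strAt_apply s t _ _ a).symm))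
    (fun {S T} k t x => hinj _ _ _ (by
      have h₁ : k ≫ t ≫ AlgOver.Hom.bs s = (k ≫ t) ≫ AlgOver.Hom.bs s :=
        (Category.assoc _ _ _).symm
      refine (AlgOver.res_at_apply s' k t _ (t ≫ AlgOver.Hom.bs s) _ rfl (hb' t) _ h₁ x).trans ?_
      refine (congrArg _ (hd t x)).trans ((map_add (X.total.toPsh.res k _ _ h₁).hom _ _).trans ?_)
      exact congrArg₂ (· + ·) (AlgOver.res_at_apply s k t _ (t ≫ AlgOver.Hom.bs s) _ rfl rfl _
        h₁ x).symm (X.inclAt_res k _ _ h₁ _)))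
  refine ⟨δ, ?_, fun ε hε => ?_⟩
  · refine AlgOver.hom_ext_at hb fun T t r h h' y => ?_
    subst h
    exact (translate_at s δ t _ rfl y).trans (hd t y).symm
  · refine AlgOver.Der.hext fun T t y => (hinj t y _ ?_).symm
    refine Eq.trans ?_ (translate_at s ε t _ rfl y)
    exact (AlgOver.at_congr_hom hε t _ rfl y).symm

/-- Local surjectivity treats one section at a time. Finiteness allows the covers to be intersected.
-/
lemma exists_locally_lift {X : ExalOver φ M} {V : E} (f : V ⟶ X.base.base) (Λ : Set (X.base.sec f))
    (hΛ : Λ.Finite) : ∃ R ∈ K V, ∀ ⦃W : E⦄ (k : W ⟶ V), R k → ∀ a ∈ Λ,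
      ∃ z : X.total.sec (k ≫ f), X.ext.proj.hom.app (op (Over.mk (k ≫ f))) z =
        X.base.toPsh.res k f (k ≫ f) rfl a := by
  induction Λ, hΛ using Set.Finite.induction_on with
  | empty => exact ⟨⊤, K.top_mem V, fun W k _ a ha => ha.elim⟩
  | @insert a Λ _ _ ih =>
    obtain ⟨R, hR, H⟩ := ih
    have h := X.ext.locallySurjective.imageSieve_mem (U := Over.mk f) a
    refine ⟨_, K.intersection_covering hR h, fun W k hk b hb => ?_⟩
    obtain rfl | hb := hb
    · obtain ⟨z, hz⟩ := (Sieve.overEquiv_iff (Y := Over.mk f) _ k).1 hk.2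
      exact ⟨z, hz⟩
    · exact H k hk.1 b hb

/-- The presheaf represented by an extension over its base is a torsor. -/
lemma toActOver_isTorsor (X : ExalOver φ M) :
    X.toActOver.fib.IsTorsor ((AlgOver.topology φ).over X.base) where
  isSheaf := by
    intro T S hS x hx
    rw [Presieve.compatible_iff_sieveCompatible] at hx
    have hS' : Sieve.overEquiv T S ∈ AlgOver.topology φ T.left := hS
    have hk {Z : AlgOver φ} (f : Z ⟶ T.left) (hf : Sieve.overEquiv T S f) :
        S (Over.homMk f rfl : Over.mk (f ≫ T.hom) ⟶ T) := (Sieve.overEquiv_iff S f).1 hf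
    let y {Z : AlgOver φ} (f : Z ⟶ T.left) (hf : Sieve.overEquiv T S f) :
        Over.mk (f ≫ T.hom) ⟶ Over.mk X.toBase := x _ (hk f hf)
    -- `toBase` is the identity on bases, so a section over `T` must have the same base map as
    -- `T.hom`. This supplies the base map required for gluing.
    obtain ⟨h, hb, hh⟩ := AlgOver.exists_hom_of_cover (X := X.total) hS'
      (AlgOver.Hom.bs (Y := X.base) T.hom)
      (fun f hf => (y f hf).left)
      (fun f hf => bs_eq_of_toBase (Over.w (y f hf)))
      (fun {Z Z'} f hf g => by
        have e := hx (Over.homMk f rfl : Over.mk (f ≫ T.hom) ⟶ T)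
          (Over.homMk g (Category.assoc _ _ _).symm :
            Over.mk ((g ≫ f) ≫ T.hom) ⟶ Over.mk (f ≫ T.hom)) (hk f hf)
        exact congrArg (fun q : Over.mk ((g ≫ f) ≫ T.hom) ⟶ Over.mk X.toBase => q.left) e)
    have hw : h ≫ X.toBase = T.hom := by
      refine AlgOver.hom_ext_of_cover hS' ((bs_eq_of_toBase rfl).symm.trans hb) fun {Z} f hf => ?_
      rw [← Category.assoc, hh f hf]
      exact Over.w (y f hf)
    refine ⟨(Over.homMk h hw : T ⟶ Over.mk X.toBase), fun Z f hf => ?_, fun h' hh' => ?_⟩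
    · let i : Over.mk (f.left ≫ T.hom) ⟶ Z :=
        Over.homMk (𝟙 _) ((Category.id_comp _).trans (Over.w f).symm)
      have hi : (Over.homMk f.left rfl : Over.mk (f.left ≫ T.hom) ⟶ T) = i ≫ f :=
        Over.OverMorphism.ext (Category.id_comp _).symm
      have hf' : Sieve.overEquiv T S f.left :=
        (Sieve.overEquiv_iff S f.left).2 (by rw [hi]; exact S.downward_closed hf i)
      have key (g : Over.mk (f.left ≫ T.hom) ⟶ T) (hg : S g) (e : g = i ≫ f) :
          x g hg = X.toActOver.fib.psh.map i.op (x f hf) := by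
        subst e
        exact hx f i hf
      refine Over.OverMorphism.ext ((hh f.left hf').trans ?_)
      refine (congrArg (fun q : Over.mk (f.left ≫ T.hom) ⟶ Over.mk X.toBase => q.left)
        (key _ (hk f.left hf') hi)).trans ?_
      exact Category.id_comp _
    · refine Over.OverMorphism.ext (AlgOver.hom_ext_of_cover hS' ?_ fun {Z} f hf => ?_)
      · exact (bs_eq_of_toBase (Over.w h')).trans hb.symm
      · refine Eq.trans ?_ (hh f hf).symm
        exact congrArg (fun q : Over.mk (f ≫ T.hom) ⟶ Over.mk X.toBase => q.left)
          (hh' (Over.homMk f rfl : Over.mk (f ≫ T.hom) ⟶ T) (hk f hf))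
  existsUnique {T} p q := by
    obtain ⟨δ, hδ, hu⟩ := existsUnique_translate (Y := T.unop.left) p.left q.left
      ((Over.w p).trans (Over.w q).symm)
    exact ⟨δ, Over.OverMorphism.ext hδ, fun ε hε => hu ε
      (congrArg (fun z : T.unop ⟶ Over.mk X.toBase => z.left) hε)⟩
  locally_nonempty := ActPresheaf.over_locally_nonempty' fun {Y} t => by
    -- The sieve of all maps along which `t` acquires a lift to the extension.
    let S : Sieve Y :=
      { arrows := fun Y' k => ∃ l : Y' ⟶ X.total, l ≫ X.toBase = k ≫ t
        downward_closed := by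
          rintro Z Z' k ⟨l, hl⟩ j
          exact ⟨j ≫ l, by rw [Category.assoc, hl, Category.assoc]⟩ }
    refine ⟨S, fun V f Λ hΛ => ?_, ?_⟩
    · obtain ⟨R, hR, H⟩ := exists_locally_lift (f ≫ AlgOver.Hom.bs t)
        (AlgOver.Hom.at t f _ rfl '' Λ) (hΛ.image _)
      refine K.superset_covering ?_ hR
      intro W k hk
      have h₁ : k ≫ f ≫ AlgOver.Hom.bs t = (k ≫ f) ≫ AlgOver.Hom.bs t :=
        (Category.assoc _ _ _).symm
      have h₂ : (k ≫ f ≫ AlgOver.Hom.bs t) ≫ AlgOver.Hom.bs (X := X.total) X.toBase =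
        k ≫ f ≫ AlgOver.Hom.bs t := Category.comp_id _
      -- The pullback of the extension to `Y`, over `W`, belongs to the sieve through its projection
      -- to the total algebra. A section of `Y` lifts to it as soon as its image in `C` lifts to the
      -- extension.
      obtain ⟨P, p, q, j, hp, hq, e, he⟩ := AlgOver.exists_fibre_product t X.toBase (k ≫ f)
        (k ≫ f ≫ AlgOver.Hom.bs (Y := X.base) t) _ h₁.symm h₂
      refine ⟨P, p, ⟨q, e.symm⟩, j, hp, fun a ha => ?_⟩
      obtain ⟨z, hz⟩ := H k hk _ ⟨a, ha, rfl⟩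
      obtain ⟨w, hw, -⟩ := he (Y.toPsh.res k f (k ≫ f) rfl a) z (by
        refine (AlgOver.res_at_apply t k f _ (f ≫ AlgOver.Hom.bs t) _ rfl rfl _ rfl a).trans ?_
        exact hz.symm.trans congr($(X.toBase_at _ h₂) z).symm)
      exact ⟨w, hw⟩
    · rintro T' k ⟨l, hl⟩
      exact ⟨Over.homMk l hl⟩

end ExalOver

end SqZero

/-! ### Full faithfulness of the functor from extensions to torsors. -/

namespace SqZero

variable {E : Type (u + 1)} [Category.{u} E] {K : GrothendieckTopology E}
  {A B : Sheaf K CommRingCat.{u}} {φ : A ⟶ B}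
  {M : PresheafOfModules.{u} (B.obj ⋙ forget₂ CommRingCat.{u} RingCat.{u})}

namespace ExalOver

section

variable {X Y : ExalOver φ M} (ψ : PshOver.Hom X.toActOver.toPsh Y.toActOver.toPsh)

/-- The morphism of total algebras which corresponds to a map of represented presheaves. -/
noncomputable def totalOfHom : X.total ⟶ Y.total :=
  (show Over.mk (X.toBase ≫ ψ.base) ⟶ Over.mk Y.toBase from
    ψ.at X.toBase (X.toBase ≫ ψ.base) rfl (𝟙 (Over.mk X.toBase))).left

lemma totalOfHom_toBase : totalOfHom ψ ≫ Y.toBase = X.toBase ≫ ψ.base :=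
  Over.w (show Over.mk (X.toBase ≫ ψ.base) ⟶ Over.mk Y.toBase from
    ψ.at X.toBase (X.toBase ≫ ψ.base) rfl (𝟙 (Over.mk X.toBase)))

/-- Yoneda: every section is a restriction of the universal one, the identity of the total algebra.
-/
lemma at_left {T : AlgOver φ} (t : T ⟶ X.base) (r : T ⟶ Y.base) (h : t ≫ ψ.base = r)
    (s : Over.mk t ⟶ Over.mk X.toBase) :
    (show Over.mk r ⟶ Over.mk Y.toBase from ψ.at t r h s).left = s.left ≫ totalOfHom ψ := by
  have hw : s.left ≫ X.toBase = t := Over.w s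
  have e := congr($(PshOver.Hom.res_at ψ s.left X.toBase t (X.toBase ≫ ψ.base) r hw rfl h)
    (𝟙 (Over.mk X.toBase)))
  have e' : X.toActOver.toPsh.res s.left X.toBase t hw (𝟙 (Over.mk X.toBase)) = s :=
    Over.OverMorphism.ext (Category.comp_id _)
  refine (congrArg (fun z => (show Over.mk r ⟶ Over.mk Y.toBase from ψ.at t r h z).left)
    e'.symm).trans ?_
  exact congrArg (fun z : Over.mk r ⟶ Over.mk Y.toBase => z.left) e

end

lemma translate_totalOfHom {X Y : ExalOver φ M} (ψ : X.toActOver ⟶ Y.toActOver)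
    {Z : AlgOver φ} (p : Z ⟶ X.total) (δ : Z.Der M) :
    translate p δ ≫ totalOfHom (ActOver.Hom.hom ψ) =
      translate (p ≫ totalOfHom (ActOver.Hom.hom ψ)) δ := by
  let p' : Over.mk (p ≫ X.toBase) ⟶ Over.mk X.toBase := Over.homMk p rfl
  have e := ActOver.Hom.at_act ψ (p ≫ X.toBase) _ rfl δ p'
  have e₁ := at_left (ActOver.Hom.hom ψ) (p ≫ X.toBase) _ rfl p'
  have e₂ := at_left (ActOver.Hom.hom ψ) (p ≫ X.toBase) _ rfl
    (X.toActOver.act (p ≫ X.toBase) δ p')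
  refine e₂.symm.trans ((congrArg (fun z : Over.mk ((p ≫ X.toBase) ≫ (ActOver.Hom.hom ψ).base) ⟶
    Over.mk Y.toBase => z.left) e).trans ?_)
  exact congrArg (translate · δ) e₁

/-- On the fibre product of the extension with itself the projections `p` and `q` differ by a
derivation `δ`. At the pair `z = (0, m)` it takes the value `m`. Equivariance makes the images of
`p` and `q` differ by the same `δ`, and evaluation at `z` gives the claim. -/
lemma totalOfHom_inclAt {X Y : ExalOver φ M} (ψ : X.toActOver ⟶ Y.toActOver) {T : E}
    (t : T ⟶ X.total.base) (s : T ⟶ Y.total.base)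
    (h : t ≫ AlgOver.Hom.bs (totalOfHom (ActOver.Hom.hom ψ)) = s) (m : M.obj (op T)) :
    AlgOver.Hom.at (totalOfHom (ActOver.Hom.hom ψ)) t s h (X.inclAt t m) = Y.inclAt s m := by
  have ht : t ≫ AlgOver.Hom.bs (X := X.total) (Y := X.base) X.toBase = t := Category.comp_id t
  obtain ⟨P, p, q, j, hp, hq, e, H⟩ := AlgOver.exists_fibre_product X.toBase X.toBase t t t ht ht
  obtain ⟨z, hz, hz'⟩ := H 0 (X.inclAt t m) (by
    refine (map_zero (AlgOver.Hom.at X.toBase t t ht).hom).trans ?_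
    exact ((congr($(X.toBase_at t ht) (X.inclAt t m))).trans (X.proj_inclAt t m)).symm)
  obtain ⟨δ, hδ, -⟩ := existsUnique_translate p q e
  have hm : AlgOver.Der.at δ j z = m := by
    refine X.inclAt_injective t (Eq.trans ?_ hz')
    refine Eq.trans ?_ (AlgOver.at_congr_hom hδ j t (hδ ▸ hq) z)
    refine Eq.trans ?_ (translate_at p δ j t hp z).symm
    rw [hz, zero_add]
  have hb := (bs_eq_of_toBase e).trans (bs_eq_of_toBase (s := q) rfl).symm
  have hs : j ≫ AlgOver.Hom.bs (p ≫ totalOfHom (ActOver.Hom.hom ψ)) = s := by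
    rw [← h, ← hp]
    exact (Category.assoc _ _ _).symm
  have hs' : j ≫ AlgOver.Hom.bs (q ≫ totalOfHom (ActOver.Hom.hom ψ)) = s := by
    rw [← h, ← hq]
    exact (Category.assoc _ _ _).symm
  refine (congrArg (AlgOver.Hom.at _ t s h) hz'.symm).trans ?_
  refine (AlgOver.at_comp_apply q (totalOfHom (ActOver.Hom.hom ψ)) j t s hs' hq h z).symm.trans ?_
  have e₁ : q ≫ totalOfHom (ActOver.Hom.hom ψ) =
      translate (p ≫ totalOfHom (ActOver.Hom.hom ψ)) δ := by
    rw [← translate_totalOfHom, hδ]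
  refine (AlgOver.at_congr_hom e₁ j s hs' z).trans ((translate_at _ δ j s hs z).trans ?_)
  rw [hm]
  refine (congrArg (· + _) ?_).trans (zero_add _)
  refine (AlgOver.at_comp_apply p _ j t s hs hp h z).trans ?_
  rw [hz]
  exact map_zero (AlgOver.Hom.at _ t s h).hom

lemma toActOverFunctor_full : (toActOverFunctor φ M).Full where
  map_surjective {X Y} ψ := by
    let f : X ⟶ Y :=
      { base := (ActOver.Hom.hom ψ).base
        total := totalOfHom (ActOver.Hom.hom ψ)
        w := totalOfHom_toBase _
        at_inclAt := fun T t s h m => totalOfHom_inclAt ψ t s h m }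
    refine ⟨f, ActOver.Hom.ext (PshOver.Hom.ext rfl fun T t r h h' => ?_)⟩
    ext s
    exact Over.OverMorphism.ext ((toPshHom_at f t r h s).trans
      (at_left (ActOver.Hom.hom ψ) t r h' s).symm)

/-- The map of total algebras is recovered as the image of the universal section. -/
lemma toActOverFunctor_faithful : (toActOverFunctor φ M).Faithful where
  map_injective {X Y f g} e := by
    have hb : Hom.base f = Hom.base g := congrArg (ActOver.proj (derPresheaf φ M)).map e
    refine Hom.ext hb ?_
    have e₁ := toPshHom_at f X.toBase _ rfl (𝟙 (Over.mk X.toBase))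
    have e₂ := toPshHom_at g X.toBase (X.toBase ≫ Hom.base f) (by rw [hb]) (𝟙 (Over.mk X.toBase))
    refine (Category.id_comp _).symm.trans (e₁.symm.trans (Eq.trans ?_
      (e₂.trans (Category.id_comp _))))
    have e₃ := PshOver.Hom.at_congr (congrArg ActOver.Hom.hom e) X.toBase
      (X.toBase ≫ Hom.base f) rfl
    exact congrArg (fun z : Over.mk (X.toBase ≫ Hom.base f) ⟶ Over.mk Y.toBase => z.left)
      congr($e₃ (𝟙 (Over.mk X.toBase)))

end ExalOver

lemma exalToTorsors_full
    (h : ∀ X : ExalOver φ M, X.toActOver.fib.IsTorsor ((AlgOver.topology φ).over X.base)) :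
    (exalToTorsors h).toFunctor.Full :=
  @Functor.Full.of_comp_faithful_iso _ _ _ _ _ _ _ _ _ ExalOver.toActOverFunctor_full
    (ActOver.isTorsor (AlgOver.topology φ) (derPresheaf φ M)).fullyFaithfulι.faithful
    ((ActOver.isTorsor (AlgOver.topology φ)
      (derPresheaf φ M)).liftCompιIso (ExalOver.toActOverFunctor φ M) h)

lemma exalToTorsors_faithful
    (h : ∀ X : ExalOver φ M, X.toActOver.fib.IsTorsor ((AlgOver.topology φ).over X.base)) :
    (exalToTorsors h).toFunctor.Faithful :=
  @Functor.Faithful.of_comp_iso _ _ _ _ _ _ _ _ _ ExalOver.toActOverFunctor_faithful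
    ((ActOver.isTorsor (AlgOver.topology φ)
      (derPresheaf φ M)).liftCompιIso (ExalOver.toActOverFunctor φ M) h)

end SqZero

/-! ### Ring structures on sheaves of sets, defined by charts. -/

namespace SqZero

section RingAtlas

universe u₁ v₁ w w₁ w₂

set_option linter.checkUnivs false

variable {D : Type u₁} [Category.{v₁} D]

/-- Charts for a sheaf of sets which endow it with a ring structure: any finite set of sections lies
locally in the image of a ring, and coincidence of images is compatible with the ring operations. -/
structure RingAtlas (L : GrothendieckTopology D) (F : Dᵒᵖ ⥤ Type w) where
  Chart : D → Type w₁
  ring : ∀ {T : D}, Chart T → CommRingCat.{w₂}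
  val : ∀ {T : D} (a : Chart T), ring a → F.obj (op T)
  exists_res : ∀ {S T : D} (k : S ⟶ T) (a : Chart T), ∃ (b : Chart S) (f : ring a →+* ring b),
    ∀ r, F.map k.op (val a r) = val b (f r)
  exists_lift : ∀ {T : D} (Λ : Set (F.obj (op T))), Λ.Finite → ∃ R ∈ L T,
    ∀ ⦃S : D⦄ (k : S ⟶ T), R k → ∃ a : Chart S, ∀ x ∈ Λ, ∃ r, val a r = F.map k.op x
  exists_subring : ∀ {T : D} (a b : Chart T), ∃ R : Subring (ring a × ring b),
    ∀ z, z ∈ R ↔ val a z.1 = val b z.2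

namespace RingAtlas

variable {L : GrothendieckTopology D} {F : Dᵒᵖ ⥤ Type w} (𝒜 : RingAtlas.{u₁, v₁, w, w₁, w₂} L F)
  (hF : Presieve.IsSheaf L F)

include hF in
lemma ext_of_lift {T : D} {Λ : Set (F.obj (op T))} (hΛ : Λ.Finite) {x y : F.obj (op T)}
    (h : ∀ {S : D} (k : S ⟶ T) (a : 𝒜.Chart S), (∀ z ∈ Λ, ∃ r, 𝒜.val a r = F.map k.op z) →
      F.map k.op x = F.map k.op y) : x = y := by
  obtain ⟨R, hR, H⟩ := 𝒜.exists_lift Λ hΛ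
  refine (hF.isSeparated R hR).ext fun S k hk => ?_
  obtain ⟨a, ha⟩ := H k hk
  exact h k a ha

lemma map_aeval {ι : Type} {R S : Type*} [CommRing R] [CommRing S] (f : R →+* S) (r : ι → R)
    (p : MvPolynomial ι ℤ) :
    f (MvPolynomial.aeval r p) = MvPolynomial.aeval (fun i => f (r i)) p :=
  MvPolynomial.comp_aeval_apply r f.toIntAlgHom p

/-- The pairs on which two charts coincide form a subring of the product, and a subring is closed
under integral polynomials. -/
lemma val_aeval_congr {ι : Type} {T : D} (a b : 𝒜.Chart T) (r : ι → 𝒜.ring a) (s : ι → 𝒜.ring b)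
    (h : ∀ i, 𝒜.val a (r i) = 𝒜.val b (s i)) (p : MvPolynomial ι ℤ) :
    𝒜.val a (MvPolynomial.aeval r p) = 𝒜.val b (MvPolynomial.aeval s p) := by
  obtain ⟨R, hR⟩ := 𝒜.exists_subring a b
  let z : ι → R := fun i => ⟨(r i, s i), (hR _).2 (h i)⟩
  have := (hR _).1 (MvPolynomial.aeval z p).2
  have h₁ := map_aeval ((RingHom.fst _ _).comp R.subtype) z p
  have h₂ := map_aeval ((RingHom.snd _ _).comp R.subtype) z p
  exact (congrArg (𝒜.val a) h₁).symm.trans (this.trans (congrArg (𝒜.val b) h₂))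

include hF in
-- Evaluate the polynomial in any chart that locally contains all arguments. The results agree
-- between charts by `val_aeval_congr`, so they glue. Using polynomials treats sum, product,
-- negation and integer constants at one stroke.
lemma exists_op {ι : Type} [Finite ι] (p : MvPolynomial ι ℤ) {T : D} (x : ι → F.obj (op T)) :
    ∃ z : F.obj (op T), ∀ {S : D} (k : S ⟶ T) (a : 𝒜.Chart S) (r : ι → 𝒜.ring a),
      (∀ i, 𝒜.val a (r i) = F.map k.op (x i)) →
        𝒜.val a (MvPolynomial.aeval r p) = F.map k.op z := by
  obtain ⟨R, hR, H⟩ := 𝒜.exists_lift (Set.range x) (Set.finite_range x)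
  choose a ha using H
  choose r hr using fun (S : D) (k : S ⟶ T) (hk : R k) (i : ι) => ha k hk _ ⟨i, rfl⟩
  have compat {S₁ S₂ S : D} (k₁ : S₁ ⟶ T) (k₂ : S₂ ⟶ T) (j₁ : S ⟶ S₁) (j₂ : S ⟶ S₂)
      (e : j₁ ≫ k₁ = j₂ ≫ k₂) (a₁ : 𝒜.Chart S₁) (a₂ : 𝒜.Chart S₂) (r₁ : ι → 𝒜.ring a₁)
      (r₂ : ι → 𝒜.ring a₂) (h₁ : ∀ i, 𝒜.val a₁ (r₁ i) = F.map k₁.op (x i))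
      (h₂ : ∀ i, 𝒜.val a₂ (r₂ i) = F.map k₂.op (x i)) :
      F.map j₁.op (𝒜.val a₁ (MvPolynomial.aeval r₁ p)) =
        F.map j₂.op (𝒜.val a₂ (MvPolynomial.aeval r₂ p)) := by
    obtain ⟨b₁, f₁, hf₁⟩ := 𝒜.exists_res j₁ a₁
    obtain ⟨b₂, f₂, hf₂⟩ := 𝒜.exists_res j₂ a₂
    rw [hf₁, hf₂, map_aeval, map_aeval]
    refine 𝒜.val_aeval_congr _ _ _ _ (fun i => ?_) p
    rw [← hf₁, ← hf₂, h₁, h₂, ← Functor.map_comp_apply, ← Functor.map_comp_apply, ← op_comp,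
      ← op_comp, e]
  obtain ⟨z, hz, -⟩ := hF R hR (fun S k hk => 𝒜.val (a k hk) (MvPolynomial.aeval (r S k hk) p))
    fun S₁ S₂ S j₁ j₂ k₁ k₂ h₁ h₂ e => compat k₁ k₂ j₁ j₂ e _ _ _ _ (hr _ k₁ h₁) (hr _ k₂ h₂)
  refine ⟨z, fun {S} k b s hs => ?_⟩
  refine (hF.isSeparated _ (L.pullback_stable k hR)).ext fun S' j hj => ?_
  rw [← Functor.map_comp_apply, ← op_comp, hz _ hj]
  refine (compat k (j ≫ k) j (𝟙 S') (Category.id_comp _).symm b _ s _ hs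
    (hr _ (j ≫ k) hj)).trans ?_
  exact congr($(F.map_id _) _)

/-- The operation which a polynomial defines on the sections. -/
noncomputable def polyOp {ι : Type} [Finite ι] (p : MvPolynomial ι ℤ) {T : D}
    (x : ι → F.obj (op T)) : F.obj (op T) :=
  (𝒜.exists_op hF p x).choose

lemma val_polyOp {ι : Type} [Finite ι] (p : MvPolynomial ι ℤ) {T : D} (x : ι → F.obj (op T))
    {S : D} (k : S ⟶ T) (a : 𝒜.Chart S) (r : ι → 𝒜.ring a)
    (h : ∀ i, 𝒜.val a (r i) = F.map k.op (x i)) :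
    𝒜.val a (MvPolynomial.aeval r p) = F.map k.op (𝒜.polyOp hF p x) :=
  (𝒜.exists_op hF p x).choose_spec k a r h

noncomputable def add {T : D} (x y : F.obj (op T)) : F.obj (op T) :=
  𝒜.polyOp hF (.X 0 + .X 1) ![x, y]

noncomputable def mul {T : D} (x y : F.obj (op T)) : F.obj (op T) :=
  𝒜.polyOp hF (.X 0 * .X 1) ![x, y]

noncomputable def neg {T : D} (x : F.obj (op T)) : F.obj (op T) :=
  𝒜.polyOp hF (-.X 0) ![x]

noncomputable def const (n : ℤ) (T : D) : F.obj (op T) :=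
  𝒜.polyOp hF (.C n) ![]

variable {𝒜 hF}
variable {T S : D} {k : S ⟶ T} {a : 𝒜.Chart S} {x y : F.obj (op T)} {r s : 𝒜.ring a}

lemma val_add (hr : 𝒜.val a r = F.map k.op x) (hs : 𝒜.val a s = F.map k.op y) :
    𝒜.val a (r + s) = F.map k.op (𝒜.add hF x y) := by
  simpa [add] using 𝒜.val_polyOp hF (.X 0 + .X 1) ![x, y] k a ![r, s]
    (Fin.forall_fin_two.2 ⟨hr, hs⟩)

lemma val_mul (hr : 𝒜.val a r = F.map k.op x) (hs : 𝒜.val a s = F.map k.op y) :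
    𝒜.val a (r * s) = F.map k.op (𝒜.mul hF x y) := by
  simpa [mul] using 𝒜.val_polyOp hF (.X 0 * .X 1) ![x, y] k a ![r, s]
    (Fin.forall_fin_two.2 ⟨hr, hs⟩)

lemma val_neg (hr : 𝒜.val a r = F.map k.op x) : 𝒜.val a (-r) = F.map k.op (𝒜.neg hF x) := by
  simpa [neg] using 𝒜.val_polyOp hF (-.X 0) ![x] k a ![r] (Fin.forall_fin_one.2 hr)

variable (a k) in
lemma val_const (n : ℤ) : 𝒜.val a n = F.map k.op (𝒜.const hF n T) := by
  simpa [const] using 𝒜.val_polyOp hF (.C n) ![] k a ![] (fun i => i.elim0)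

variable (a k) in
lemma val_zero : 𝒜.val a 0 = F.map k.op (𝒜.const hF 0 T) := by
  rw [← Int.cast_zero, val_const k a]

variable (a k) in
lemma val_one : 𝒜.val a 1 = F.map k.op (𝒜.const hF 1 T) := by
  rw [← Int.cast_one, val_const k a]

variable (𝒜 hF) in
/-- The ring structure on sections. -/
@[reducible]
noncomputable def commRing (T : D) : CommRing (F.obj (op T)) :=
  letI : Zero (F.obj (op T)) := ⟨𝒜.const hF 0 T⟩
  letI : Add (F.obj (op T)) := ⟨𝒜.add hF⟩
  letI : Neg (F.obj (op T)) := ⟨𝒜.neg hF⟩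
  { mul := 𝒜.mul hF
    one := 𝒜.const hF 1 T
    nsmul := nsmulRec
    zsmul := zsmulRec
    -- Each ring axiom is inherited from a chart that locally contains all the elements involved;
    -- this again needs simultaneous lifts of finite sets.
    add_assoc := fun x y z => 𝒜.ext_of_lift hF (Set.toFinite {x, y, z}) fun k a H => by
      obtain ⟨r, hr⟩ := H x (by simp)
      obtain ⟨s, hs⟩ := H y (by simp)
      obtain ⟨t, ht⟩ := H z (by simp)
      exact (val_add (val_add hr hs) ht).symm.trans
        ((congrArg _ (add_assoc r s t)).trans (val_add hr (val_add hs ht)))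
    add_comm := fun x y => 𝒜.ext_of_lift hF (Set.toFinite {x, y}) fun k a H => by
      obtain ⟨r, hr⟩ := H x (by simp)
      obtain ⟨s, hs⟩ := H y (by simp)
      exact (val_add hr hs).symm.trans ((congrArg _ (add_comm r s)).trans (val_add hs hr))
    zero_add := fun x => 𝒜.ext_of_lift hF (Set.toFinite {x}) fun k a H => by
      obtain ⟨r, hr⟩ := H x (by simp)
      exact (val_add (val_zero k a) hr).symm.trans ((congrArg _ (zero_add r)).trans hr)
    add_zero := fun x => 𝒜.ext_of_lift hF (Set.toFinite {x}) fun k a H => by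
      obtain ⟨r, hr⟩ := H x (by simp)
      exact (val_add hr (val_zero k a)).symm.trans ((congrArg _ (add_zero r)).trans hr)
    neg_add_cancel := fun x => 𝒜.ext_of_lift hF (Set.toFinite {x}) fun k a H => by
      obtain ⟨r, hr⟩ := H x (by simp)
      exact (val_add (val_neg hr) hr).symm.trans
        ((congrArg _ (neg_add_cancel r)).trans (val_zero k a))
    mul_assoc := fun x y z => 𝒜.ext_of_lift hF (Set.toFinite {x, y, z}) fun k a H => by
      obtain ⟨r, hr⟩ := H x (by simp)
      obtain ⟨s, hs⟩ := H y (by simp)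
      obtain ⟨t, ht⟩ := H z (by simp)
      exact (val_mul (val_mul hr hs) ht).symm.trans
        ((congrArg _ (mul_assoc r s t)).trans (val_mul hr (val_mul hs ht)))
    mul_comm := fun x y => 𝒜.ext_of_lift hF (Set.toFinite {x, y}) fun k a H => by
      obtain ⟨r, hr⟩ := H x (by simp)
      obtain ⟨s, hs⟩ := H y (by simp)
      exact (val_mul hr hs).symm.trans ((congrArg _ (mul_comm r s)).trans (val_mul hs hr))
    one_mul := fun x => 𝒜.ext_of_lift hF (Set.toFinite {x}) fun k a H => by
      obtain ⟨r, hr⟩ := H x (by simp)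
      exact (val_mul (val_one k a) hr).symm.trans ((congrArg _ (one_mul r)).trans hr)
    mul_one := fun x => 𝒜.ext_of_lift hF (Set.toFinite {x}) fun k a H => by
      obtain ⟨r, hr⟩ := H x (by simp)
      exact (val_mul hr (val_one k a)).symm.trans ((congrArg _ (mul_one r)).trans hr)
    zero_mul := fun x => 𝒜.ext_of_lift hF (Set.toFinite {x}) fun k a H => by
      obtain ⟨r, hr⟩ := H x (by simp)
      exact (val_mul (val_zero k a) hr).symm.trans
        ((congrArg _ (zero_mul r)).trans (val_zero k a))
    mul_zero := fun x => 𝒜.ext_of_lift hF (Set.toFinite {x}) fun k a H => by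
      obtain ⟨r, hr⟩ := H x (by simp)
      exact (val_mul hr (val_zero k a)).symm.trans
        ((congrArg _ (mul_zero r)).trans (val_zero k a))
    left_distrib := fun x y z => 𝒜.ext_of_lift hF (Set.toFinite {x, y, z}) fun k a H => by
      obtain ⟨r, hr⟩ := H x (by simp)
      obtain ⟨s, hs⟩ := H y (by simp)
      obtain ⟨t, ht⟩ := H z (by simp)
      exact (val_mul hr (val_add hs ht)).symm.trans
        ((congrArg _ (mul_add r s t)).trans (val_add (val_mul hr hs) (val_mul hr ht)))
    right_distrib := fun x y z => 𝒜.ext_of_lift hF (Set.toFinite {x, y, z}) fun k a H => by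
      obtain ⟨r, hr⟩ := H x (by simp)
      obtain ⟨s, hs⟩ := H y (by simp)
      obtain ⟨t, ht⟩ := H z (by simp)
      exact (val_mul (val_add hr hs) ht).symm.trans
        ((congrArg _ (add_mul r s t)).trans (val_add (val_mul hr ht) (val_mul hs ht))) }

variable (𝒜 hF) in
/-- The sections as a presheaf of rings. -/
noncomputable def ringPsh : Dᵒᵖ ⥤ CommRingCat.{w} where
  obj T := @CommRingCat.of (F.obj T) (𝒜.commRing hF T.unop)
  map {T S} j :=
    @CommRingCat.ofHom (F.obj T) (F.obj S) (𝒜.commRing hF T.unop) (𝒜.commRing hF S.unop)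
      (letI := 𝒜.commRing hF T.unop
      letI := 𝒜.commRing hF S.unop
      { toFun := F.map j
        map_zero' := 𝒜.ext_of_lift hF Set.finite_empty fun {S'} k a _ => by
          refine Eq.trans (Functor.map_comp_apply F j k.op _).symm (Eq.trans ?_ (val_zero k a))
          exact (val_zero (k ≫ j.unop) a).symm
        map_one' := 𝒜.ext_of_lift hF Set.finite_empty fun {S'} k a _ => by
          refine Eq.trans (Functor.map_comp_apply F j k.op _).symm (Eq.trans ?_ (val_one k a))
          exact (val_one (k ≫ j.unop) a).symm
        map_add' := fun x y =>
          𝒜.ext_of_lift hF (Set.toFinite {F.map j x, F.map j y}) fun {S'} k a H => by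
            obtain ⟨r, hr⟩ := H (F.map j x) (by simp)
            obtain ⟨s, hs⟩ := H (F.map j y) (by simp)
            have e (z : F.obj T) : F.map (k ≫ j.unop).op z = F.map k.op (F.map j z) :=
              Functor.map_comp_apply F j k.op z
            exact ((e _).symm.trans (val_add (hr.trans (e x).symm)
              (hs.trans (e y).symm)).symm).trans (val_add hr hs)
        map_mul' := fun x y =>
          𝒜.ext_of_lift hF (Set.toFinite {F.map j x, F.map j y}) fun {S'} k a H => by
            obtain ⟨r, hr⟩ := H (F.map j x) (by simp)
            obtain ⟨s, hs⟩ := H (F.map j y) (by simp)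
            have e (z : F.obj T) : F.map (k ≫ j.unop).op z = F.map k.op (F.map j z) :=
              Functor.map_comp_apply F j k.op z
            exact ((e _).symm.trans (val_mul (hr.trans (e x).symm)
              (hs.trans (e y).symm)).symm).trans (val_mul hr hs) })
  map_id T := CommRingCat.hom_ext (RingHom.ext fun x => congr($(F.map_id T) x))
  map_comp j k := CommRingCat.hom_ext (RingHom.ext fun x => Functor.map_comp_apply F j k x)

variable (𝒜 hF) in
/-- The map from a chart as a ring homomorphism. -/
noncomputable def valHom {T : D} (a : 𝒜.Chart T) : 𝒜.ring a →+* (𝒜.ringPsh hF).obj (op T) :=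
  have id_map (x : F.obj (op T)) : F.map (𝟙 T).op x = x := congr($(F.map_id _) x)
  { toFun := 𝒜.val a
    map_zero' := (val_zero (hF := hF) (𝟙 T) a).trans (id_map _)
    map_one' := (val_one (hF := hF) (𝟙 T) a).trans (id_map _)
    map_add' := fun _ _ => (val_add (id_map _).symm (id_map _).symm).trans (id_map _)
    map_mul' := fun _ _ => (val_mul (id_map _).symm (id_map _).symm).trans (id_map _) }

end RingAtlas

/-- A matching family of ring maps out of `R` is glued one element at a time, and separatedness
makes the result a ring homomorphism. -/
lemma isSheaf_of_forget {L : GrothendieckTopology D} (G : Dᵒᵖ ⥤ CommRingCat.{w})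
    (hG : Presieve.IsSheaf L (G ⋙ forget CommRingCat.{w})) : Presheaf.IsSheaf L G := by
  intro R T S hS x hx
  have sep {T : D} {S : Sieve T} (hS : S ∈ L T) {a b : G.obj (op T)}
      (h : ∀ {Y : D} (k : Y ⟶ T), S k → G.map k.op a = G.map k.op b) : a = b :=
    (hG.isSeparated S hS).ext fun Y k hk => h k hk
  have hex (r : R) : ∃ y : G.obj (op T), ∀ {Y : D} (k : Y ⟶ T) (hk : S k),
      (G.map k.op).hom y = (show R ⟶ G.obj (op Y) from x k hk).hom r := by
    obtain ⟨y, hy, -⟩ := hG S hS (fun Y k hk => (show R ⟶ G.obj (op Y) from x k hk).hom r)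
      fun Y₁ Y₂ Z g₁ g₂ f₁ f₂ h₁ h₂ e =>
        congrArg (fun h : R ⟶ G.obj (op Z) => h.hom r) (hx g₁ g₂ h₁ h₂ e)
    exact ⟨y, fun k hk => hy k hk⟩
  choose y hy using hex
  let f : R →+* G.obj (op T) :=
    { toFun := y
      map_zero' := sep hS fun k hk => (hy _ k hk).trans (by rw [map_zero]; exact (map_zero (G.map k.op).hom).symm)
      map_one' := sep hS fun k hk => (hy _ k hk).trans (by rw [map_one]; exact (map_one (G.map k.op).hom).symm)
      map_add' := fun r s => sep hS fun k hk => (hy _ k hk).trans (by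
        rw [map_add, ← hy, ← hy]
        exact (map_add (G.map k.op).hom _ _).symm)
      map_mul' := fun r s => sep hS fun k hk => (hy _ k hk).trans (by
        rw [map_mul, ← hy, ← hy]
        exact (map_mul (G.map k.op).hom _ _).symm) }
  refine ⟨CommRingCat.ofHom f, fun Y k hk => CommRingCat.hom_ext (RingHom.ext fun r => hy r k hk),
    fun g hg => CommRingCat.hom_ext (RingHom.ext fun r => sep hS fun {Y} k hk => ?_)⟩
  exact (congrArg (fun h : R ⟶ G.obj (op Y) => h.hom r) (hg k hk)).trans (hy r k hk).symm

/-- This brings the ring built from charts down to the universe in which extensions live. -/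
lemma exists_shrink (G : Dᵒᵖ ⥤ CommRingCat.{w}) [∀ T, Small.{w₂} (G.obj T)] :
    ∃ (H : Dᵒᵖ ⥤ CommRingCat.{w₂}) (e : ∀ T, G.obj T ≃+* H.obj T),
      ∀ ⦃S T : Dᵒᵖ⦄ (k : S ⟶ T) (x : G.obj S), e T (G.map k x) = H.map k (e S x) := by
  refine ⟨{ obj := fun T => CommRingCat.of (Shrink.{w₂} (G.obj T))
            map := fun {S T} k => CommRingCat.ofHom ((Shrink.ringEquiv (G.obj T)).symm.toRingHom.comp
              ((G.map k).hom.comp (Shrink.ringEquiv (G.obj S)).toRingHom))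
            map_id := fun T => ?_
            map_comp := fun j k => ?_ }, fun T => (Shrink.ringEquiv (G.obj T)).symm,
          fun S T k x => ?_⟩
  · ext x
    simp
  · ext x
    simp
  · simp

end RingAtlas

end SqZero

/-! ### Charts of a torsor and the differences between their sections. -/

namespace SqZero

variable {E : Type (u + 1)} [Category.{u} E] {K : GrothendieckTopology E}
  {A B : Sheaf K CommRingCat.{u}} {φ : A ⟶ B}
  {M : PresheafOfModules.{u} (B.obj ⋙ forget₂ CommRingCat.{u} RingCat.{u})}

namespace AlgOver

lemma exists_isEqualizer {D : Type (u + 1)} [Category.{u} D] {L : GrothendieckTopology D}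
    {F H : Sheaf L CommRingCat.{u}} (f g : F ⟶ H) :
    ∃ (R : Sheaf L CommRingCat.{u}) (e : R ⟶ F), e ≫ f = e ≫ g ∧
      (∀ {S : Sheaf L CommRingCat.{u}} (a : S ⟶ F), a ≫ f = a ≫ g → ∃ l : S ⟶ R, l ≫ e = a) ∧
      ∀ (T : Dᵒᵖ) (x : F.obj.obj T), f.hom.app T x = g.hom.app T x →
        ∃ y : R.obj.obj T, e.hom.app T y = x := by
  refine ⟨equalizer f g, equalizer.ι f g, equalizer.condition f g,
    fun a h => ⟨equalizer.lift a h, equalizer.lift_ι a h⟩, fun T x h => ?_⟩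
  let G := sheafToPresheaf L CommRingCat.{u} ⋙ (evaluation _ _).obj T ⋙ forget CommRingCat.{u}
  have hl := isLimitForkMapOfIsLimit G (equalizer.condition f g) (equalizerIsEqualizer f g)
  obtain ⟨y, hy, -⟩ := Types.unique_of_type_equalizer _ _ hl x h
  exact ⟨y, hy⟩

/-- A section on which two maps agree comes from an algebra on which they are equal.
`Chart.Diff.eq_zero` uses this to compare a chart with itself. -/
lemma exists_equalizer {Z Y : AlgOver φ} (f g : Z ⟶ Y) {W : E} (m : W ⟶ Z.base)
    (n : W ⟶ Y.base) (hf : m ≫ Hom.bs f = n) (hg : m ≫ Hom.bs g = n) :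
    ∃ (Q : AlgOver φ) (e : Q ⟶ Z) (j : W ⟶ Q.base) (he : j ≫ Hom.bs e = m), e ≫ f = e ≫ g ∧
      ∀ z : Z.sec m, Hom.at f m n hf z = Hom.at g m n hg z →
        ∃ w : Q.sec j, Hom.at e j m he w = z := by
  obtain ⟨R, c, hc, hl, hs⟩ := exists_isEqualizer (pullMap f m n hf) (pullMap g m n hg)
  obtain ⟨a, ha⟩ := hl (Z.pullStr m) (by rw [pullStr_pullMap, pullStr_pullMap])
  let Q : AlgOver φ := Z.ofMap m R a c ha
  let e : Q ⟶ Z := homMk (X := Q) m c ha rfl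
  have he {T : E} (t : T ⟶ W) : Hom.at e t (t ≫ m) rfl = c.hom.app (op (Over.mk t)) :=
    homMk_at (X := Q) m c _ _ t
  refine ⟨Q, e, 𝟙 W, Category.id_comp m, ?_, fun z hz => ?_⟩
  · refine Hom.hext (hf.trans hg.symm) fun T t s h h' => ?_
    have e₁ : (t ≫ m) ≫ Hom.bs f = s := (Category.assoc _ _ _).trans h
    have e₂ : (t ≫ m) ≫ Hom.bs g = s := (Category.assoc _ _ _).trans h'
    have e₃ : t ≫ n = s := by rw [← hf]; exact h
    subst e₃
    rw [Hom.at_comp e f t (t ≫ m) _ h rfl e₁, Hom.at_comp e g t (t ≫ m) _ h' rfl e₂]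
    exact (congrArg (· ≫ _) (he t)).trans
      (Eq.trans congr(($hc).hom.app (op (Over.mk t))) (congrArg (· ≫ _) (he t)).symm)
  · have em : 𝟙 W ≫ m = m := Category.id_comp m
    have hn : 𝟙 W ≫ n = 𝟙 W ≫ n := rfl
    obtain ⟨w, hw⟩ := hs (op (Over.mk (𝟙 W))) (Z.toPsh.res (𝟙 W) m (𝟙 W ≫ m) rfl z) (by
      refine (res_at_apply f (𝟙 W) m (𝟙 W ≫ m) n (𝟙 W ≫ n) rfl hf
          (by rw [em, hf, Category.id_comp]) rfl z).trans (Eq.trans ?_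
        (res_at_apply g (𝟙 W) m (𝟙 W ≫ m) n (𝟙 W ≫ n) rfl hg
          (by rw [em, hg, Category.id_comp]) rfl z).symm)
      exact congrArg _ hz)
    have key (l : W ⟶ Z.base) (h : 𝟙 W ≫ m = l) (hl : l = m)
        (hw : Hom.at e (𝟙 W) l h w = Z.toPsh.res (𝟙 W) m l h z) :
        Hom.at e (𝟙 W) m em w = z := by
      subst hl
      exact hw.trans congr($(PshOver.res_id Z.toPsh _ _) z)
    exact ⟨w, key _ rfl em (congr($(he (𝟙 W)) w).trans hw)⟩

end AlgOver

namespace ActOver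

variable (P : ActOver (derPresheaf φ M))

lemma res_act {S T : AlgOver φ} (k : S ⟶ T) (t : T ⟶ P.base) (s : S ⟶ P.base) (h : k ≫ t = s)
    (δ : T.Der M) (p : P.toPsh.psh.obj (op (Over.mk t))) :
    P.toPsh.res k t s h (P.act t (show (derPresheaf φ M).obj (op T) from δ) p) =
      P.act s (show (derPresheaf φ M).obj (op S) from AlgOver.Der.comp k δ)
        (P.toPsh.res k t s h p) :=
  P.fib.map_act (Over.homMk k h : Over.mk s ⟶ Over.mk t).op δ p

lemma res_res_apply {R S T : AlgOver φ} (j : R ⟶ S) (k : S ⟶ T) (t : T ⟶ P.base)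
    (s : S ⟶ P.base) (r : R ⟶ P.base) (h : k ≫ t = s) (h' : j ≫ s = r) (l : R ⟶ T)
    (hl : j ≫ k = l) (h'' : l ≫ t = r) (x : P.toPsh.psh.obj (op (Over.mk t))) :
    P.toPsh.res j s r h' (P.toPsh.res k t s h x) = P.toPsh.res l t r h'' x := by
  subst hl
  exact congr($(PshOver.res_res P.toPsh j k t s r h h') x)

/-- A chart over `T`: an algebra `alg` over the base of `P`, with a section `pt` of `P` and a map
from `T`. It parametrizes the sections over `T` of the extension which represents `P`. -/
structure Chart (T : Over P.base.base) where
  alg : AlgOver φ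
  hom : alg ⟶ P.base
  pt : P.toPsh.psh.obj (op (Over.mk hom))
  map : T.left ⟶ alg.base
  w : map ≫ AlgOver.Hom.bs hom = T.hom

namespace Chart

variable {P} {S T : Over P.base.base}

abbrev sec (a : P.Chart T) : CommRingCat.{u} := a.alg.sec a.map

/-- The map from a chart to the sections of the base algebra. -/
def toBase (a : P.Chart T) : a.sec →+* P.base.sec T.hom :=
  (AlgOver.Hom.at a.hom a.map T.hom a.w).hom

def res (k : S ⟶ T) (a : P.Chart T) : P.Chart S where
  alg := a.alg
  hom := a.hom
  pt := a.pt
  map := k.left ≫ a.map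
  w := by rw [Category.assoc, a.w, Over.w]

def resHom (k : S ⟶ T) (a : P.Chart T) : a.sec →+* (a.res k).sec :=
  (a.alg.toPsh.res k.left a.map (k.left ≫ a.map) rfl).hom

/-- The relation `p_a(y) - p_b(y') = m` for sections `y`, `y'` of charts `a`, `b`. -/
def Diff (a b : P.Chart T) (y : a.sec) (y' : b.sec) (m : M.obj (op T.left)) : Prop :=
  ∃ (Z : AlgOver φ) (v : Z ⟶ a.alg) (w : Z ⟶ b.alg) (e : v ≫ a.hom = w ≫ b.hom)
    (j : T.left ⟶ Z.base) (hv : j ≫ AlgOver.Hom.bs v = a.map) (hw : j ≫ AlgOver.Hom.bs w = b.map)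
    (δ : Z.Der M) (z : Z.sec j),
    P.act (v ≫ a.hom) (show (derPresheaf φ M).obj (op Z) from δ)
      (P.toPsh.res w b.hom (v ≫ a.hom) e.symm b.pt) =
      P.toPsh.res v a.hom (v ≫ a.hom) rfl a.pt ∧
    AlgOver.Hom.at v j a.map hv z = y ∧ AlgOver.Hom.at w j b.map hw z = y' ∧
    AlgOver.Der.at δ j z = m

lemma Diff.toBase_eq {a b : P.Chart T} {y : a.sec} {y' : b.sec} {m : M.obj (op T.left)}
    (h : Diff a b y y' m) : a.toBase y = b.toBase y' := by
  obtain ⟨Z, v, w, e, j, hv, hw, δ, z, -, rfl, rfl, -⟩ := h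
  have h₁ : j ≫ AlgOver.Hom.bs (v ≫ a.hom) = T.hom := by
    rw [← a.w, ← hv]
    exact (Category.assoc _ _ _).symm
  refine (AlgOver.at_comp_apply v a.hom j a.map T.hom h₁ hv a.w z).symm.trans (Eq.trans ?_
    (AlgOver.at_comp_apply w b.hom j b.map T.hom (by rw [← e, h₁]) hw b.w z))
  exact AlgOver.at_congr_hom e _ _ _ z

/-- A map of charts which matches the sections of `P` up to a derivation. -/
lemma Diff.of_hom {a b : P.Chart T} (w : a.alg ⟶ b.alg) (e : w ≫ b.hom = a.hom)
    (hw : a.map ≫ AlgOver.Hom.bs w = b.map) (δ : a.alg.Der M)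
    (h : P.act a.hom (show (derPresheaf φ M).obj (op a.alg) from δ)
      (P.toPsh.res w b.hom a.hom e b.pt) = a.pt) (y : a.sec) :
    Diff a b y (AlgOver.Hom.at w a.map b.map hw y) (AlgOver.Der.at δ a.map y) := by
  obtain ⟨aalg, ahom, apt, amap, aw⟩ := a
  have h₁ : 𝟙 aalg ≫ ahom = ahom := Category.id_comp _
  refine ⟨aalg, 𝟙 _, w, h₁.trans e.symm, amap, Category.comp_id _, hw, δ, y, ?_, ?_, rfl, rfl⟩
  -- `𝟙 ≫ ahom` and `ahom` index different sets of sections of `P`; replacing the first by a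
  -- variable allows substitution.
  · have key (r : aalg ⟶ P.base) (hr : 𝟙 aalg ≫ ahom = r) :
        P.act r (show (derPresheaf φ M).obj (op aalg) from δ)
          (P.toPsh.res w b.hom r (by rw [← hr, h₁]; exact e) b.pt) =
        P.toPsh.res (𝟙 aalg) ahom r hr apt := by
      obtain rfl : ahom = r := h₁.symm.trans hr
      exact h.trans congr($(PshOver.res_id P.toPsh ahom hr) apt).symm
    exact key _ rfl
  · exact congr($(PshOver.Hom.id_at_self aalg.toPsh amap _) y)

lemma Diff.refl (a : P.Chart T) (y : a.sec) : Diff a a y y 0 := by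
  have h := Diff.of_hom (a := a) (b := a) (𝟙 _) (Category.id_comp _) (Category.comp_id _) 0
    ((P.fib.zero_act _).trans congr($(PshOver.res_id P.toPsh a.hom _) a.pt)) y
  have e : AlgOver.Hom.at (𝟙 a.alg) a.map a.map (Category.comp_id _) y = y :=
    congr($(PshOver.Hom.id_at_self a.alg.toPsh a.map _) y)
  rw [e] at h
  exact h

lemma Diff.symm {a b : P.Chart T} {y : a.sec} {y' : b.sec} {m : M.obj (op T.left)}
    (h : Diff a b y y' m) : Diff b a y' y (-m) := by
  obtain ⟨Z, v, w, e, j, hv, hw, δ, z, h, rfl, rfl, rfl⟩ := h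
  refine ⟨Z, w, v, e.symm, j, hw, hv, -δ, z, ?_, rfl, rfl, rfl⟩
  have key (r : Z ⟶ P.base) (h₁ : v ≫ a.hom = r) (h₂ : w ≫ b.hom = r)
      (h : P.act r (show (derPresheaf φ M).obj (op Z) from δ) (P.toPsh.res w b.hom r h₂ b.pt) =
        P.toPsh.res v a.hom r h₁ a.pt) :
      P.act r (show (derPresheaf φ M).obj (op Z) from -δ) (P.toPsh.res v a.hom r h₁ a.pt) =
        P.toPsh.res w b.hom r h₂ b.pt := by
    rw [← h]
    refine (P.fib.add_act (T := op (Over.mk r)) (-δ) δ _).symm.trans ?_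
    exact (congrArg (P.fib.act (T := op (Over.mk r)) · _) (neg_add_cancel δ)).trans
      (P.fib.zero_act _)
  have h' (r : Z ⟶ P.base) (h₁ : v ≫ a.hom = r) : P.act r (show (derPresheaf φ M).obj (op Z) from δ)
      (P.toPsh.res w b.hom r (e.symm.trans h₁) b.pt) = P.toPsh.res v a.hom r h₁ a.pt := by
    subst h₁
    exact h
  exact key _ e rfl (h' _ e)

/-- The two witnesses contain sections with the same image in `b`, so both come from the fibre
product over `b`. There the pulled back derivations add. -/
lemma Diff.trans {a b c : P.Chart T} {y : a.sec} {y' : b.sec} {y'' : c.sec}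
    {m n : M.obj (op T.left)} (h : Diff a b y y' m) (h' : Diff b c y' y'' n) :
    Diff a c y y'' (m + n) := by
  obtain ⟨Z, v, w, e, j, hv, hw, δ, z, h, rfl, hz, rfl⟩ := h
  obtain ⟨Z', v', w', e', j', hv', hw', δ', z', h', hz', rfl, rfl⟩ := h'
  obtain ⟨Q, p, q, i, hp, hq, H, HQ⟩ := AlgOver.exists_fibre_product w v' j j' b.map hw hv'
  obtain ⟨x, rfl, rfl⟩ := HQ z z' (hz.trans hz'.symm)
  have h₁ : i ≫ AlgOver.Hom.bs (p ≫ v) = a.map := by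
    rw [← hv, ← hp]
    exact (Category.assoc _ _ _).symm
  have h₂ : i ≫ AlgOver.Hom.bs (q ≫ w') = c.map := by
    rw [← hw', ← hq]
    exact (Category.assoc _ _ _).symm
  have e₁ : (p ≫ v) ≫ a.hom = (q ≫ w') ≫ c.hom := by
    rw [Category.assoc, e, ← Category.assoc, H, Category.assoc, e', Category.assoc]
  refine ⟨Q, p ≫ v, q ≫ w', e₁, i, h₁, h₂, AlgOver.Der.comp p δ + AlgOver.Der.comp q δ', x, ?_,
    AlgOver.at_comp_apply p v i j a.map h₁ hp hv x,
    AlgOver.at_comp_apply q w' i j' c.map h₂ hq hw' x, ?_⟩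
  · have ep : p ≫ v ≫ a.hom = (p ≫ v) ≫ a.hom := (Category.assoc _ _ _).symm
    have eq' : q ≫ v' ≫ b.hom = (p ≫ v) ≫ a.hom := by
      rw [← Category.assoc, ← H, Category.assoc, ← e, ep]
    have k₁ := (P.res_act p _ _ ep δ _).symm.trans ((congrArg (P.toPsh.res p _ _ ep) h).trans
      (P.res_res_apply p v a.hom _ _ rfl ep (p ≫ v) rfl rfl a.pt))
    have k₂ := (P.res_act q _ _ eq' δ' _).symm.trans ((congrArg (P.toPsh.res q _ _ eq') h').trans
      (P.res_res_apply q v' b.hom _ _ rfl eq' (q ≫ v') rfl (by rw [Category.assoc, eq']) b.pt))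
    have k₃ := P.res_res_apply p w b.hom _ _ e.symm ep (q ≫ v') H
      (by rw [Category.assoc, eq']) b.pt
    have k₄ := P.res_res_apply q w' c.hom _ _ e'.symm eq' (q ≫ w') rfl e₁.symm c.pt
    rw [k₃, ← k₂, k₄] at k₁
    exact (P.fib.add_act (T := op (Over.mk _)) _ _ _).trans k₁
  · exact congrArg₂ (· + ·) (AlgOver.Der.comp_at p δ i j hp x)
      (AlgOver.Der.comp_at q δ' i j' hq x)

end Chart

end ActOver

end SqZero

/-! ### Differences are unique and respect the algebra operations. -/

namespace SqZero

variable {E : Type (u + 1)} [Category.{u} E] {K : GrothendieckTopology E}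
  {A B : Sheaf K CommRingCat.{u}} {φ : A ⟶ B}
  {M : PresheafOfModules.{u} (B.obj ⋙ forget₂ CommRingCat.{u} RingCat.{u})}

namespace ActOver

variable {P : ActOver (derPresheaf φ M)}

namespace Chart

variable {S T : Over P.base.base}

def toB (a : P.Chart T) : a.sec →+* B.obj.obj (op T.left) :=
  (a.alg.toBAt a.map).hom

lemma toB_eq (a : P.Chart T) (y : a.sec) : a.toB y = P.base.toBAt T.hom (a.toBase y) :=
  (AlgOver.at_toBAt_apply a.hom a.map T.hom a.w y).symm

def strHom (a : P.Chart T) : A.obj.obj (op T.left) →+* a.sec :=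
  (a.alg.strAt a.map).hom

lemma toBase_strHom (a : P.Chart T) (r : A.obj.obj (op T.left)) :
    a.toBase (a.strHom r) = P.base.strAt T.hom r :=
  AlgOver.at_strAt_apply a.hom a.map T.hom a.w r

lemma toBase_resHom (k : S ⟶ T) (a : P.Chart T) (y : a.sec) :
    (a.res k).toBase (a.resHom k y) =
      P.base.toPsh.res k.left T.hom S.hom (Over.w k) (a.toBase y) :=
  AlgOver.res_at_apply a.hom k.left a.map _ T.hom S.hom rfl a.w (a.res k).w (Over.w k) y

lemma toB_resHom (k : S ⟶ T) (a : P.Chart T) (y : a.sec) :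
    (a.res k).toB (a.resHom k y) = B.obj.map k.left.op (a.toB y) :=
  AlgOver.res_toBAt_apply a.alg k.left a.map _ rfl y

lemma strHom_map (k : S ⟶ T) (a : P.Chart T) (r : A.obj.obj (op T.left)) :
    (a.res k).strHom (A.obj.map k.left.op r) = a.resHom k (a.strHom r) :=
  (AlgOver.strAt_res_apply a.alg k.left a.map _ rfl r).symm

lemma Diff.res (k : S ⟶ T) {a b : P.Chart T} {y : a.sec} {y' : b.sec} {m : M.obj (op T.left)}
    (h : Diff a b y y' m) :
    Diff (a.res k) (b.res k) (a.resHom k y) (b.resHom k y') (M.map k.left.op m) := by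
  obtain ⟨Z, v, w, e, j, hv, hw, δ, z, h, rfl, rfl, rfl⟩ := h
  have hv' : (k.left ≫ j) ≫ AlgOver.Hom.bs v = k.left ≫ a.map := by rw [Category.assoc, hv]
  have hw' : (k.left ≫ j) ≫ AlgOver.Hom.bs w = k.left ≫ b.map := by rw [Category.assoc, hw]
  exact ⟨Z, v, w, e, k.left ≫ j, hv', hw', δ, Z.toPsh.res k.left j _ rfl z, h,
    AlgOver.res_at_apply v k.left j _ a.map _ rfl hv hv' rfl z,
    AlgOver.res_at_apply w k.left j _ b.map _ rfl hw hw' rfl z,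
    AlgOver.Der.at_res δ k.left j _ rfl z⟩

section

variable {L : GrothendieckTopology (AlgOver φ)} (hP : P.fib.IsTorsor (L.over P.base))
include hP

/-- Two maps `v`, `w` to the same chart that agree on `z` are equalized by some algebra through
which `z` lifts. There both pull the point of the chart back to the same point, so the derivation
fixes a point and vanishes. -/
lemma Diff.eq_zero {a : P.Chart T} {y : a.sec} {m : M.obj (op T.left)} (h : Diff a a y y m) :
    m = 0 := by
  obtain ⟨Z, v, w, e, j, hv, hw, δ, z, h, hz, hz', rfl⟩ := h
  obtain ⟨Q, c, i, hi, hc, H⟩ := AlgOver.exists_equalizer v w j a.map hv hw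
  obtain ⟨x, rfl⟩ := H z (hz.trans hz'.symm)
  have e' : c ≫ v ≫ a.hom = (c ≫ v) ≫ a.hom := (Category.assoc _ _ _).symm
  have h₁ := (P.res_act c _ _ e' δ _).symm.trans ((congrArg (P.toPsh.res c _ _ e') h).trans
    (P.res_res_apply c v a.hom _ _ rfl e' (c ≫ v) rfl rfl a.pt))
  rw [P.res_res_apply c w a.hom _ _ e.symm e' (c ≫ v) hc.symm rfl a.pt] at h₁
  obtain ⟨ε, -, hε⟩ := hP.existsUnique (T := op (Over.mk ((c ≫ v) ≫ a.hom)))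
    (P.toPsh.res (c ≫ v) a.hom _ rfl a.pt) (P.toPsh.res (c ≫ v) a.hom _ rfl a.pt)
  have h₂ : AlgOver.Der.comp c δ = 0 := (hε _ h₁).trans (hε 0 (P.fib.zero_act _)).symm
  rw [← AlgOver.Der.comp_at c δ i j hi, h₂]
  rfl

lemma Diff.unique {a b : P.Chart T} {y : a.sec} {y' : b.sec} {m n : M.obj (op T.left)}
    (h : Diff a b y y' m) (h' : Diff a b y y' n) : m = n :=
  eq_of_sub_eq_zero ((sub_eq_add_neg m n).trans (Diff.eq_zero hP (h.trans h'.symm)))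

variable (a b : P.Chart T)

/-- The fibre product of the two charts over the base is a universal witness: one derivation
compares the two points and computes every difference at once. With uniqueness, compatibility of
`Diff` with each operation becomes a rule for this derivation. -/
lemma exists_common : ∃ (Z : AlgOver φ) (v : Z ⟶ a.alg) (w : Z ⟶ b.alg)
    (j : T.left ⟶ Z.base) (hv : j ≫ AlgOver.Hom.bs v = a.map)
    (hw : j ≫ AlgOver.Hom.bs w = b.map) (δ : Z.Der M),
    (∀ z : Z.sec j, Diff a b (AlgOver.Hom.at v j a.map hv z) (AlgOver.Hom.at w j b.map hw z)
      (AlgOver.Der.at δ j z)) ∧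
    ∀ (y : a.sec) (y' : b.sec), a.toBase y = b.toBase y' → ∃ z : Z.sec j,
      AlgOver.Hom.at v j a.map hv z = y ∧ AlgOver.Hom.at w j b.map hw z = y' := by
  obtain ⟨Z, v, w, j, hv, hw, e, H⟩ :=
    AlgOver.exists_fibre_product a.hom b.hom a.map b.map T.hom a.w b.w
  obtain ⟨δ, hδ, -⟩ := hP.existsUnique (T := op (Over.mk (v ≫ a.hom)))
    (P.toPsh.res w b.hom (v ≫ a.hom) e.symm b.pt) (P.toPsh.res v a.hom (v ≫ a.hom) rfl a.pt)
  exact ⟨Z, v, w, j, hv, hw, δ, fun z => ⟨Z, v, w, e, j, hv, hw, δ, z, hδ, rfl, rfl, rfl⟩, H⟩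

variable {a b}

lemma exists_diff {y : a.sec} {y' : b.sec} (h : a.toBase y = b.toBase y') :
    ∃ m, Diff a b y y' m := by
  obtain ⟨Z, v, w, j, hv, hw, δ, H, H'⟩ := exists_common hP a b
  obtain ⟨z, rfl, rfl⟩ := H' y y' h
  exact ⟨_, H z⟩

lemma Diff.add {y t : a.sec} {y' t' : b.sec} {m n : M.obj (op T.left)} (h : Diff a b y y' m)
    (h' : Diff a b t t' n) : Diff a b (y + t) (y' + t') (m + n) := by
  obtain ⟨Z, v, w, j, hv, hw, δ, H, H'⟩ := exists_common hP a b
  obtain ⟨z, rfl, rfl⟩ := H' y y' h.toBase_eq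
  obtain ⟨x, rfl, rfl⟩ := H' t t' h'.toBase_eq
  obtain rfl := h.unique hP (H z)
  obtain rfl := h'.unique hP (H x)
  rw [← map_add, ← map_add, ← map_add]
  exact H _

lemma Diff.mul {y t : a.sec} {y' t' : b.sec} {m n : M.obj (op T.left)} (h : Diff a b y y' m)
    (h' : Diff a b t t' n) : Diff a b (y * t) (y' * t') (a.toB y • n + a.toB t • m) := by
  obtain ⟨Z, v, w, j, hv, hw, δ, H, H'⟩ := exists_common hP a b
  obtain ⟨z, rfl, rfl⟩ := H' y y' h.toBase_eq
  obtain ⟨x, rfl, rfl⟩ := H' t t' h'.toBase_eq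
  obtain rfl := h.unique hP (H z)
  obtain rfl := h'.unique hP (H x)
  have hB (c : Z.sec j) : a.toB (AlgOver.Hom.at v j a.map hv c) = Z.toBAt j c :=
    AlgOver.at_toBAt_apply v j a.map hv c
  rw [← map_mul, ← map_mul, hB, hB, ← AlgOver.Der.at_mul]
  exact H _

lemma Diff.zero : Diff a b 0 0 0 := by
  obtain ⟨Z, v, w, j, hv, hw, δ, H, H'⟩ := exists_common hP a b
  simpa using H 0

lemma Diff.neg {y : a.sec} {y' : b.sec} {m : M.obj (op T.left)} (h : Diff a b y y' m) :
    Diff a b (-y) (-y') (-m) := by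
  obtain ⟨Z, v, w, j, hv, hw, δ, H, H'⟩ := exists_common hP a b
  obtain ⟨z, rfl, rfl⟩ := H' y y' h.toBase_eq
  obtain rfl := h.unique hP (H z)
  rw [← map_neg, ← map_neg, ← map_neg]
  exact H _

variable (a b) in
lemma Diff.strHom (r : A.obj.obj (op T.left)) : Diff a b (a.strHom r) (b.strHom r) 0 := by
  obtain ⟨Z, v, w, j, hv, hw, δ, H, H'⟩ := exists_common hP a b
  have h := H (Z.strAt j r)
  rw [AlgOver.Der.at_strAt, AlgOver.at_strAt_apply, AlgOver.at_strAt_apply] at h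
  exact h

lemma Diff.one : Diff a b 1 1 0 := by
  have h := Diff.strHom hP a b 1
  rwa [map_one, map_one] at h

end

/-- Finitely many sections of the base algebra lift locally to a chart. -/
lemma exists_lift (hP : P.fib.IsTorsor ((AlgOver.topology φ).over P.base)) (T : Over P.base.base)
    (Λ : Set (P.base.sec T.hom)) (hΛ : Λ.Finite) :
    ∃ R ∈ K.over P.base.base T, ∀ ⦃S : Over P.base.base⦄ (k : S ⟶ T), R k →
      ∃ a : P.Chart S, ∀ c ∈ Λ, ∃ y : a.sec, a.toBase y =
        P.base.toPsh.res k.left T.hom S.hom (Over.w k) c := by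
  -- Algebras over which `P` has a point cover the base, and a member of this cover with such a
  -- point is a chart. The covering condition applied to `Λ` gives the lifts.
  obtain ⟨R, hR, hne⟩ := ActPresheaf.over_locally_nonempty hP (𝟙 P.base)
  refine ⟨_, K.overEquiv_symm_mem_over T _ (hR T.hom Λ hΛ), fun S k hk => ?_⟩
  obtain ⟨Y, g, hg, m, w, H⟩ := hk
  obtain ⟨p⟩ := hne g hg g (Category.comp_id g)
  have hm : m ≫ AlgOver.Hom.bs g = S.hom := w.trans (Over.w k)
  refine ⟨⟨Y, g, p, m, hm⟩, fun c hc => ?_⟩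
  obtain ⟨y, hy⟩ := H c hc
  refine ⟨y, ?_⟩
  have key (s : S.left ⟶ P.base.base) (h₁ : m ≫ AlgOver.Hom.bs g = s) (h₂ : k.left ≫ T.hom = s)
      (h : s = S.hom) (e : AlgOver.Hom.at g m s h₁ y = P.base.toPsh.res k.left T.hom s h₂ c) :
      AlgOver.Hom.at g m S.hom hm y = P.base.toPsh.res k.left T.hom S.hom (Over.w k) c := by
    subst h
    exact e
  exact key _ w rfl (Over.w k) hy

end Chart

end ActOver

end SqZero

/-! ### Germs `p_a(y) + n` and their sheafification. -/

namespace SqZero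

variable {E : Type (u + 1)} [Category.{u} E] {K : GrothendieckTopology E}
  {A B : Sheaf K CommRingCat.{u}} {φ : A ⟶ B}
  {M : PresheafOfModules.{u} (B.obj ⋙ forget₂ CommRingCat.{u} RingCat.{u})}

namespace ActOver

variable {P : ActOver (derPresheaf φ M)}

lemma module_map_id {T : E} (m : M.obj (op T)) : (M.map (𝟙 T).op m : M.obj (op T)) = m :=
  congr($(M.presheaf.map_id (op T)) m)

lemma module_map_comp {R S T : E} (j : R ⟶ S) (k : S ⟶ T) (m : M.obj (op T)) :
    (M.map (j ≫ k).op m : M.obj (op R)) =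
      (M.map j.op (show M.obj (op S) from M.map k.op m) : M.obj (op R)) :=
  congr($(M.presheaf.map_comp k.op j.op) m)

namespace Chart

variable {R S T : Over P.base.base}

/-- Restricting a chart along an identity or a composite changes its structural map by a
propositional equality. Recording this as a zero difference avoids comparing sections of different
types. -/
lemma Diff.of_map_eq {alg : AlgOver φ} {hom : alg ⟶ P.base} {pt : P.toPsh.psh.obj (op (Over.mk hom))}
    {m n : T.left ⟶ alg.base} (h : m = n) (hm : m ≫ AlgOver.Hom.bs hom = T.hom)
    (hn : n ≫ AlgOver.Hom.bs hom = T.hom) (y : alg.sec m) (y' : alg.sec n)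
    (hy : alg.toPsh.res (𝟙 _) m n (by rw [Category.id_comp, h]) y = y') :
    Diff (P := P) ⟨alg, hom, pt, m, hm⟩ ⟨alg, hom, pt, n, hn⟩ y y' 0 := by
  subst h
  obtain rfl : y = y' := congr($(PshOver.res_id alg.toPsh m _) y).symm.trans hy
  exact Diff.refl _ _

lemma Diff.res_id (a : P.Chart T) (y : a.sec) :
    Diff (a.res (𝟙 T)) a (a.resHom (𝟙 T) y) y 0 := by
  have h : 𝟙 T.left ≫ a.map = a.map := Category.id_comp _
  refine Diff.of_map_eq h _ a.w _ y ?_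
  refine (AlgOver.res_res_apply a.alg (𝟙 _) (𝟙 _) a.map (𝟙 _ ≫ a.map) a.map rfl _ (𝟙 _) (Category.comp_id _) h
    y).trans ?_
  exact congr($(PshOver.res_id a.alg.toPsh a.map h) y)

lemma Diff.res_comp (j : R ⟶ S) (k : S ⟶ T) (a : P.Chart T) (y : a.sec) :
    Diff (a.res (j ≫ k)) ((a.res k).res j) (a.resHom (j ≫ k) y)
      ((a.res k).resHom j (a.resHom k y)) 0 := by
  have h : (j ≫ k).left ≫ a.map = j.left ≫ k.left ≫ a.map := Category.assoc _ _ _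
  refine Diff.of_map_eq h _ _ _ _ ?_
  refine (AlgOver.res_res_apply a.alg (𝟙 _) _ a.map _ _ rfl _ _ (Category.id_comp _) h
    y).trans (Eq.symm ?_)
  exact AlgOver.res_res_apply a.alg j.left k.left a.map _ _ rfl rfl _ rfl h y

/-- The images in `C` agree because `C` is separated, so some difference `n` exists. It equals `m`
locally, hence globally, because `M` is separated. -/
lemma Diff.of_cover {L : GrothendieckTopology (AlgOver φ)} (hP : P.fib.IsTorsor (L.over P.base))
    (hM : Presheaf.IsSheaf K M.presheaf) {a b : P.Chart T} {y : a.sec} {y' : b.sec}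
    {m : M.obj (op T.left)} {R : Sieve T} (hR : R ∈ K.over P.base.base T)
    (h : ∀ ⦃S : Over P.base.base⦄ (k : S ⟶ T), R k → Diff (a.res k) (b.res k) (a.resHom k y)
      (b.resHom k y') (M.map k.left.op m)) : Diff a b y y' m := by
  have h₀ : a.toBase y = b.toBase y' := by
    refine ((AlgOver.forget_isSheaf P.base.ring).isSeparated R hR).ext fun S k hk => ?_
    exact (a.toBase_resHom k y).symm.trans ((h k hk).toBase_eq.trans (b.toBase_resHom k y'))
  obtain ⟨n, hn⟩ := exists_diff hP h₀
  obtain rfl : n = m := by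
    refine ((AlgOver.overPsh_isSheaf hM P.base.base).isSeparated R hR).ext fun S k hk => ?_
    exact (hn.res k).unique hP (h k hk)
  exact hn

end Chart

variable (P) in
/-- A section `p_a(y) + n` of the extension over `T`, given in a chart. -/
structure Germ (T : Over P.base.base) where
  chart : P.Chart T
  sec : chart.sec
  shift : M.obj (op T.left)

namespace Germ

variable {S T : Over P.base.base}

/-- The equation `p_a(y) + n = p_b(y') + n'`, rewritten as a difference of chart sections. -/
def Rel (g h : P.Germ T) : Prop :=
  Chart.Diff g.chart h.chart g.sec h.sec (h.shift - g.shift)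

lemma rel_equivalence : Equivalence (Rel (P := P) (T := T)) where
  refl g := by
    have h := Chart.Diff.refl g.chart g.sec
    rwa [← sub_self g.shift] at h
  symm {g g'} h := by
    have e := Chart.Diff.symm h
    rwa [neg_sub] at e
  trans {g g' g''} h h' := by
    have e := Chart.Diff.trans h h'
    rwa [add_comm, sub_add_sub_cancel] at e

variable (P T) in
def setoid : Setoid (P.Germ T) := ⟨Rel, rel_equivalence⟩

noncomputable def res (k : S ⟶ T) (g : P.Germ T) : P.Germ S :=
  ⟨g.chart.res k, g.chart.resHom k g.sec, M.map k.left.op g.shift⟩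

lemma Rel.of_diff {g h : P.Germ T} (H : Chart.Diff g.chart h.chart g.sec h.sec 0)
    (e : g.shift = h.shift) : Rel g h := by
  rwa [Rel, e, sub_self]

lemma Rel.res (k : S ⟶ T) {g h : P.Germ T} (H : Rel g h) : Rel (g.res k) (h.res k) := by
  have e := Chart.Diff.res k H
  rwa [show (M.map k.left.op (h.shift - g.shift) : M.obj (op S.left)) = _ from
    map_sub (M.map k.left.op).hom _ _] at e

end Germ

variable (P) in
noncomputable def germPsh : (Over P.base.base)ᵒᵖ ⥤ Type (u + 1) where
  obj T := Quotient (Germ.setoid P T.unop)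
  map {T S} k := ↾ Quotient.map' (Germ.res k.unop) fun _ _ h => h.res k.unop
  map_id T := by
    ext x
    induction x using Quotient.inductionOn with | _ g =>
    refine Quotient.sound' ?_
    exact Germ.Rel.of_diff (Chart.Diff.res_id g.chart g.sec) (module_map_id g.shift)
  map_comp j k := by
    ext x
    induction x using Quotient.inductionOn with | _ g =>
    refine Quotient.sound' ?_
    exact Germ.Rel.of_diff (Chart.Diff.res_comp k.unop j.unop g.chart g.sec)
      (module_map_comp _ _ g.shift)

variable (P) in
/-- The sheaf of sets of the extension which represents `P`. -/
noncomputable def germSheaf : (Over P.base.base)ᵒᵖ ⥤ Type (u + 1) :=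
  sheafify (K.over P.base.base) (germPsh P)

variable (P) in
lemma germSheaf_isSheaf : Presieve.IsSheaf (K.over P.base.base) (germSheaf P) :=
  (isSheaf_iff_isSheaf_of_type _ _).1
    ((presheafToSheaf (K.over P.base.base) (Type (u + 1))).obj (germPsh P)).property

namespace Chart

variable {S T : Over P.base.base}

/-- The section `p_a(y) + n`. -/
noncomputable def val (a : P.Chart T) (y : a.sec) (n : M.obj (op T.left)) :
    (germSheaf P).obj (op T) :=
  (toSheafify (K.over P.base.base) (germPsh P)).app (op T) (Quotient.mk'' ⟨a, y, n⟩)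

lemma map_val (k : S ⟶ T) (a : P.Chart T) (y : a.sec) (n : M.obj (op T.left)) :
    (germSheaf P).map k.op (a.val y n) =
      (a.res k).val (a.resHom k y) (M.map k.left.op n) :=
  congr($((toSheafify (K.over P.base.base) (germPsh P)).naturality k.op) _).symm

lemma exists_val (x : (germSheaf P).obj (op T)) : ∃ R ∈ K.over P.base.base T,
    ∀ ⦃S : Over P.base.base⦄ (k : S ⟶ T), R k → ∃ (a : P.Chart S) (y : a.sec)
      (n : M.obj (op S.left)), a.val y n = (germSheaf P).map k.op x := by
  refine ⟨_, Presheaf.imageSieve_mem (K.over P.base.base)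
    (toSheafify (K.over P.base.base) (germPsh P)) x, ?_⟩
  rintro S k ⟨g, hg⟩
  induction g using Quotient.inductionOn with | _ g =>
  exact ⟨g.chart, g.sec, g.shift, hg⟩

lemma val_eq_of_diff {a b : P.Chart T} {y : a.sec} {y' : b.sec} {n n' : M.obj (op T.left)}
    (h : Diff a b y y' (n' - n)) : a.val y n = b.val y' n' :=
  congrArg ((toSheafify (K.over P.base.base) (germPsh P)).app (op T)) (Quotient.sound' h)

/-- Sheafification only adds identities that hold locally, and `Diff` is already a local condition.
-/
lemma val_eq_iff {L : GrothendieckTopology (AlgOver φ)} (hP : P.fib.IsTorsor (L.over P.base))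
    (hM : Presheaf.IsSheaf K M.presheaf) {a b : P.Chart T} {y : a.sec} {y' : b.sec}
    {n n' : M.obj (op T.left)} : a.val y n = b.val y' n' ↔ Diff a b y y' (n' - n) := by
  refine ⟨fun h => ?_, val_eq_of_diff⟩
  have hR := Presheaf.equalizerSieve_mem (K.over P.base.base)
    (toSheafify (K.over P.base.base) (germPsh P)) _ _ h
  refine Diff.of_cover hP hM hR fun S k hk => ?_
  have e : Germ.Rel (Germ.res k ⟨a, y, n⟩) (Germ.res k ⟨b, y', n'⟩) := Quotient.exact hk
  rw [show (M.map k.left.op (n' - n) : M.obj (op S.left)) = _ from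
    map_sub (M.map k.left.op).hom _ _]
  exact e

end Chart

end ActOver

end SqZero

/-! ### The ring atlas given by the charts of a torsor. -/

namespace SqZero

variable {E : Type (u + 1)} [Category.{u} E] {K : GrothendieckTopology E}
  {A B : Sheaf K CommRingCat.{u}} {φ : A ⟶ B}
  {M : PresheafOfModules.{u} (B.obj ⋙ forget₂ CommRingCat.{u} RingCat.{u})}

namespace ActOver

variable {P : ActOver (derPresheaf φ M)}

namespace Chart

variable {S T : Over P.base.base}

/-- The sections of `M`, as a module over the sections of a chart. -/
def Shift (_ : P.Chart T) : Type u := M.obj (op T.left)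

instance (a : P.Chart T) : AddCommGroup a.Shift :=
  inferInstanceAs (AddCommGroup (M.obj (op T.left)))

noncomputable instance (a : P.Chart T) : Module a.sec a.Shift :=
  letI : Module (B.obj.obj (op T.left)) a.Shift :=
    inferInstanceAs (Module ((B.obj ⋙ forget₂ CommRingCat.{u} RingCat.{u}).obj (op T.left))
      (M.obj (op T.left)))
  Module.compHom a.Shift a.toB

noncomputable instance (a : P.Chart T) : Module (a.sec)ᵐᵒᵖ a.Shift :=
  Module.compHom a.Shift ((RingHom.id a.sec).fromOpposite fun x y => mul_comm x y)

instance (a : P.Chart T) : IsCentralScalar a.sec a.Shift := ⟨fun _ _ => rfl⟩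

/-- The ring of sections `p_a(y) + n`. -/
abbrev Ext (a : P.Chart T) : Type u := TrivSqZeroExt a.sec a.Shift

noncomputable def resExt (k : S ⟶ T) (a : P.Chart T) : a.Ext →+* (a.res k).Ext where
  toFun x := (a.resHom k x.fst, (show M.obj (op S.left) from
    M.map k.left.op (show M.obj (op T.left) from x.snd)))
  map_zero' := TrivSqZeroExt.ext (map_zero (a.resHom k)) (map_zero (M.map k.left.op).hom)
  map_one' := TrivSqZeroExt.ext (map_one (a.resHom k)) (map_zero (M.map k.left.op).hom)
  map_add' x y := TrivSqZeroExt.ext (map_add (a.resHom k) _ _)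
    (map_add (M.map k.left.op).hom _ _)
  map_mul' x y := TrivSqZeroExt.ext (map_mul (a.resHom k) _ _) (by
    refine (map_add (M.map k.left.op).hom _ _).trans ?_
    refine congrArg₂ (fun m n : M.obj (op S.left) => m + n) ?_ ?_
    · refine (AlgOver.map_smul_apply k.left (a.toB x.fst) _).trans ?_
      rw [← toB_resHom]
      rfl
    · refine (AlgOver.map_smul_apply k.left (a.toB y.fst) _).trans ?_
      rw [← toB_resHom]
      rfl)

noncomputable def valExt (a : P.Chart T) (x : a.Ext) : (germSheaf P).obj (op T) :=
  a.val x.fst x.snd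

end Chart

section

variable (hP : P.fib.IsTorsor ((AlgOver.topology φ).over P.base))
  (hM : Presheaf.IsSheaf K M.presheaf)

include hP in
-- Each section lies locally in a chart of its own. A further refinement provides one chart `b` that
-- lifts all their images in `C`, and the differences from `b` are absorbed into the `M` components.
lemma exists_chart_lift {T : Over P.base.base} (Λ : Set ((germSheaf P).obj (op T)))
    (hΛ : Λ.Finite) : ∃ R ∈ K.over P.base.base T, ∀ ⦃S : Over P.base.base⦄ (k : S ⟶ T), R k →
      ∃ a : P.Chart S, ∀ x ∈ Λ, ∃ r : a.Ext, a.valExt r = (germSheaf P).map k.op x := by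
  have h₁ : ∃ R ∈ K.over P.base.base T, ∀ ⦃S : Over P.base.base⦄ (k : S ⟶ T), R k → ∀ x ∈ Λ,
      ∃ (a : P.Chart S) (y : a.sec) (n : M.obj (op S.left)),
        a.val y n = (germSheaf P).map k.op x := by
    induction Λ, hΛ using Set.Finite.induction_on with
    | empty => exact ⟨⊤, (K.over P.base.base).top_mem T, fun S k _ x hx => hx.elim⟩
    | @insert x Λ _ _ ih =>
      obtain ⟨R, hR, H⟩ := ih
      obtain ⟨R', hR', H'⟩ := Chart.exists_val x
      refine ⟨_, (K.over P.base.base).intersection_covering hR hR', fun S k hk z hz => ?_⟩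
      obtain rfl | hz := hz
      · exact H' k hk.2
      · exact H k hk.1 z hz
  obtain ⟨R, hR, H⟩ := h₁
  let R' : Sieve T :=
    { arrows := fun S k => ∃ a : P.Chart S, ∀ x ∈ Λ, ∃ r : a.Ext,
        a.valExt r = (germSheaf P).map k.op x
      downward_closed := by
        rintro S S' k ⟨a, ha⟩ j
        refine ⟨a.res j, fun x hx => ?_⟩
        obtain ⟨r, hr⟩ := ha x hx
        refine ⟨a.resExt j r, (a.map_val j r.fst r.snd).symm.trans ?_⟩
        exact (congrArg ((germSheaf P).map j.op) hr).trans
          (Functor.map_comp_apply (germSheaf P) k.op j.op x).symm }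
  refine ⟨R', (K.over P.base.base).transitive hR R' fun S k hk => ?_, fun S k hk => hk⟩
  choose a y n h using fun x : Λ => H k hk x x.2
  have := hΛ.to_subtype
  obtain ⟨R'', hR'', H''⟩ := Chart.exists_lift hP S (Set.range fun x => (a x).toBase (y x))
    (Set.finite_range _)
  refine (K.over P.base.base).superset_covering (fun S' l hl => ?_) hR''
  obtain ⟨b, hb⟩ := H'' l hl
  refine ⟨b, fun x hx => ?_⟩
  obtain ⟨x, rfl⟩ : ∃ z : Λ, z.1 = x := ⟨⟨x, hx⟩, rfl⟩
  obtain ⟨y', hy'⟩ := hb _ ⟨x, rfl⟩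
  obtain ⟨m, hm⟩ := Chart.exists_diff hP ((Chart.toBase_resHom l (a x) (y x)).trans hy'.symm)
  let n' : M.obj (op S'.left) := M.map l.left.op (n x)
  -- If `p_a(y) - p_b(y') = m`, then `p_a(y) + n' = p_b(y') + (n' + m)`.
  refine ⟨(y', (show M.obj (op S'.left) from n' + m)), ?_⟩
  have e : ((a x).res l).val ((a x).resHom l (y x)) n' = b.val y' (n' + m) :=
    Chart.val_eq_of_diff (by rwa [add_sub_cancel_left])
  refine e.symm.trans (((a x).map_val l (y x) (n x)).symm.trans ?_)
  exact (congrArg ((germSheaf P).map l.op) (h x)).trans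
    (Functor.map_comp_apply (germSheaf P) k.op l.op x).symm

/-- The charts of a torsor as an atlas. -/
noncomputable def atlas : RingAtlas (K.over P.base.base) (germSheaf P) where
  Chart T := P.Chart T
  ring a := CommRingCat.of a.Ext
  val a x := a.valExt x
  exists_res k a := ⟨a.res k, a.resExt k, fun r => a.map_val k r.fst r.snd⟩
  exists_lift Λ hΛ := exists_chart_lift hP Λ hΛ
  exists_subring {T} a b := by
    let snd₁ (z : a.Ext × b.Ext) : M.obj (op T.left) := z.1.snd
    let snd₂ (z : a.Ext × b.Ext) : M.obj (op T.left) := z.2.snd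
    let H (z : a.Ext × b.Ext) : Prop := Chart.Diff a b z.1.fst z.2.fst (snd₂ z - snd₁ z)
    have h₀ : (0 : M.obj (op T.left)) - 0 = 0 := sub_zero 0
    refine ⟨⟨⟨⟨⟨{z | H z}, fun {x y} hx hy => ?_⟩, ?_⟩, fun {x y} hx hy => ?_, ?_⟩,
      fun {x} hx => ?_⟩, fun z => (Chart.val_eq_iff hP hM).symm⟩
    -- Coinciding sections have the same image in `B`, so the two products act on `M` by the same
    -- scalars and `Diff.mul` applies.
    · have hB : a.toB x.1.fst = b.toB x.2.fst := by
        rw [Chart.toB_eq, Chart.toB_eq, Chart.Diff.toBase_eq hx]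
      have hB' : a.toB y.1.fst = b.toB y.2.fst := by
        rw [Chart.toB_eq, Chart.toB_eq, Chart.Diff.toBase_eq hy]
      have h := Chart.Diff.mul hP hx hy
      have e : snd₂ (x * y) - snd₁ (x * y) =
          a.toB x.1.fst • (snd₂ y - snd₁ y) + a.toB y.1.fst • (snd₂ x - snd₁ x) := by
        have e₁ : snd₁ (x * y) = a.toB x.1.fst • snd₁ y + a.toB y.1.fst • snd₁ x := rfl
        have e₂ : snd₂ (x * y) = b.toB x.2.fst • snd₂ y + b.toB y.2.fst • snd₂ x := rfl
        rw [e₁, e₂, hB, hB']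
        refine (add_sub_add_comm _ _ _ _).trans ?_
        exact congrArg₂ (· + ·) (smul_sub (M := B.obj.obj (op T.left)) (b.toB x.2.fst) (snd₂ y) (snd₁ y)).symm
          (smul_sub _ _ _).symm
      change Chart.Diff a b _ _ (snd₂ (x * y) - snd₁ (x * y))
      rw [e]
      exact h
    · exact (congrArg (Chart.Diff a b 1 1) h₀).mpr (Chart.Diff.one hP)
    · have h := Chart.Diff.add hP hx hy
      rw [← add_sub_add_comm] at h
      exact h
    · exact (congrArg (Chart.Diff a b 0 0) h₀).mpr (Chart.Diff.zero hP)
    · have h := Chart.Diff.neg hP hx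
      rw [neg_sub, ← neg_sub_neg] at h
      exact h

end

end ActOver

end SqZero

/-! ### Realizations of a torsor by a sheaf of rings, and the projection to the base algebra. -/

namespace SqZero

variable {E : Type (u + 1)} [Category.{u} E] {K : GrothendieckTopology E}
  {A B : Sheaf K CommRingCat.{u}} {φ : A ⟶ B}
  {M : PresheafOfModules.{u} (B.obj ⋙ forget₂ CommRingCat.{u} RingCat.{u})}

namespace ActOver

universe w

variable {P : ActOver (derPresheaf φ M)}

variable (P) in
/-- A sheaf of rings whose sections are locally the sections `p_a(y) + n` of charts. -/
structure Realization where
  ring : (Over P.base.base)ᵒᵖ ⥤ CommRingCat.{w}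
  isSheaf : Presieve.IsSheaf (K.over P.base.base) (ring ⋙ forget CommRingCat.{w})
  val : ∀ {T : Over P.base.base} (a : P.Chart T), a.Ext →+* ring.obj (op T)
  map_val : ∀ {S T : Over P.base.base} (k : S ⟶ T) (a : P.Chart T) (r : a.Ext),
    ring.map k.op (val a r) = val (a.res k) (a.resExt k r)
  val_eq_iff : ∀ {T : Over P.base.base} {a b : P.Chart T} {r : a.Ext} {s : b.Ext},
    val a r = val b s ↔ Chart.Diff a b r.fst s.fst
      ((show M.obj (op T.left) from s.snd) - (show M.obj (op T.left) from r.snd))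
  exists_lift : ∀ {T : Over P.base.base} (Λ : Set (ring.obj (op T))), Λ.Finite →
    ∃ R ∈ K.over P.base.base T, ∀ ⦃S : Over P.base.base⦄ (k : S ⟶ T), R k →
      ∃ a : P.Chart S, ∀ x ∈ Λ, ∃ r : a.Ext, val a r = ring.map k.op x

/-- The realization whose sections are sheafified germs. -/
noncomputable def germRealization (hP : P.fib.IsTorsor ((AlgOver.topology φ).over P.base))
    (hM : Presheaf.IsSheaf K M.presheaf) : Realization.{u, u + 1} P where
  ring := (atlas hP hM).ringPsh (germSheaf_isSheaf P)
  isSheaf := germSheaf_isSheaf P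
  val {T} a := (atlas hP hM).valHom (T := T) (germSheaf_isSheaf P) a
  map_val k a r := a.map_val k r.fst r.snd
  val_eq_iff := Chart.val_eq_iff hP hM
  exists_lift Λ hΛ := exists_chart_lift hP Λ hΛ

namespace Realization

variable (V : Realization.{u, w} P) {S T : Over P.base.base}

lemma ext_of_cover {R : Sieve T} (hR : R ∈ K.over P.base.base T) {x y : V.ring.obj (op T)}
    (h : ∀ ⦃S⦄ (k : S ⟶ T), R k → V.ring.map k.op x = V.ring.map k.op y) :
    x = y :=
  (V.isSheaf.isSeparated R hR).ext fun _ k hk => h k hk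

lemma ext_of_chart {x y : V.ring.obj (op T)}
    (h : ∀ ⦃S⦄ (k : S ⟶ T), P.Chart S → V.ring.map k.op x = V.ring.map k.op y) :
    x = y := by
  obtain ⟨R, hR, H⟩ := V.exists_lift (T := T) ∅ Set.finite_empty
  exact V.ext_of_cover hR fun S k hk => h k (H k hk).choose

/-- A compatible family of sections of charts defines a section. -/
lemma exists_glue (g : ∀ ⦃S : Over P.base.base⦄ (_ : S ⟶ T) (a : P.Chart S), a.Ext)
    (hres : ∀ ⦃S S' : Over P.base.base⦄ (j : S' ⟶ S) (k : S ⟶ T) (a : P.Chart S),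
      a.resExt j (g k a) = g (j ≫ k) (a.res j))
    (hg : ∀ ⦃S : Over P.base.base⦄ (k : S ⟶ T) (a b : P.Chart S),
      V.val a (g k a) = V.val b (g k b)) :
    ∃ x : V.ring.obj (op T), ∀ ⦃S : Over P.base.base⦄ (k : S ⟶ T) (a : P.Chart S),
      V.ring.map k.op x = V.val a (g k a) := by
  obtain ⟨R, hR, H⟩ := V.exists_lift (T := T) ∅ Set.finite_empty
  choose a _ using H
  obtain ⟨x, hx, -⟩ := V.isSheaf R hR (fun S k hk => V.val (a k hk) (g k (a k hk))) (by
    intro Y₁ Y₂ Z g₁ g₂ f₁ f₂ h₁ h₂ e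
    refine (V.map_val g₁ _ _).trans (Eq.trans ?_ (V.map_val g₂ _ _).symm)
    rw [hres, hres, e]
    exact hg _ _ _)
  refine ⟨x, fun S k b => V.ext_of_cover ((K.over P.base.base).pullback_stable k hR)
    fun S' j hj => ?_⟩
  refine (Functor.map_comp_apply V.ring k.op j.op x).symm.trans ((hx _ hj).trans ?_)
  rw [V.map_val, hres]
  exact hg _ _ _

/-- Sections of charts that coincide have the same image in `C`, so the images of local
representatives of `x` glue in the sheaf `C`. -/
lemma exists_proj (x : V.ring.obj (op T)) : ∃ c : P.base.sec T.hom,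
    ∀ ⦃S : Over P.base.base⦄ (k : S ⟶ T) (a : P.Chart S) (r : a.Ext),
      V.val a r = V.ring.map k.op x →
        a.toBase r.fst = P.base.toPsh.res k.left T.hom S.hom (Over.w k) c := by
  obtain ⟨R, hR, H⟩ := V.exists_lift {x} (Set.finite_singleton x)
  choose a ha using H
  choose r hr using fun (S : Over P.base.base) (k : S ⟶ T) (hk : R k) => ha k hk x rfl
  have hC := AlgOver.forget_isSheaf P.base.ring
  have compat {S₁ S₂ S : Over P.base.base} (k₁ : S₁ ⟶ T) (k₂ : S₂ ⟶ T) (j₁ : S ⟶ S₁)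
      (j₂ : S ⟶ S₂) (e : j₁ ≫ k₁ = j₂ ≫ k₂) (a₁ : P.Chart S₁) (a₂ : P.Chart S₂)
      (r₁ : a₁.Ext) (r₂ : a₂.Ext) (h₁ : V.val a₁ r₁ = V.ring.map k₁.op x)
      (h₂ : V.val a₂ r₂ = V.ring.map k₂.op x) :
      P.base.toPsh.res j₁.left S₁.hom S.hom (Over.w j₁) (a₁.toBase r₁.fst) =
        P.base.toPsh.res j₂.left S₂.hom S.hom (Over.w j₂) (a₂.toBase r₂.fst) := by
    rw [← Chart.toBase_resHom, ← Chart.toBase_resHom]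
    refine ((V.val_eq_iff (r := a₁.resExt j₁ r₁) (s := a₂.resExt j₂ r₂)).1 ?_).toBase_eq
    rw [← V.map_val, ← V.map_val, h₁, h₂, ← Functor.map_comp_apply, ← Functor.map_comp_apply,
      ← op_comp, ← op_comp, e]
  obtain ⟨c, hc, -⟩ := hC R hR (fun S k hk => (a k hk).toBase (r S k hk).fst) (by
    intro Y₁ Y₂ Z g₁ g₂ f₁ f₂ h₁ h₂ e
    exact compat f₁ f₂ g₁ g₂ e _ _ _ _ (hr _ _ h₁) (hr _ _ h₂))
  refine ⟨c, fun S k b s hs => ?_⟩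
  refine (hC.isSeparated _ ((K.over P.base.base).pullback_stable k hR)).ext fun S' j hj => ?_
  refine (compat k (j ≫ k) j (𝟙 S') (Category.id_comp _).symm b _ s _ hs (hr _ _ hj)).trans ?_
  refine (congr($(P.base.toPsh.res_id S'.hom (Category.id_comp _)) _)).trans ((hc _ hj).symm.trans ?_)
  exact Functor.map_comp_apply P.base.ring.obj k.op j.op c

/-- The projection to the base algebra. -/
noncomputable def projFun (x : V.ring.obj (op T)) : P.base.sec T.hom :=
  (V.exists_proj x).choose

variable {V} in
lemma toBase_eq_of_val {x : V.ring.obj (op T)} {k : S ⟶ T} {a : P.Chart S} {r : a.Ext}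
    (h : V.val a r = V.ring.map k.op x) :
    a.toBase r.fst = P.base.toPsh.res k.left T.hom S.hom (Over.w k) (V.projFun x) :=
  (V.exists_proj x).choose_spec k a r h

lemma base_ext {Λ : Set (V.ring.obj (op T))} (hΛ : Λ.Finite) {c d : P.base.sec T.hom}
    (h : ∀ ⦃S : Over P.base.base⦄ (k : S ⟶ T) (a : P.Chart S),
      (∀ x ∈ Λ, ∃ r, V.val a r = V.ring.map k.op x) →
        P.base.toPsh.res k.left T.hom S.hom (Over.w k) c =
          P.base.toPsh.res k.left T.hom S.hom (Over.w k) d) : c = d := by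
  obtain ⟨R, hR, H⟩ := V.exists_lift Λ hΛ
  refine ((AlgOver.forget_isSheaf P.base.ring).isSeparated R hR).ext fun S k hk => ?_
  obtain ⟨a, ha⟩ := H k hk
  exact h k a ha

lemma projFun_val (a : P.Chart T) (r : a.Ext) : V.projFun (V.val a r) = a.toBase r.fst := by
  have h := toBase_eq_of_val (x := V.val a r) (k := 𝟙 T) (a := a) (r := r)
    congr($(V.ring.map_id (op T)) _).symm
  exact (h.trans congr($(P.base.toPsh.res_id T.hom (Category.id_comp _)) _)).symm

lemma projFun_map (k : S ⟶ T) (x : V.ring.obj (op T)) :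
    V.projFun (V.ring.map k.op x) =
      P.base.toPsh.res k.left T.hom S.hom (Over.w k) (V.projFun x) := by
  refine V.base_ext (Set.finite_singleton (V.ring.map k.op x)) fun S' j a ha => ?_
  obtain ⟨r, hr⟩ := ha _ rfl
  refine (toBase_eq_of_val hr).symm.trans ((toBase_eq_of_val (k := j ≫ k) (hr.trans
    (Functor.map_comp_apply V.ring k.op j.op x).symm)).trans ?_)
  exact congr($(PshOver.res_res P.base.toPsh j.left k.left T.hom S.hom S'.hom (Over.w k) (Over.w j)) _).symm

noncomputable def proj (T : Over P.base.base) : V.ring.obj (op T) →+* P.base.sec T.hom where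
  toFun := V.projFun
  map_zero' := V.base_ext Set.finite_empty fun S k a _ => by
    refine (toBase_eq_of_val (r := (0 : a.Ext)) ?_).symm.trans ?_
    · rw [map_zero]
      exact (map_zero (V.ring.map k.op).hom).symm
    · exact (map_zero a.toBase).trans (map_zero (P.base.toPsh.res k.left T.hom S.hom (Over.w k)).hom).symm
  map_one' := V.base_ext Set.finite_empty fun S k a _ => by
    refine (toBase_eq_of_val (r := (1 : a.Ext)) ?_).symm.trans ?_
    · rw [map_one]
      exact (map_one (V.ring.map k.op).hom).symm
    · exact (map_one a.toBase).trans (map_one (P.base.toPsh.res k.left T.hom S.hom (Over.w k)).hom).symm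
  map_add' x y := V.base_ext (Set.toFinite {x, y}) fun S k a ha => by
    obtain ⟨r, hr⟩ := ha x (by simp)
    obtain ⟨s, hs⟩ := ha y (by simp)
    refine (toBase_eq_of_val (r := r + s) ?_).symm.trans ?_
    · rw [map_add, hr, hs]
      exact (map_add (V.ring.map k.op).hom x y).symm
    · refine (map_add a.toBase r.fst s.fst).trans ?_
      rw [toBase_eq_of_val hr, toBase_eq_of_val hs]
      exact (map_add (P.base.toPsh.res k.left T.hom S.hom (Over.w k)).hom _ _).symm
  map_mul' x y := V.base_ext (Set.toFinite {x, y}) fun S k a ha => by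
    obtain ⟨r, hr⟩ := ha x (by simp)
    obtain ⟨s, hs⟩ := ha y (by simp)
    refine (toBase_eq_of_val (r := r * s) ?_).symm.trans ?_
    · rw [map_mul, hr, hs]
      exact (map_mul (V.ring.map k.op).hom x y).symm
    · refine (map_mul a.toBase r.fst s.fst).trans ?_
      rw [toBase_eq_of_val hr, toBase_eq_of_val hs]
      exact (map_mul (P.base.toPsh.res k.left T.hom S.hom (Over.w k)).hom _ _).symm

end Realization

end ActOver

end SqZero

/-! ### The kernel, the structure map and the size of a realization. -/

namespace SqZero

variable {E : Type (u + 1)} [Category.{u} E] {K : GrothendieckTopology E}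
  {A B : Sheaf K CommRingCat.{u}} {φ : A ⟶ B}
  {M : PresheafOfModules.{u} (B.obj ⋙ forget₂ CommRingCat.{u} RingCat.{u})}

namespace ActOver

universe w

variable {P : ActOver (derPresheaf φ M)}

/-- The section `p_a(y) + n` of a chart. -/
def Chart.pair {T : Over P.base.base} (a : P.Chart T) (y : a.sec) (n : M.obj (op T.left)) : a.Ext :=
  (y, n)

/-- The sections `p_a(y)` of a chart. -/
noncomputable def Chart.inlHom {T : Over P.base.base} (a : P.Chart T) : a.sec →+* a.Ext :=
  TrivSqZeroExt.inlHom a.sec a.Shift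

/-- The chart over `s` given by a section of `P` over `h : Y ⟶ P.base` and a map `t`. -/
abbrev chartOf {Y : AlgOver φ} (h : Y ⟶ P.base) (p : P.toPsh.psh.obj (op (Over.mk h))) {T : E}
    (t : T ⟶ Y.base) (s : T ⟶ P.base.base) (hs : t ≫ AlgOver.Hom.bs h = s) :
    P.Chart (Over.mk s) :=
  ⟨Y, h, p, t, hs⟩

namespace Realization

variable (V : Realization.{u, w} P) {S T : Over P.base.base}

section

variable (hP : P.fib.IsTorsor ((AlgOver.topology φ).over P.base))
include hP

lemma val_pair_eq_iff {a : P.Chart T} {n n' : M.obj (op T.left)} :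
    V.val a (a.pair 0 n) = V.val a (a.pair 0 n') ↔ n = n' := by
  refine ⟨fun h => ?_, fun h => h ▸ rfl⟩
  exact (sub_eq_zero.1 ((V.val_eq_iff.1 h).eq_zero hP)).symm

/-- The symbol `p_a(0) + n` does not depend on the chart, since derivations vanish at zero. -/
lemma exists_incl (n : M.obj (op T.left)) : ∃ x : V.ring.obj (op T),
    ∀ ⦃S : Over P.base.base⦄ (k : S ⟶ T) (a : P.Chart S),
      V.ring.map k.op x = V.val a (a.pair 0 (M.map k.left.op n)) := by
  refine V.exists_glue (fun S k a => a.pair 0 (M.map k.left.op n)) (fun S S' j k a => ?_)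
    (fun S k a b => V.val_eq_iff.2 ?_)
  · exact TrivSqZeroExt.ext (map_zero (a.resHom j)) (module_map_comp j.left k.left n).symm
  · exact (congrArg (Chart.Diff a b 0 0) (sub_self (M.map k.left.op n : M.obj (op S.left)))).mpr
      (Chart.Diff.zero hP)

noncomputable def inclFun (n : M.obj (op T.left)) : V.ring.obj (op T) :=
  (V.exists_incl hP n).choose

lemma map_inclFun (k : S ⟶ T) (a : P.Chart S) (n : M.obj (op T.left)) :
    V.ring.map k.op (V.inclFun hP n) = V.val a (a.pair 0 (M.map k.left.op n)) :=
  (V.exists_incl hP n).choose_spec k a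

lemma inclFun_eq_val (a : P.Chart T) (n : M.obj (op T.left)) :
    V.inclFun hP n = V.val a (a.pair 0 n) := by
  have h := V.map_inclFun hP (𝟙 T) a n
  refine congr($(V.ring.map_id (op T)) _).symm.trans (h.trans ?_)
  exact congrArg (fun z => V.val a (a.pair 0 z)) (module_map_id n)

lemma inclFun_map (k : S ⟶ T) (n : M.obj (op T.left)) :
    V.ring.map k.op (V.inclFun hP n) = V.inclFun hP (T := S) (M.map k.left.op n) := by
  refine V.ext_of_chart fun S' j a => ?_
  refine (Functor.map_comp_apply V.ring k.op j.op _).symm.trans ((V.map_inclFun hP (j ≫ k) a n).trans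
    (Eq.trans ?_ (V.map_inclFun hP j a _).symm))
  exact congrArg (fun z => V.val a (a.pair 0 z)) (module_map_comp j.left k.left n)

/-- The inclusion of the module. -/
noncomputable def incl (T : Over P.base.base) : M.obj (op T.left) →+ V.ring.obj (op T) where
  toFun := V.inclFun hP
  map_zero' := V.ext_of_chart fun S k a => by
    refine (V.map_inclFun hP k a 0).trans (Eq.trans ?_ (map_zero (V.ring.map k.op).hom).symm)
    rw [← map_zero (V.val a)]
    exact congrArg (fun z => V.val a (a.pair 0 z)) (map_zero (M.map k.left.op).hom)
  map_add' m n := V.ext_of_chart fun S k a => by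
    refine (V.map_inclFun hP k a _).trans (Eq.trans ?_ (map_add (V.ring.map k.op).hom _ _).symm)
    have h₁ : (V.ring.map k.op).hom (V.inclFun hP m) = _ := V.map_inclFun hP k a m
    have h₂ : (V.ring.map k.op).hom (V.inclFun hP n) = _ := V.map_inclFun hP k a n
    rw [h₁, h₂, ← map_add]
    exact congrArg (V.val a) (TrivSqZeroExt.ext (add_zero (0 : a.sec)).symm
      (map_add (M.map k.left.op).hom m n))

lemma incl_injective (hM : Presheaf.IsSheaf K M.presheaf) (T : Over P.base.base) :
    Function.Injective (V.incl hP T) := fun m n h => by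
  obtain ⟨R, hR, H⟩ := V.exists_lift (T := T) ∅ Set.finite_empty
  refine ((AlgOver.overPsh_isSheaf hM P.base.base).isSeparated R hR).ext fun S k hk => ?_
  obtain ⟨a, -⟩ := H k hk
  refine (V.val_pair_eq_iff hP (a := a)).1 ?_
  exact (V.map_inclFun hP k a m).symm.trans ((congrArg (V.ring.map k.op) h).trans
    (V.map_inclFun hP k a n))

lemma proj_incl (n : M.obj (op T.left)) : V.proj T (V.incl hP T n) = 0 :=
  V.base_ext Set.finite_empty fun S k a _ =>
    (toBase_eq_of_val (V.map_inclFun hP k a n).symm).symm.trans ((map_zero a.toBase).trans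
      (map_zero (P.base.toPsh.res k.left T.hom S.hom (Over.w k)).hom).symm)

/-- Locally `x = p_a(y) + m'` with `y` mapping to zero in `C`. Then `p_a(0) - p_a(y) = m` for some
`m`, so `x = p_a(0) + (m' - m)` lies in `M`. Injectivity of the inclusion glues these local
elements. -/
lemma proj_eq_zero_iff (hM : Presheaf.IsSheaf K M.presheaf) (x : V.ring.obj (op T)) :
    V.proj T x = 0 ↔ ∃ n, V.incl hP T n = x := by
  refine ⟨fun h => ?_, fun ⟨n, hn⟩ => hn ▸ V.proj_incl hP n⟩
  obtain ⟨R, hR, H⟩ := V.exists_lift {x} (Set.finite_singleton x)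
  have hex (S : Over P.base.base) (k : S ⟶ T) (hk : R k) :
      ∃ n : M.obj (op S.left), V.inclFun hP n = V.ring.map k.op x := by
    obtain ⟨a, ha⟩ := H k hk
    obtain ⟨r, hr⟩ := ha x rfl
    have h₀ : a.toBase 0 = a.toBase r.fst := by
      refine (map_zero a.toBase).trans (Eq.symm ((toBase_eq_of_val hr).trans ?_))
      exact (congrArg (P.base.toPsh.res k.left T.hom S.hom (Over.w k)) h).trans
        (map_zero (P.base.toPsh.res k.left T.hom S.hom (Over.w k)).hom)
    obtain ⟨m, hm⟩ := Chart.exists_diff hP h₀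
    let m' : M.obj (op S.left) := r.snd
    refine ⟨m' - m, (V.inclFun_eq_val hP a _).trans (Eq.trans (V.val_eq_iff.2 ?_) hr)⟩
    rw [← sub_sub_cancel m' m] at hm
    exact hm
  choose n hn using hex
  obtain ⟨m, hm, -⟩ := AlgOver.overPsh_isSheaf hM P.base.base R hR n (by
    intro Y₁ Y₂ Z g₁ g₂ f₁ f₂ h₁ h₂ e
    refine V.incl_injective hP hM Z ?_
    refine (V.inclFun_map hP g₁ _).symm.trans (Eq.trans ?_ (V.inclFun_map hP g₂ _))
    rw [hn, hn, ← Functor.map_comp_apply, ← Functor.map_comp_apply, ← op_comp, ← op_comp, e])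
  refine ⟨m, V.ext_of_cover hR fun S k hk => ?_⟩
  exact (V.inclFun_map hP k m).trans ((congrArg (V.inclFun hP) (hm k hk)).trans (hn S k hk))

lemma mul_incl (x : V.ring.obj (op T)) (n : M.obj (op T.left)) :
    x * V.incl hP T n = V.incl hP T
      ((show B.obj.obj (op T.left) from P.base.toBAt T.hom (V.proj T x)) • n) := by
  obtain ⟨R, hR, H⟩ := V.exists_lift {x} (Set.finite_singleton x)
  refine V.ext_of_cover hR fun S k hk => ?_
  obtain ⟨a, ha⟩ := H k hk
  obtain ⟨r, hr⟩ := ha x rfl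
  refine (map_mul (V.ring.map k.op).hom _ _).trans (Eq.trans ?_ (V.map_inclFun hP k a _).symm)
  have h₁ : (V.ring.map k.op).hom (V.incl hP T n) = _ := V.map_inclFun hP k a n
  have h₂ : (V.ring.map k.op).hom x = _ := hr.symm
  rw [h₁, h₂, ← map_mul]
  refine congrArg (V.val a) (TrivSqZeroExt.ext (mul_zero r.fst) ?_)
  let n' : M.obj (op S.left) := M.map k.left.op n
  have e : (r * a.pair 0 n').snd = (a.toB r.fst • n' : M.obj (op S.left)) :=
    (congrArg (_ + ·) (zero_smul (a.sec)ᵐᵒᵖ r.snd)).trans (add_zero _)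
  refine e.trans (Eq.trans ?_ (AlgOver.map_smul_apply k.left _ n).symm)
  refine congrArg (fun b : B.obj.obj (op S.left) => b • n') ?_
  rw [Chart.toB_eq, toBase_eq_of_val hr]
  exact AlgOver.res_toBAt_apply P.base k.left T.hom S.hom (Over.w k) (V.projFun x)

lemma exists_locally_lift (c : P.base.sec T.hom) : ∃ R ∈ K.over P.base.base T,
    ∀ ⦃S : Over P.base.base⦄ (k : S ⟶ T), R k → ∃ x : V.ring.obj (op S),
      V.proj S x = P.base.toPsh.res k.left T.hom S.hom (Over.w k) c := by
  obtain ⟨R, hR, H⟩ := Chart.exists_lift hP T {c} (Set.finite_singleton c)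
  refine ⟨R, hR, fun S k hk => ?_⟩
  obtain ⟨a, ha⟩ := H k hk
  obtain ⟨y, hy⟩ := ha c rfl
  exact ⟨V.val a (a.pair y 0), (V.projFun_val a _).trans hy⟩

/-- Derivations kill `A`, so the structure maps of all charts agree. -/
lemma exists_str (c : A.obj.obj (op T.left)) : ∃ x : V.ring.obj (op T),
    ∀ ⦃S : Over P.base.base⦄ (k : S ⟶ T) (a : P.Chart S),
      V.ring.map k.op x = V.val a (a.pair (a.strHom (A.obj.map k.left.op c)) 0) := by
  refine V.exists_glue (fun S k a => a.pair (a.strHom (A.obj.map k.left.op c)) 0)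
    (fun S S' j k a => ?_) (fun S k a b => V.val_eq_iff.2 ?_)
  · refine TrivSqZeroExt.ext ((a.strHom_map j _).symm.trans ?_) (map_zero (M.map j.left.op).hom)
    exact congrArg (a.res j).strHom (Functor.map_comp_apply A.obj k.left.op j.left.op c).symm
  · have h := Chart.Diff.strHom hP a b (A.obj.map k.left.op c)
    rw [← sub_self (0 : M.obj (op S.left))] at h
    exact h

noncomputable def strFun (c : A.obj.obj (op T.left)) : V.ring.obj (op T) :=
  (V.exists_str hP c).choose

lemma map_strFun (k : S ⟶ T) (a : P.Chart S) (c : A.obj.obj (op T.left)) :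
    V.ring.map k.op (V.strFun hP c) = V.val a (a.pair (a.strHom (A.obj.map k.left.op c)) 0) :=
  (V.exists_str hP c).choose_spec k a

lemma strFun_eq_val (a : P.Chart T) (c : A.obj.obj (op T.left)) :
    V.strFun hP c = V.val a (a.pair (a.strHom c) 0) := by
  have h := V.map_strFun hP (𝟙 T) a c
  refine congr($(V.ring.map_id (op T)) _).symm.trans (h.trans ?_)
  exact congrArg (fun z => V.val a (a.pair (a.strHom z) 0)) congr($(A.obj.map_id (op T.left)) c)

lemma strFun_map (k : S ⟶ T) (c : A.obj.obj (op T.left)) :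
    V.ring.map k.op (V.strFun hP c) = V.strFun hP (T := S) (A.obj.map k.left.op c) := by
  refine V.ext_of_chart fun S' j a => ?_
  refine (Functor.map_comp_apply V.ring k.op j.op _).symm.trans ((V.map_strFun hP (j ≫ k) a c).trans
    (Eq.trans ?_ (V.map_strFun hP j a _).symm))
  exact congrArg (fun z => V.val a (a.pair (a.strHom z) 0))
    (Functor.map_comp_apply A.obj k.left.op j.left.op c)

/-- The structure map. -/
noncomputable def str (T : Over P.base.base) : A.obj.obj (op T.left) →+* V.ring.obj (op T) where
  toFun := V.strFun hP
  map_zero' := V.ext_of_chart fun S k a => by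
    refine (V.map_strFun hP k a 0).trans (Eq.trans ?_ (map_zero (V.ring.map k.op).hom).symm)
    rw [map_zero, map_zero, ← map_zero (V.val a)]
    rfl
  map_one' := V.ext_of_chart fun S k a => by
    refine (V.map_strFun hP k a 1).trans (Eq.trans ?_ (map_one (V.ring.map k.op).hom).symm)
    rw [map_one, map_one, ← map_one (V.val a)]
    rfl
  map_add' c d := V.ext_of_chart fun S k a => by
    refine (V.map_strFun hP k a _).trans (Eq.trans ?_ (map_add (V.ring.map k.op).hom _ _).symm)
    have h₁ : (V.ring.map k.op).hom (V.strFun hP c) = _ := V.map_strFun hP k a c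
    have h₂ : (V.ring.map k.op).hom (V.strFun hP d) = _ := V.map_strFun hP k a d
    rw [h₁, h₂, ← map_add, map_add, map_add]
    exact congrArg (V.val a) (TrivSqZeroExt.ext rfl (add_zero (0 : M.obj (op S.left))).symm)
  map_mul' c d := V.ext_of_chart fun S k a => by
    refine (V.map_strFun hP k a _).trans (Eq.trans ?_ (map_mul (V.ring.map k.op).hom _ _).symm)
    have h₁ : (V.ring.map k.op).hom (V.strFun hP c) = _ := V.map_strFun hP k a c
    have h₂ : (V.ring.map k.op).hom (V.strFun hP d) = _ := V.map_strFun hP k a d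
    rw [h₁, h₂, ← map_mul, map_mul, map_mul]
    exact congrArg (V.val a) (TrivSqZeroExt.inl_mul a.Shift _ _)

lemma proj_str (c : A.obj.obj (op T.left)) : V.proj T (V.str hP T c) = P.base.strAt T.hom c :=
  V.base_ext Set.finite_empty fun S k a _ =>
    (toBase_eq_of_val (V.map_strFun hP k a c).symm).symm.trans ((a.toBase_strHom _).trans
      (AlgOver.strAt_res_apply P.base k.left T.hom S.hom (Over.w k) c).symm)

/-- Each nonempty fibre of the projection to `C` embeds in `M` by subtracting a base point. Both `C`
and `M` lie in universe `u`, although the charts do not. -/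
lemma small (hM : Presheaf.IsSheaf K M.presheaf) (T : Over P.base.base) :
    Small.{u} (V.ring.obj (op T)) := by
  have h (c : P.base.sec T.hom) : Small.{u} {x // V.proj T x = c} := by
    by_cases hc : ∃ x, V.proj T x = c
    · obtain ⟨x₀, rfl⟩ := hc
      have hx (x : {x // V.proj T x = V.proj T x₀}) : ∃ n, V.incl hP T n = x.1 - x₀ :=
        (V.proj_eq_zero_iff hP hM _).1 (by rw [map_sub, x.2, sub_self])
      choose f hf using hx
      refine small_of_injective (f := f) fun x y e => Subtype.ext ?_
      have h := (hf x).symm.trans ((congrArg _ e).trans (hf y))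
      exact sub_left_injective h
    · have : IsEmpty {x // V.proj T x = c} := ⟨fun x => hc ⟨x.1, x.2⟩⟩
      infer_instance
  exact small_map (Equiv.sigmaFiberEquiv (V.proj T)).symm

end

end Realization

/-- A torsor has a realization in the universe of the algebras. -/
lemma exists_realization (hP : P.fib.IsTorsor ((AlgOver.topology φ).over P.base))
    (hM : Presheaf.IsSheaf K M.presheaf) : Nonempty (Realization.{u, u} P) := by
  let V := germRealization hP hM
  have : ∀ T, Small.{u} (V.ring.obj T) := fun T => V.small hP hM T.unop
  obtain ⟨H, e, he⟩ := exists_shrink V.ring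
  refine ⟨{ ring := H
            isSheaf := ?_
            val := fun {T} a => (e (op T)).toRingHom.comp (V.val a)
            map_val := fun k a r => (he k.op _).symm.trans (congrArg (e _) (V.map_val k a r))
            val_eq_iff := fun {T a b r s} => (e (op T)).injective.eq_iff.trans V.val_eq_iff
            exists_lift := fun {T} Λ hΛ => ?_ }⟩
  · exact (Presieve.isSheaf_iff_of_nat_equiv (P₁ := V.ring ⋙ forget CommRingCat.{u + 1})
      (P₂ := H ⋙ forget CommRingCat.{u}) (fun T => (e (op T)).toEquiv)
      fun T S k x => he k.op x).1 V.isSheaf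
  · obtain ⟨R, hR, h⟩ := V.exists_lift ((e (op T)).symm '' Λ) (hΛ.image _)
    refine ⟨R, hR, fun S k hk => ?_⟩
    obtain ⟨a, ha⟩ := h k hk
    refine ⟨a, fun x hx => ?_⟩
    obtain ⟨r, hr⟩ := ha _ ⟨x, hx, rfl⟩
    refine ⟨r, (congrArg (e _) hr).trans ((he k.op _).trans ?_)⟩
    exact congrArg (H.map k.op) ((e (op T)).apply_symm_apply x)

end ActOver

end SqZero

/-! ### The extension of a realization and the comparison with the torsor. -/

namespace SqZero

variable {E : Type (u + 1)} [Category.{u} E] {K : GrothendieckTopology E}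
  {A B : Sheaf K CommRingCat.{u}} {φ : A ⟶ B}
  {M : PresheafOfModules.{u} (B.obj ⋙ forget₂ CommRingCat.{u} RingCat.{u})}

namespace ActOver

variable {P : ActOver (derPresheaf φ M)}

namespace Realization

variable (V : Realization.{u, u} P) (hP : P.fib.IsTorsor ((AlgOver.topology φ).over P.base))
  (hM : Presheaf.IsSheaf K M.presheaf)

/-- The extension of the base algebra which a realization defines. -/
noncomputable def toExal : ExalOver φ M where
  base := P.base
  ext :=
    { ring := ⟨V.ring, isSheaf_of_forget V.ring V.isSheaf⟩
      str := ⟨{ app := fun T => CommRingCat.ofHom (V.str hP T.unop)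
                naturality := fun S T k => CommRingCat.hom_ext (RingHom.ext fun c =>
                  (V.strFun_map hP k.unop c).symm) }⟩
      proj := ⟨{ app := fun T => CommRingCat.ofHom (V.proj T.unop)
                 naturality := fun S T k => CommRingCat.hom_ext (RingHom.ext fun x =>
                  V.projFun_map k.unop x) }⟩
      str_proj := by
        ext T : 3
        exact CommRingCat.hom_ext (RingHom.ext fun c => V.proj_str hP c)
      incl := fun T => V.incl hP T.unop
      incl_map := fun S T k m => V.inclFun_map hP k.unop m
      incl_injective := fun T => V.incl_injective hP hM T.unop
      proj_eq_zero_iff := fun T x => V.proj_eq_zero_iff hP hM x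
      locallySurjective :=
        ⟨fun {T} c => by
          obtain ⟨R, hR, H⟩ := V.exists_locally_lift hP (T := T) c
          exact (K.over P.base.base).superset_covering (fun S k hk => H k hk) hR⟩
      mul_incl := fun T x m => V.mul_incl hP x m }

/-- The section of the extension which corresponds to a section of the torsor. -/
noncomputable def sectionOf {Y : AlgOver φ} (h : Y ⟶ P.base)
    (p : P.toPsh.psh.obj (op (Over.mk h))) : Y ⟶ (V.toExal hP hM).total :=
  AlgOver.homOfAt (Y := (V.toExal hP hM).total) (AlgOver.Hom.bs (Y := P.base) h)
    -- A point `p` over `Y` turns each map `t` into a chart; the section is `y ↦ p_a(y)`.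
    (fun {T} t => (V.val (chartOf h p t _ rfl)).comp (chartOf h p t _ rfl).inlHom)
    (fun {S T} k t s hs y => by
      subst hs
      let k' : Over.mk ((k ≫ t) ≫ AlgOver.Hom.bs h) ⟶ Over.mk (t ≫ AlgOver.Hom.bs h) :=
        Over.homMk k (Category.assoc _ _ _).symm
      refine Eq.trans ?_ (V.map_val k' (chartOf h p t _ rfl) ((chartOf h p t _ rfl).inlHom y)).symm
      refine congrArg (V.val (T := Over.mk ((k ≫ t) ≫ AlgOver.Hom.bs h)) _) ?_
      exact TrivSqZeroExt.ext rfl (map_zero (M.map k.op).hom).symm)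
    (fun {T} t r => (V.strFun_eq_val hP (chartOf h p t _ rfl) r).symm)
    (fun {T} t y => (congrArg (P.base.toBAt (t ≫ AlgOver.Hom.bs h))
        (V.projFun_val (chartOf h p t _ rfl) ((chartOf h p t _ rfl).inlHom y))).trans
      (AlgOver.at_toBAt_apply h t _ rfl y))

lemma sectionOf_at {Y : AlgOver φ} (h : Y ⟶ P.base) (p : P.toPsh.psh.obj (op (Over.mk h))) {T : E}
    (t : T ⟶ Y.base) (s : T ⟶ P.base.base) (hs : t ≫ AlgOver.Hom.bs h = s) (y : Y.sec t) :
    AlgOver.Hom.at (V.sectionOf hP hM h p) t s hs y =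
      V.val (chartOf h p t s hs) ((chartOf h p t s hs).inlHom y) := by
  subst hs
  exact congr($(PshOver.Hom.at_eq (X := Y.toPsh) (Y := (V.toExal hP hM).total.toPsh)
    (AlgOver.Hom.hom (V.sectionOf hP hM h p)) t) y)

lemma sectionOf_toBase {Y : AlgOver φ} (h : Y ⟶ P.base)
    (p : P.toPsh.psh.obj (op (Over.mk h))) :
    V.sectionOf hP hM h p ≫ (V.toExal hP hM).toBase = h := by
  have hb : AlgOver.Hom.bs (V.sectionOf hP hM h p ≫ (V.toExal hP hM).toBase) = AlgOver.Hom.bs h :=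
    Category.comp_id (AlgOver.Hom.bs h)
  refine AlgOver.hom_ext_at hb fun T t s hs hs' y => ?_
  have e : s ≫ AlgOver.Hom.bs (X := (V.toExal hP hM).total) (Y := P.base) (V.toExal hP hM).toBase = s :=
    Category.comp_id s
  refine (AlgOver.at_comp_apply (V.sectionOf hP hM h p) (V.toExal hP hM).toBase t s s hs hs' e
    y).trans ?_
  refine congr($((V.toExal hP hM).toBase_at s e) _).trans ?_
  refine (congrArg (V.proj (Over.mk s)) (V.sectionOf_at hP hM h p t s hs' y)).trans ?_
  exact V.projFun_val (T := Over.mk s) _ _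

/-- The chart on `Z` with the restricted point maps to the chart on `Y` through `g`, with zero
derivation between the points. -/
lemma sectionOf_res {Y Z : AlgOver φ} (g : Z ⟶ Y) (h : Y ⟶ P.base) (r : Z ⟶ P.base)
    (hr : g ≫ h = r) (p : P.toPsh.psh.obj (op (Over.mk h))) :
    V.sectionOf hP hM r (P.toPsh.res g h r hr p) = g ≫ V.sectionOf hP hM h p := by
  have hb : AlgOver.Hom.bs (V.sectionOf hP hM r (P.toPsh.res g h r hr p)) =
      AlgOver.Hom.bs (g ≫ V.sectionOf hP hM h p) := (congrArg AlgOver.Hom.bs hr).symm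
  refine AlgOver.hom_ext_at hb fun T t s hs hs' y => ?_
  have e : (t ≫ AlgOver.Hom.bs g) ≫ AlgOver.Hom.bs (V.sectionOf hP hM h p) = s :=
    (Category.assoc _ _ _).trans hs'
  refine (V.sectionOf_at hP hM r _ t s hs y).trans (Eq.trans ?_
    (AlgOver.at_comp_apply g (V.sectionOf hP hM h p) t _ s hs' rfl e y).symm)
  refine Eq.trans (V.val_eq_iff.2 ?_) (V.sectionOf_at hP hM h p _ s e _).symm
  have H := Chart.Diff.of_hom (P := P) (T := Over.mk s) (a := chartOf r (P.toPsh.res g h r hr p) t s hs)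
    (b := chartOf h p (t ≫ AlgOver.Hom.bs g) s e) g hr rfl 0 (P.fib.zero_act _) y
  exact (congrArg (Chart.Diff _ _ _ _) (sub_zero (0 : M.obj (op T)))).mpr H

/-- The charts of `p` and of its translate by `δ` have the same algebra, and their points differ by
`δ`, so the symbols differ by `δ(y)`. -/
lemma sectionOf_act {Y : AlgOver φ} (h : Y ⟶ P.base) (δ : Y.Der M)
    (p : P.toPsh.psh.obj (op (Over.mk h))) :
    V.sectionOf hP hM h (P.act h (show (derPresheaf φ M).obj (op Y) from δ) p) =
      ExalOver.translate (V.sectionOf hP hM h p) δ := by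
  refine AlgOver.hom_ext_at rfl fun T t s hs hs' y => ?_
  refine (V.sectionOf_at hP hM h _ t s hs y).trans (Eq.trans ?_
    (ExalOver.translate_at (V.sectionOf hP hM h p) δ t s hs y).symm)
  let b : P.Chart (Over.mk s) := chartOf h p t s hs
  have e : AlgOver.Hom.at (V.sectionOf hP hM h p) t s hs y +
      (V.toExal hP hM).inclAt s (AlgOver.Der.at δ t y) =
      V.val b (b.pair y (AlgOver.Der.at δ t y)) := by
    refine (congrArg₂ (fun x z : V.ring.obj (op (Over.mk s)) => x + z)
      (V.sectionOf_at hP hM h p t s hs y)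
      (V.inclFun_eq_val hP b (AlgOver.Der.at δ t y))).trans ?_
    refine (map_add (V.val b) _ _).symm.trans (congrArg (V.val b) ?_)
    exact TrivSqZeroExt.ext (add_zero (show b.sec from y))
      (zero_add (AlgOver.Der.at δ t y : M.obj (op T)))
  refine Eq.trans (V.val_eq_iff.2 ?_) e.symm
  let a : P.Chart (Over.mk s) :=
    chartOf h (P.act h (show (derPresheaf φ M).obj (op Y) from δ) p) t s hs
  have H := Chart.Diff.of_hom (a := a) (b := b) (𝟙 Y) (Category.id_comp _) (Category.comp_id _) δ
    (congrArg (P.act h _) congr($(P.toPsh.res_id h (Category.id_comp _)) p)) y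
  have e₁ : AlgOver.Hom.at (𝟙 Y) t t (Category.comp_id t) y = y :=
    congr($(PshOver.Hom.id_at_self Y.toPsh t _) y)
  refine (congrArg (Chart.Diff a b y y)
    (sub_zero (AlgOver.Der.at δ t y : M.obj (op T)))).mpr ?_
  exact (congrArg (fun y' : b.sec => Chart.Diff a b y y' (AlgOver.Der.at δ t y)) e₁).mp H

/-- The comparison of the torsor with the torsor of sections of the extension. -/
noncomputable def toSections : P.fib.psh ⟶ (V.toExal hP hM).toActOver.fib.psh where
  app T := ↾ fun p => (Over.homMk (V.sectionOf hP hM T.unop.hom p)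
    (V.sectionOf_toBase hP hM T.unop.hom p) : T.unop ⟶ Over.mk (V.toExal hP hM).toBase)
  naturality S T k := by
    ext p
    exact Over.OverMorphism.ext
      (V.sectionOf_res hP hM k.unop.left S.unop.hom T.unop.hom (Over.w k.unop) p)

lemma toSections_act (T : (Over P.base)ᵒᵖ) (δ : (derPresheaf φ M).obj (op T.unop.left))
    (p : P.fib.psh.obj T) : (V.toSections hP hM).app T (P.fib.act δ p) =
      (V.toExal hP hM).toActOver.fib.act (T := T) δ ((V.toSections hP hM).app T p) :=
  Over.OverMorphism.ext (V.sectionOf_act hP hM T.unop.hom δ p)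

end Realization

end ActOver

end SqZero

/-! ### Essential surjectivity and the equivalence of fibered categories. -/

namespace SqZero

section

universe u₁ v₁ w₁
variable {D : Type u₁} [Category.{v₁} D] {G : Dᵒᵖ ⥤ AddCommGrpCat.{w₁}}

namespace ActOver

variable {X : D} {F F' F'' : ActPresheaf ((Over.forget X).op ⋙ G)}

/-- An equivariant map between presheaves on the slice over `X`, as a morphism over `X`. -/
def fibHom (θ : F.psh ⟶ F'.psh)
    (hθ : ∀ (T : (Over X)ᵒᵖ) (g : ((Over.forget X).op ⋙ G).obj T) (p : F.psh.obj T),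
      θ.app T (F.act g p) = F'.act g (θ.app T p)) :
    (⟨X, F⟩ : ActOver G) ⟶ ⟨X, F'⟩ :=
  { hom :=
      { base := 𝟙 _
        app := θ ≫ (PshOver.Hom.id (⟨X, F'⟩ : ActOver G).toPsh).app }
    at_act := fun T t s h g p => by
      obtain rfl : t = s := (Category.comp_id t).symm.trans h
      have e : PshOver.Hom.at (X := (⟨X, F⟩ : ActOver G).toPsh) (Y := (⟨X, F'⟩ : ActOver G).toPsh)
          ⟨𝟙 _, θ ≫ (PshOver.Hom.id (⟨X, F'⟩ : ActOver G).toPsh).app⟩ t t h =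
            θ.app (op (Over.mk t)) :=
        ((Category.assoc _ _ _).trans (congrArg (_ ≫ ·)
          (PshOver.Hom.id_at_self (⟨X, F'⟩ : ActOver G).toPsh t h))).trans (Category.comp_id _)
      exact congr($e _).trans ((hθ (op (Over.mk t)) g p).trans (congrArg (F'.act (T := op (Over.mk t)) g)
        congr($e p).symm)) }

variable {θ : F.psh ⟶ F'.psh} {hθ : ∀ (T : (Over X)ᵒᵖ) (g : ((Over.forget X).op ⋙ G).obj T)
  (p : F.psh.obj T), θ.app T (F.act g p) = F'.act g (θ.app T p)}

lemma fibHom_at {T : D} (t : T ⟶ X) (h : t ≫ 𝟙 X = t) :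
    (Hom.hom (fibHom θ hθ)).at t t h = θ.app (op (Over.mk t)) :=
  ((Category.assoc _ _ _).trans (congrArg (_ ≫ ·)
    (PshOver.Hom.id_at_self (⟨X, F'⟩ : ActOver G).toPsh t h))).trans (Category.comp_id _)

lemma fibHom_comp_eq_id {θ' : F'.psh ⟶ F.psh}
    {hθ' : ∀ (T : (Over X)ᵒᵖ) (g : ((Over.forget X).op ⋙ G).obj T) (p : F'.psh.obj T),
      θ'.app T (F'.act g p) = F.act g (θ'.app T p)} (e : θ ≫ θ' = 𝟙 _) :
    fibHom θ hθ ≫ fibHom θ' hθ' = 𝟙 _ := by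
  refine Hom.ext (PshOver.Hom.ext (Category.comp_id (𝟙 X)) fun T t s h h' => ?_)
  obtain rfl : t = s := (Category.comp_id t).symm.trans h'
  have h₁ : t ≫ 𝟙 X = t := Category.comp_id t
  refine (comp_hom_at (fibHom θ hθ) (fibHom θ' hθ') t t t h h₁ h₁).trans ?_
  rw [fibHom_at, fibHom_at]
  refine congr(($e).app (op (Over.mk t))).trans ?_
  exact (PshOver.Hom.id_at_self (⟨X, F⟩ : ActOver G).toPsh t h').symm

/-- Equivariant maps of torsors are bijective on sections, and the inverse is again equivariant. The
result lies over the identity, as an equivalence over the base requires. -/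
lemma exists_iso {L : GrothendieckTopology D} (hF : F.IsTorsor (L.over X))
    (hF' : F'.IsTorsor (L.over X)) (θ : F.psh ⟶ F'.psh)
    (hθ : ∀ (T : (Over X)ᵒᵖ) (g : ((Over.forget X).op ⋙ G).obj T) (p : F.psh.obj T),
      θ.app T (F.act g p) = F'.act g (θ.app T p)) :
    ∃ e : (⟨X, F⟩ : ActOver G) ≅ ⟨X, F'⟩, (ActOver.proj G).map e.hom = 𝟙 X ∧
      (ActOver.proj G).map e.inv = 𝟙 X := by
  have hT (T : (Over X)ᵒᵖ) : IsIso (θ.app T) := (isIso_iff_bijective _).2 (hF.bijective hF' θ hθ T)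
  have : IsIso θ := NatIso.isIso_of_isIso_app θ
  have hi (T : (Over X)ᵒᵖ) (g : ((Over.forget X).op ⋙ G).obj T) (p : F'.psh.obj T) :
      (inv θ).app T (F'.act g p) = F.act g ((inv θ).app T p) := by
    refine (hF.bijective hF' θ hθ T).injective ?_
    have e (q : F'.psh.obj T) : θ.app T ((inv θ).app T q) = q :=
      congr(($(IsIso.inv_hom_id θ)).app T q)
    rw [e, hθ, e]
  exact ⟨⟨fibHom θ hθ, fibHom (inv θ) hi, fibHom_comp_eq_id (IsIso.hom_inv_id θ),
    fibHom_comp_eq_id (IsIso.inv_hom_id θ)⟩, rfl, rfl⟩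

end ActOver

end

variable {E : Type (u + 1)} [Category.{u} E] {K : GrothendieckTopology E}
  {A B : Sheaf K CommRingCat.{u}} {φ : A ⟶ B}
  {M : PresheafOfModules.{u} (B.obj ⋙ forget₂ CommRingCat.{u} RingCat.{u})}

/-- Every torsor is the torsor of sections of an extension. -/
lemma ActOver.exists_exalOver {P : ActOver (derPresheaf φ M)}
    (hP : P.fib.IsTorsor ((AlgOver.topology φ).over P.base)) (hM : Presheaf.IsSheaf K M.presheaf)
    (h : ∀ X : ExalOver φ M, X.toActOver.fib.IsTorsor ((AlgOver.topology φ).over X.base)) :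
    ∃ (X : Exal P.base.str (P.base.mod M)) (e : (⟨P.base, X⟩ : ExalOver φ M).toActOver ≅ P),
      (ActOver.proj (derPresheaf φ M)).map e.hom = 𝟙 P.base := by
  obtain ⟨V⟩ := exists_realization hP hM
  obtain ⟨e, -, he⟩ := ActOver.exists_iso hP (h (V.toExal hP hM)) (V.toSections hP hM)
    (V.toSections_act hP hM)
  exact ⟨(V.toExal hP hM).ext, e.symm, he⟩

lemma exalToTorsors_essSurj (hM : Presheaf.IsSheaf K M.presheaf)
    (h : ∀ X : ExalOver φ M, X.toActOver.fib.IsTorsor ((AlgOver.topology φ).over X.base))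
    (P : (classifyingStack (AlgOver.topology φ) (derPresheaf φ M)).obj) :
    ∃ (X : (exalFibered φ M).obj) (e : (exalToTorsors h).obj X ≅ P),
      (classifyingStack (AlgOver.topology φ) (derPresheaf φ M)).p.IsHomLift
        (𝟙 ((classifyingStack (AlgOver.topology φ) (derPresheaf φ M)).p.obj P)) e.hom := by
  let Q : (ActOver.isTorsor (AlgOver.topology φ) (derPresheaf φ M)).FullSubcategory := P
  obtain ⟨X, e, he⟩ := Q.obj.exists_exalOver Q.property hM h
  let X' : ExalOver φ M := ⟨Q.obj.base, X⟩
  let e' : (⟨X'.toActOver, h X'⟩ : (ActOver.isTorsor (AlgOver.topology φ)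
    (derPresheaf φ M)).FullSubcategory) ≅ Q := ObjectProperty.isoMk _ e
  refine ⟨X', e', ?_⟩
  have hl := IsHomLift.map ((ActOver.isTorsor (AlgOver.topology φ) (derPresheaf φ M)).ι ⋙
    ActOver.proj (derPresheaf φ M)) e'.hom
  have he' : ((ActOver.isTorsor (AlgOver.topology φ) (derPresheaf φ M)).ι ⋙
    ActOver.proj (derPresheaf φ M)).map e'.hom = 𝟙 Q.obj.base := he
  rw [he'] at hl
  exact hl

theorem exalToTorsors_isBasedEquivalence (hM : Presheaf.IsSheaf K M.presheaf)
    (h : ∀ X : ExalOver φ M, X.toActOver.fib.IsTorsor ((AlgOver.topology φ).over X.base)) :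
    IsBasedEquivalence (exalToTorsors h) :=
  have := exalToTorsors_full h
  have := exalToTorsors_faithful h
  IsBasedEquivalence.of_fullyFaithful (exalToTorsors h) (exalToTorsors_essSurj hM h)

/-- Cartesian lifts of extensions come from restriction of torsors through the comparison functor,
so no pullback of extensions is constructed by hand. -/
theorem exalFibered_isFibered (hM : Presheaf.IsSheaf K M.presheaf) :
    (exalFibered φ M).p.IsFibered :=
  have h (X : ExalOver φ M) := X.toActOver_isTorsor
  have := exalToTorsors_full h
  have := exalToTorsors_faithful h
  have := classifyingStack_isFibered (AlgOver.topology φ) (derPresheaf φ M)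
  isFibered_of_fullyFaithful (exalToTorsors h) (exalToTorsors_essSurj hM h)

end SqZero

/-! ### The final object `(⊤, B)` and the torsor of a global extension. -/

namespace SqZero

section

universe u₁ v₁ w₁
variable {D : Type u₁} [Category.{v₁} D]

/-- A presheaf is a sheaf if its restriction to the slice over a weakly terminal object is one. -/
lemma isSheaf_of_over {L : GrothendieckTopology D} {X : D} (t : ∀ Y, Y ⟶ X) {P : Dᵒᵖ ⥤ Type w₁}
    {F : (Over X)ᵒᵖ ⥤ Type w₁} (θ : (Over.forget X).op ⋙ P ⟶ F)
    (hθ : ∀ T, Function.Bijective (θ.app T)) (hF : Presieve.IsSheaf (L.over X) F) :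
    Presieve.IsSheaf L P := by
  intro Y S hS x hx
  have hS' := L.overEquiv_symm_mem_over (Over.mk (t Y)) S hS
  have nat {S T : Over X} (k : S ⟶ T) (p : P.obj (op T.left)) :
      θ.app (op S) (P.map k.left.op p) = F.map k.op (θ.app (op T) p) :=
    congr($(θ.naturality k.op) p)
  have mem {Z : Over X} {g : Z ⟶ Over.mk (t Y)}
      (hg : (Sieve.overEquiv (Over.mk (t Y))).symm S g) : S g.left := hg
  obtain ⟨y, hy, hu⟩ := hF _ hS' (fun Z g hg => θ.app (op Z) (x g.left (mem hg))) (by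
    intro Y₁ Y₂ Z g₁ g₂ f₁ f₂ h₁ h₂ e
    refine (nat g₁ _).symm.trans (Eq.trans ?_ (nat g₂ _))
    exact congrArg (θ.app (op Z)) (hx g₁.left g₂.left (mem h₁) (mem h₂) congr(($e).left)))
  obtain ⟨z, rfl⟩ := (hθ _).surjective y
  refine ⟨z, fun Z g hg => ?_, fun z' hz' => (hθ (op (Over.mk (t Y)))).injective (hu _ ?_)⟩
  · let g' : Over.mk (g ≫ t Y) ⟶ Over.mk (t Y) := Over.homMk g rfl
    refine (hθ (op (Over.mk (g ≫ t Y)))).injective ((nat g' z).trans (hy g' ?_))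
    exact hg
  · intro Z g hg
    exact (nat g z').symm.trans (congrArg (θ.app (op Z)) (hz' g.left (mem hg)))

variable {G : Dᵒᵖ ⥤ AddCommGrpCat.{w₁}} {L : GrothendieckTopology D}

lemma ActPresheaf.IsTorsor.of_over {X : D} (t : ∀ Y, Y ⟶ X) {P : ActPresheaf G}
    {F : ActPresheaf ((Over.forget X).op ⋙ G)} (θ : (Over.forget X).op ⋙ P.psh ⟶ F.psh)
    (hθ : ∀ T, Function.Bijective (θ.app T))
    (hact : ∀ (T : (Over X)ᵒᵖ) (g : G.obj (op T.unop.left)) (p : P.psh.obj (op T.unop.left)),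
      θ.app T (P.act g p) = F.act (T := T) g (θ.app T p))
    (hF : F.IsTorsor (L.over X)) : P.IsTorsor L where
  isSheaf := isSheaf_of_over t θ hθ hF.isSheaf
  existsUnique {T} p q := by
    obtain ⟨g, hg, hu⟩ := hF.existsUnique (T := op (Over.mk (t T.unop)))
      (θ.app (op (Over.mk (t T.unop))) p) (θ.app (op (Over.mk (t T.unop))) q)
    refine ⟨g, (hθ (op (Over.mk (t T.unop)))).injective ((hact _ g p).trans hg), fun g' hg' => ?_⟩
    exact hu g' ((hact (op (Over.mk (t T.unop))) g' p).symm.trans (congrArg _ hg'))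
  locally_nonempty T := by
    obtain ⟨S, hS, H⟩ := ActPresheaf.over_locally_nonempty hF (t T)
    refine ⟨S, hS, fun T' k hk => ?_⟩
    obtain ⟨p⟩ := H k hk _ rfl
    exact ⟨((hθ (op (Over.mk (k ≫ t T)))).surjective p).choose⟩

/-- The restriction to the slice over `X`. -/
def ActPresheaf.over (P : ActPresheaf G) (X : D) : ActPresheaf ((Over.forget X).op ⋙ G) where
  psh := (Over.forget X).op ⋙ P.psh
  act g p := P.act g p
  zero_act p := P.zero_act p
  add_act g h p := P.add_act g h p
  map_act _ g p := P.map_act _ g p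

lemma ActPresheaf.IsTorsor.over {P : ActPresheaf G} (hP : P.IsTorsor L) (X : D) :
    (P.over X).IsTorsor (L.over X) where
  isSheaf := (Over.forget X).op_comp_isSheaf_of_types (L.over X) L
    ⟨P.psh, (isSheaf_iff_isSheaf_of_type _ _).2 hP.isSheaf⟩
  existsUnique p q := hP.existsUnique p q
  locally_nonempty := ActPresheaf.over_locally_nonempty' fun {T} t => by
    obtain ⟨S, hS, hne⟩ := hP.locally_nonempty T
    exact ⟨S, hS, hne⟩

end

variable {E : Type (u + 1)} [Category.{u} E] [HasTerminal E] {K : GrothendieckTopology E}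
  {A B : Sheaf K CommRingCat.{u}} {φ : A ⟶ B}
  {M : PresheafOfModules.{u} (B.obj ⋙ forget₂ CommRingCat.{u} RingCat.{u})}

namespace AlgOver

variable (φ) in
/-- The final object `(⊤, B)`. -/
noncomputable def final : AlgOver φ where
  base := ⊤_ E
  ring := B.over _
  str := (K.overPullback CommRingCat.{u} _).map φ
  toB := 𝟙 _
  str_toB := Category.comp_id _

noncomputable def toFinal (Y : AlgOver φ) : Y ⟶ final φ :=
  homOfAt (Y := final φ) (terminal.from _) (fun t => (Y.toBAt t).hom)
    (fun k t s h x => Y.res_toBAt_apply k t s h x)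
    (fun t r => congr(($(Y.str_toB)).hom.app (op (Over.mk t)) r))
    (fun _ _ => rfl)

/-- The algebra of the final object is `B` itself, so a map over `B` is forced. -/
lemma hom_final_ext {Y : AlgOver φ} (f g : Y ⟶ final φ) : f = g :=
  hom_ext_at (terminal.hom_ext _ _) fun _ t s h h' x =>
    (at_toBAt_apply f t s h x).trans (at_toBAt_apply g t s h' x).symm

end AlgOver

namespace Exal

/-- A global extension as an extension over the final object. -/
noncomputable def toOver (X : Exal φ M) : ExalOver φ M where
  base := AlgOver.final φ
  ext :=
    { ring := X.ring.over _
      str := (K.overPullback CommRingCat.{u} _).map X.str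
      proj := (K.overPullback CommRingCat.{u} _).map X.proj
      str_proj := ((K.overPullback CommRingCat.{u} (⊤_ E)).map_comp X.str X.proj).symm.trans
        (congrArg _ X.str_proj)
      incl := fun T => X.incl (op T.unop.left)
      incl_map := fun S T k m => X.incl_map k.unop.left.op m
      incl_injective := fun T => X.incl_injective _
      proj_eq_zero_iff := fun T x => X.proj_eq_zero_iff (op T.unop.left) x
      locallySurjective :=
        ⟨fun {T} c => by
          have h := X.locallySurjective.imageSieve_mem (U := T.left) c
          refine (K.over _).superset_covering (fun S k hk => ?_) (K.overEquiv_symm_mem_over T _ h)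
          exact hk⟩
      mul_incl := fun T x m => X.mul_incl (op T.unop.left) x m }

variable {X : Exal φ M} {Y Z : AlgOver φ}

/-- A lift as a morphism to the total algebra. -/
noncomputable def Lift.toHom (s : X.Lift Y) : Y ⟶ X.toOver.total :=
  AlgOver.homOfAt (Y := X.toOver.total) (terminal.from _) (fun t => (s.app t).hom)
    (fun k t r h x => congr($(s.res_at k t r h) x))
    (fun t r => congr($(s.strAt_at t) r)) (fun t x => congr($(s.at_proj t) x))

lemma Lift.toHom_at (s : X.Lift Y) {T : E} (t : T ⟶ Y.base) (r : T ⟶ ⊤_ E)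
    (h : t ≫ AlgOver.Hom.bs s.toHom = r) (y : Y.sec t) :
    AlgOver.Hom.at s.toHom t r h y = s.app t y := by
  subst h
  exact congr($(PshOver.Hom.at_eq (X := Y.toPsh) (Y := X.toOver.total.toPsh)
    (AlgOver.Hom.hom s.toHom) t) y)

lemma Lift.toHom_bijective : Function.Bijective (Lift.toHom : X.Lift Y → (Y ⟶ X.toOver.total)) := by
  refine ⟨fun s s' e => Lift.hext fun T t => CommRingCat.hom_ext (RingHom.ext fun y => ?_),
    fun f => ?_⟩
  · refine (s.toHom_at t _ rfl y).symm.trans (Eq.trans ?_ (s'.toHom_at t _ (by rw [e]) y))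
    exact AlgOver.at_congr_hom e t _ rfl y
  · refine ⟨Lift.mk' (fun T t => (AlgOver.Hom.at f t _ rfl).hom)
      (fun S T k t r h y => AlgOver.res_at_apply f k t r _ _ h rfl rfl
        (terminal.hom_ext _ _) y)
      (fun T t a => AlgOver.at_strAt_apply f t _ rfl a)
      (fun T t y => AlgOver.at_toBAt_apply f t _ rfl y), ?_⟩
    refine AlgOver.hom_ext_at (terminal.hom_ext _ _) fun T t s h h' y => ?_
    refine (Lift.toHom_at _ t s h y).trans ?_
    subst h'
    rfl

lemma Lift.toHom_comp (f : Z ⟶ Y) (s : X.Lift Y) : (s.comp f).toHom = f ≫ s.toHom := by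
  refine AlgOver.hom_ext_at (terminal.hom_ext _ _) fun T t r h h' y => ?_
  refine (Lift.toHom_at _ t r h y).trans (Eq.trans ?_ (AlgOver.at_comp_apply f s.toHom t
    (t ≫ AlgOver.Hom.bs f) r h' rfl (terminal.hom_ext _ _) y).symm)
  exact congr($(Lift.comp_at f s t _ rfl) y).trans (s.toHom_at _ r _ _).symm

lemma Lift.toHom_translate (s : X.Lift Y) (δ : Y.Der M) :
    (s.translate δ).toHom = ExalOver.translate s.toHom δ := by
  refine AlgOver.hom_ext_at (terminal.hom_ext _ _) fun T t r h h' y => ?_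
  refine (Lift.toHom_at _ t r h y).trans (Eq.trans ?_
    (ExalOver.translate_at s.toHom δ t r (terminal.hom_ext _ _) y).symm)
  exact congrArg (fun z : X.ring.obj.obj (op T) => z + X.incl (op T) (AlgOver.Der.at δ t y))
    (s.toHom_at t r (terminal.hom_ext _ _) y).symm

/-- The sections of a global extension over `T`, as sections over the final object. -/
noncomputable def liftToOver (X : Exal φ M) :
    (Over.forget (AlgOver.final φ)).op ⋙ X.liftPresheaf.psh ⟶ X.toOver.toActOver.fib.psh where
  app T := ↾ fun s => (Over.homMk (Lift.toHom s) (AlgOver.hom_final_ext _ _) :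
    T.unop ⟶ Over.mk X.toOver.toBase)
  naturality S T k := by
    ext s
    exact Over.OverMorphism.ext (Lift.toHom_comp k.unop.left s)

lemma liftToOver_bijective (X : Exal φ M) (T : (Over (AlgOver.final φ))ᵒᵖ) :
    Function.Bijective (X.liftToOver.app T) := by
  refine ⟨fun s s' e => Lift.toHom_bijective.injective congr(($e).left), fun f => ?_⟩
  obtain ⟨s, hs⟩ := Lift.toHom_bijective.surjective (show T.unop ⟶ Over.mk X.toOver.toBase from f).left
  exact ⟨s, Over.OverMorphism.ext hs⟩

lemma liftToOver_act (X : Exal φ M) (T : (Over (AlgOver.final φ))ᵒᵖ)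
    (δ : (derPresheaf φ M).obj (op T.unop.left)) (s : X.Lift T.unop.left) :
    X.liftToOver.app T (X.liftPresheaf.act δ s) =
      X.toOver.toActOver.fib.act (T := T) δ (X.liftToOver.app T s) :=
  Over.OverMorphism.ext (Lift.toHom_translate s δ)

/-- Every object maps to `(⊤, B)`, so the torsor property can be tested on the slice over it, where
lifts are the sections of the represented presheaf. -/
theorem liftPresheaf_isTorsor (X : Exal φ M) : X.liftPresheaf.IsTorsor (AlgOver.topology φ) :=
  .of_over AlgOver.toFinal X.liftToOver X.liftToOver_bijective X.liftToOver_act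
    X.toOver.toActOver_isTorsor

end Exal

end SqZero

/-! ### Isomorphism classes of global extensions and cohomology classes. -/

namespace SqZero

variable {E : Type (u + 1)} [Category.{u} E] {K : GrothendieckTopology E}
  {A B : Sheaf K CommRingCat.{u}} {φ : A ⟶ B}
  {M : PresheafOfModules.{u} (B.obj ⋙ forget₂ CommRingCat.{u} RingCat.{u})}

namespace Exal

section

variable {X X' : Exal φ M}

/-- The map of lifts induced by a map of extensions. -/
def Lift.map {Y : AlgOver φ} (f : X ⟶ X') (s : X.Lift Y) : X'.Lift Y :=
  Lift.mk' (fun T t => (f.hom.hom.app (op T)).hom.comp (s.app t).hom)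
    (fun S _ k t r h y => (congrArg (f.hom.hom.app (op S)) congr($(s.res_at k t r h) y)).trans
      congr($(f.hom.hom.naturality k.op) (s.app t y)))
    (fun T t a => (congrArg (f.hom.hom.app (op T)) congr($(s.strAt_at t) a)).trans
      congr(($(f.str_hom)).hom.app (op T) a))
    (fun T t y => (congr(($(f.hom_proj)).hom.app (op T) (s.app t y))).trans
      congr($(s.at_proj t) y))

/-- The map of torsors induced by a map of extensions. -/
noncomputable def liftPresheafMap (f : X ⟶ X') : X.liftPresheaf.psh ⟶ X'.liftPresheaf.psh where
  app T := ↾ fun s => Lift.map f s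
  naturality S T k := by
    ext s
    exact Lift.hext fun _ _ => rfl

lemma liftPresheafMap_act (f : X ⟶ X') (T : (AlgOver φ)ᵒᵖ) (δ : (derPresheaf φ M).obj T)
    (s : X.liftPresheaf.psh.obj T) : (liftPresheafMap f).app T (X.liftPresheaf.act δ s) =
      X'.liftPresheaf.act δ ((liftPresheafMap f).app T s) :=
  Lift.hext fun T _ => CommRingCat.hom_ext (RingHom.ext fun _ =>
    (map_add (f.hom.hom.app (op T)).hom _ _).trans (congrArg (_ + ·) (f.hom_incl (op T) _)))

variable [HasTerminal E]

/-- A map of extensions over the final object as a map of global extensions. -/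
noncomputable def ofOver (f : X.toOver ⟶ X'.toOver) : X ⟶ X' where
  hom :=
    ⟨{ app := fun T => AlgOver.Hom.at (ExalOver.Hom.total f) (terminal.from T.unop)
          (terminal.from T.unop) (terminal.hom_ext _ _)
       naturality := fun S T k => AlgOver.Hom.res_at (ExalOver.Hom.total f) k.unop
          (terminal.from S.unop) (terminal.from T.unop) _ _ (terminal.hom_ext _ _) _ _
          (terminal.hom_ext _ _) }⟩
  str_hom := by
    ext T : 3
    exact AlgOver.Hom.strAt_at (ExalOver.Hom.total f) (terminal.from T.unop) (terminal.from T.unop)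
      (terminal.hom_ext _ _)
  hom_proj := by
    ext T : 3
    exact AlgOver.Hom.at_toBAt (ExalOver.Hom.total f) (terminal.from T.unop) (terminal.from T.unop)
      (terminal.hom_ext _ _)
  hom_incl T m := ExalOver.Hom.at_inclAt f (terminal.from T.unop) (terminal.from T.unop)
    (terminal.hom_ext _ _) m

lemma ofOver_comp_eq_id (f : X.toOver ⟶ X'.toOver) (g : X'.toOver ⟶ X.toOver) (h : f ≫ g = 𝟙 _) :
    ofOver f ≫ ofOver g = 𝟙 X := by
  refine Hom.ext ?_
  ext T : 3
  refine CommRingCat.hom_ext (RingHom.ext fun x => ?_)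
  have h' : ExalOver.Hom.total f ≫ ExalOver.Hom.total g = 𝟙 X.toOver.total :=
    congrArg ExalOver.Hom.total h
  let t := terminal.from T.unop
  change AlgOver.Hom.at (ExalOver.Hom.total g) t t (terminal.hom_ext _ _)
    (AlgOver.Hom.at (ExalOver.Hom.total f) t t (terminal.hom_ext _ _) x) = x
  refine (AlgOver.at_comp_apply (ExalOver.Hom.total f) (ExalOver.Hom.total g)
    t t t (terminal.hom_ext _ _) (terminal.hom_ext _ _) (terminal.hom_ext _ _) x).symm.trans ?_
  refine (AlgOver.at_congr_hom h' t t (terminal.hom_ext _ _) x).trans ?_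
  exact congr($(PshOver.Hom.id_at_self X.toOver.total.toPsh (terminal.from T.unop) _) x)

/-- Over the final object `θ` becomes an isomorphism of torsors represented by extensions. Full
faithfulness turns it into an isomorphism of extensions, which then descends. -/
lemma nonempty_iso_of_hom (θ : X.liftPresheaf.psh ⟶ X'.liftPresheaf.psh)
    (hθ : ∀ (T : (AlgOver φ)ᵒᵖ) (δ : (derPresheaf φ M).obj T) (s : X.liftPresheaf.psh.obj T),
      θ.app T (X.liftPresheaf.act δ s) = X'.liftPresheaf.act δ (θ.app T s)) :
    Nonempty (X ≅ X') := by
  have hX := X.liftPresheaf_isTorsor.over (AlgOver.final φ)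
  have hX' := X'.liftPresheaf_isTorsor.over (AlgOver.final φ)
  obtain ⟨e₁, -⟩ := ActOver.exists_iso hX X.toOver.toActOver_isTorsor X.liftToOver
    X.liftToOver_act
  obtain ⟨e₂, -⟩ := ActOver.exists_iso hX' X'.toOver.toActOver_isTorsor X'.liftToOver
    X'.liftToOver_act
  obtain ⟨e, -⟩ := ActOver.exists_iso hX hX'
    (Functor.whiskerLeft (Over.forget (AlgOver.final φ)).op θ) fun T δ s => hθ _ δ s
  have := ExalOver.toActOverFunctor_full (φ := φ) (M := M)
  have := ExalOver.toActOverFunctor_faithful (φ := φ) (M := M)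
  let i : X.toOver ≅ X'.toOver :=
    (ExalOver.toActOverFunctor φ M).preimageIso (e₁.symm ≪≫ e ≪≫ e₂)
  exact ⟨⟨ofOver i.hom, ofOver i.inv, ofOver_comp_eq_id _ _ i.hom_inv_id,
    ofOver_comp_eq_id _ _ i.inv_hom_id⟩⟩

/-- A map to a torsor from the presheaf of lifts, from a map over the final object. -/
lemma exists_hom_of_over {P : ActPresheaf (derPresheaf φ M)}
    (χ : X.toOver.toActOver ⟶ ⟨AlgOver.final φ, P.over _⟩) :
    ∃ θ : X.liftPresheaf.psh ⟶ P.psh, ∀ (T : (AlgOver φ)ᵒᵖ) (δ : (derPresheaf φ M).obj T)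
      (s : X.liftPresheaf.psh.obj T), θ.app T (X.liftPresheaf.act δ s) = P.act δ (θ.app T s) := by
  let Q : ActOver (derPresheaf φ M) := ⟨AlgOver.final φ, P.over _⟩
  let χ' : PshOver.Hom X.toOver.toActOver.toPsh Q.toPsh := ActOver.Hom.hom χ
  have hχ (Y : AlgOver φ) : Y.toFinal ≫ χ'.base = Y.toFinal := AlgOver.hom_final_ext _ _
  -- Each `Y` has exactly one map to the final object, so evaluating `χ` there defines a map on the
  -- whole site.
  let f (Y : AlgOver φ) (s : X.Lift Y) : P.psh.obj (op Y) :=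
    χ'.at Y.toFinal Y.toFinal (hχ Y) (X.liftToOver.app (op (Over.mk Y.toFinal)) s)
  refine ⟨{ app := fun T => ↾ f T.unop, naturality := fun S T k => ?_ }, fun T δ s => ?_⟩
  · ext s
    have hk : k.unop ≫ S.unop.toFinal = T.unop.toFinal := AlgOver.hom_final_ext _ _
    have e₁ := congr($(X.liftToOver.naturality (Over.homMk k.unop hk :
      Over.mk T.unop.toFinal ⟶ Over.mk S.unop.toFinal).op) s)
    refine (congrArg (χ'.at T.unop.toFinal T.unop.toFinal (hχ _)) e₁).trans ?_
    exact congr($(PshOver.Hom.res_at χ' k.unop S.unop.toFinal T.unop.toFinal _ _ hk (hχ _) (hχ _)) _)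
  · refine (congrArg (χ'.at T.unop.toFinal T.unop.toFinal (hχ _))
      (X.liftToOver_act (op (Over.mk T.unop.toFinal)) δ s)).trans ?_
    exact ActOver.Hom.at_act χ T.unop.toFinal T.unop.toFinal (hχ _) δ _

end

variable [HasTerminal E]

section

variable (X : Exal (AlgOver.final φ).str ((AlgOver.final φ).mod M))

variable (E) in
noncomputable def toOverTop : E ⥤ Over (⊤_ E) where
  obj T := Over.mk (terminal.from T)
  map k := Over.homMk k

/-- An extension over the final object as a global extension. -/
noncomputable def descend : Exal φ M where
  ring := ⟨(toOverTop E).op ⋙ X.ring.obj, by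
    -- An object over `⊤` is isomorphic, but not equal, to its underlying object with the terminal
    -- map. `θ` is restriction along this isomorphism.
    let θ : (Over.forget (⊤_ E)).op ⋙ (toOverTop E).op ⋙ X.ring.obj ⟶ X.ring.obj :=
      { app := fun T => X.ring.obj.map (Over.homMk (𝟙 _) (terminal.hom_ext _ _) :
          T.unop ⟶ Over.mk (terminal.from T.unop.left)).op
        naturality := fun S T k => by
          refine (X.ring.obj.map_comp _ _).symm.trans (Eq.trans ?_ (X.ring.obj.map_comp _ _))
          refine congrArg X.ring.obj.map (Quiver.Hom.unop_inj (Over.OverMorphism.ext ?_))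
          exact (Category.id_comp k.unop.left).trans (Category.comp_id _).symm }
    refine isSheaf_of_forget _ (isSheaf_of_over (fun T => terminal.from T)
      (Functor.whiskerRight θ (forget CommRingCat.{u})) (fun T => ?_)
      (AlgOver.forget_isSheaf X.ring))
    let i : T.unop ≅ Over.mk (terminal.from T.unop.left) :=
      Over.isoMk (Iso.refl _) (terminal.hom_ext _ _)
    exact (isIso_iff_bijective _).1 (((X.ring.obj ⋙ forget CommRingCat.{u}).mapIso i.op).isIso_hom)⟩
  str := ⟨{ app := fun T => X.str.hom.app (op (Over.mk (terminal.from T.unop)))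
            naturality := fun S T k => X.str.hom.naturality ((toOverTop E).map k.unop).op }⟩
  proj := ⟨{ app := fun T => X.proj.hom.app (op (Over.mk (terminal.from T.unop)))
             naturality := fun S T k => X.proj.hom.naturality ((toOverTop E).map k.unop).op }⟩
  str_proj := by
    ext T : 3
    exact congr(($(X.str_proj)).hom.app (op (Over.mk (terminal.from T.unop))))
  incl T := X.incl (op (Over.mk (terminal.from T.unop)))
  incl_map S T k m := X.incl_map ((toOverTop E).map k.unop).op m
  incl_injective T := X.incl_injective _
  proj_eq_zero_iff T x := X.proj_eq_zero_iff (op (Over.mk (terminal.from T.unop))) x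
  locallySurjective :=
    ⟨fun {T} c => by
      have h := X.locallySurjective.imageSieve_mem (U := Over.mk (terminal.from T)) c
      refine K.superset_covering (fun S k hk => ?_) h
      obtain ⟨x, hx⟩ := (Sieve.overEquiv_iff (Y := Over.mk (terminal.from T)) _ k).1 hk
      let j : Over.mk (terminal.from S) ⟶ Over.mk (k ≫ terminal.from T) :=
        Over.homMk (𝟙 S) (terminal.hom_ext _ _)
      refine ⟨X.ring.obj.map j.op x, ?_⟩
      refine congr($(X.proj.hom.naturality j.op) x).trans ?_
      refine (congrArg (B.obj.map (𝟙 S).op) hx).trans ?_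
      exact congr($(B.obj.map_id (op S)) _)⟩
  mul_incl T x m := X.mul_incl (op (Over.mk (terminal.from T.unop))) x m

/-- The comparison of `X` with the restriction of `X.descend`. -/
noncomputable def descendToOver : X.descend.toOver ⟶ (⟨AlgOver.final φ, X⟩ : ExalOver φ M) :=
  let W : ExalOver φ M := ⟨AlgOver.final φ, X⟩
  { base := 𝟙 _
    total := AlgOver.homOfAt (X := X.descend.toOver.total) (Y := W.total) (𝟙 _)
      (fun {T} t => (W.total.toPsh.res (𝟙 T) (terminal.from T) (t ≫ 𝟙 _) (terminal.hom_ext _ _)).hom)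
      (fun {S T} k t s h x =>
        (AlgOver.res_res_apply W.total (𝟙 S) k (terminal.from T) (terminal.from S) _
          (terminal.hom_ext _ _) _ k (Category.id_comp k) (terminal.hom_ext _ _) x).trans
        (AlgOver.res_res_apply W.total k (𝟙 T) (terminal.from T) (t ≫ 𝟙 _) _
          (terminal.hom_ext _ _) (terminal.hom_ext _ _) k (Category.comp_id k)
          (terminal.hom_ext _ _) x).symm)
      (fun {T} t r => (W.total.strAt_res_apply (𝟙 T) (terminal.from T) _ _ r).trans
        (congrArg (W.total.strAt (t ≫ 𝟙 _)) congr($(A.obj.map_id (op T)) r)))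
      (fun {T} t x => (W.total.res_toBAt_apply (𝟙 T) (terminal.from T) _ _ x).trans
        congr($(B.obj.map_id (op T)) _))
    w := AlgOver.hom_final_ext _ _
    at_inclAt := fun T t s h m => by
      subst h
      refine (AlgOver.homOfAt_at (X := X.descend.toOver.total) (Y := W.total) _ _ _ _ _ t _).trans ?_
      refine (W.inclAt_res (𝟙 T) (terminal.from T) (t ≫ 𝟙 _) (terminal.hom_ext _ _) m).trans ?_
      exact congrArg (W.inclAt (t ≫ 𝟙 _)) congr($(M.presheaf.map_id (op T)) m) }

end

/-- Essential surjectivity over `(⊤, B)`, followed by descent. An equivariant map is all that the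
comparison of cohomology classes needs. -/
lemma exists_hom_of_isTorsor {P : ActPresheaf (derPresheaf φ M)}
    (hP : P.IsTorsor (AlgOver.topology φ)) (hM : Presheaf.IsSheaf K M.presheaf) :
    ∃ (X : Exal φ M) (θ : X.liftPresheaf.psh ⟶ P.psh), ∀ (T : (AlgOver φ)ᵒᵖ)
      (δ : (derPresheaf φ M).obj T) (s : X.liftPresheaf.psh.obj T),
        θ.app T (X.liftPresheaf.act δ s) = P.act δ (θ.app T s) := by
  obtain ⟨X, e, -⟩ := ActOver.exists_exalOver (P := ⟨AlgOver.final φ, P.over _⟩)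
    (hP.over (AlgOver.final φ)) hM ExalOver.toActOver_isTorsor
  exact ⟨X.descend, exists_hom_of_over
    ((ExalOver.toActOverFunctor φ M).map X.descendToOver ≫ e.hom)⟩

section

universe w

variable [HasExt.{w} (Sheaf (AlgOver.topology φ) AddCommGrpCat.{u + 1})]

/-- Isomorphism classes of extensions correspond to cohomology classes. -/
theorem exists_equiv_cohomology (hM : Presheaf.IsSheaf K M.presheaf)
    (hDer : Presheaf.IsSheaf (AlgOver.topology φ) (derPresheaf φ M)) :
    ∃ Φ : Quotient (isIsomorphicSetoid (Exal φ M)) ≃ Sheaf.H.{w} (⟨derPresheaf φ M, hDer⟩ :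
      Sheaf (AlgOver.topology φ) AddCommGrpCat.{u + 1}) 1,
      ∀ X : Exal φ M, IsTorsorClass (⟨derPresheaf φ M, hDer⟩ :
        Sheaf (AlgOver.topology φ) AddCommGrpCat.{u + 1}) X.liftPresheaf
          (Φ (Quotient.mk _ X)) := by
  let F : Sheaf (AlgOver.topology φ) AddCommGrpCat.{u + 1} := ⟨derPresheaf φ M, hDer⟩
  choose c hc using fun X : Exal φ M =>
    ActPresheaf.IsTorsor.exists_isTorsorClass (F := F) X.liftPresheaf_isTorsor
  let Φ : Quotient (isIsomorphicSetoid (Exal φ M)) → Sheaf.H.{w} F 1 :=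
    -- The class of `X'` is also a class of the torsor of `X`, by composition with the map induced
    -- by `e`; uniqueness gives equality.
    Quotient.lift c fun X X' ⟨e⟩ => IsTorsorClass.unique X.liftPresheaf_isTorsor (hc X)
      ((hc X').of_hom (liftPresheafMap e.hom) (liftPresheafMap_act e.hom))
  have hΦ : Function.Bijective Φ := by
    refine ⟨fun x x' e => ?_, fun d => ?_⟩
    · induction x using Quotient.inductionOn with | _ X =>
      induction x' using Quotient.inductionOn with | _ X' =>
      have e' : c X = c X' := e
      -- Equal classes give an equivariant map of torsors, hence an isomorphism of extensions.
      obtain ⟨θ, hθ⟩ := IsTorsorClass.exists_hom X'.liftPresheaf_isTorsor (hc X) (e' ▸ hc X')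
      exact Quotient.sound (nonempty_iso_of_hom θ hθ)
    · obtain ⟨P, hP, hd⟩ := exists_isTorsor_isTorsorClass d
      obtain ⟨X, θ, hθ⟩ := exists_hom_of_isTorsor hP hM
      exact ⟨Quotient.mk _ X, IsTorsorClass.unique X.liftPresheaf_isTorsor (hc X)
        (hd.of_hom θ hθ)⟩
  exact ⟨Equiv.ofBijective Φ hΦ, hc⟩

end

end Exal

/-- A Grothendieck topos has a terminal object. -/
lemma IsGrothendieckTopos.hasTerminal (E : Type (u + 1)) [Category.{u} E]
    [h : IsGrothendieckTopos E] : HasTerminal E := by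
  obtain ⟨C, _, J, ⟨e⟩⟩ := h.exists_equivalence
  exact Adjunction.hasLimitsOfShape_of_equivalence e.functor

end SqZero

theorem mainTheorem3 {E : Type (u + 1)} [Category.{u} E] [SqZero.IsGrothendieckTopos E]
    {A B : Sheaf (Sheaf.canonicalTopology E) CommRingCat.{u}} (φ : A ⟶ B)
    (M : PresheafOfModules.{u} (B.obj ⋙ forget₂ CommRingCat.{u} RingCat.{u}))
    (hM : Presheaf.IsSheaf (Sheaf.canonicalTopology E) M.presheaf) :
    (SqZero.exalFibered φ M).p.IsFibered ∧
    (SqZero.classifyingStack (SqZero.AlgOver.topology φ) (SqZero.derPresheaf φ M)).p.IsFibered ∧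
    (∃ h : ∀ X : SqZero.ExalOver φ M,
        X.toActOver.fib.IsTorsor ((SqZero.AlgOver.topology φ).over X.base),
      SqZero.IsBasedEquivalence (SqZero.exalToTorsors h)) ∧
    ∃ (hDer : Presheaf.IsSheaf (SqZero.AlgOver.topology φ) (SqZero.derPresheaf φ M))
      (Φ : Quotient (isIsomorphicSetoid (SqZero.Exal φ M)) ≃
        Sheaf.H.{u + 1} (⟨SqZero.derPresheaf φ M, hDer⟩ :
          Sheaf (SqZero.AlgOver.topology φ) AddCommGrpCat.{u + 1}) 1),
      ∀ X : SqZero.Exal φ M, X.liftPresheaf.IsTorsor (SqZero.AlgOver.topology φ) ∧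
        SqZero.IsTorsorClass (⟨SqZero.derPresheaf φ M, hDer⟩ :
          Sheaf (SqZero.AlgOver.topology φ) AddCommGrpCat.{u + 1}) X.liftPresheaf
          (Φ (Quotient.mk _ X)) := by
  -- The terminal object of the topos is what provides the final object `(⊤, B)` of the site.
  have := SqZero.IsGrothendieckTopos.hasTerminal E
  have hDer := SqZero.derPresheaf_isSheaf (φ := φ) hM
  obtain ⟨Φ, hΦ⟩ := SqZero.Exal.exists_equiv_cohomology hM hDer
  exact ⟨SqZero.exalFibered_isFibered hM, SqZero.classifyingStack_isFibered _ _,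
    ⟨SqZero.ExalOver.toActOver_isTorsor,
      SqZero.exalToTorsors_isBasedEquivalence hM SqZero.ExalOver.toActOver_isTorsor⟩,
    hDer, Φ, fun X => ⟨X.liftPresheaf_isTorsor, hΦ X⟩⟩
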